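/- **Setting.** Let $K>1$, $n\ge 1$, $m$ be integers, $y^*\in\mathbb R^m$, $\sigma>0$, let $\Pi\subset\mathbb R^n$ be compact and convex, and let $\Theta$ be a compact set of parameters $\theta=(A_k,b_k)_{k=1}^K$ with $A_k\in\mathbb R^{m\times n}$, $b_k\in\mathbb R^m$. A *system* is a triple $(\theta,P,f)$, where $P=(p_{i,j})$ is a $K\times K$ stochastic matrix and $f=(f_k)_{k=1}^K$ are noise laws on $\mathbb R^m$. The states $s_0,s_1,\dots$ form a Markov chain with transition matrix $P$ and some initial law. At stage $t\ge1$ an input $x_t\in\mathbb R^n$ is chosen and $y_t=A_{s_t}x_t+b_{s_t}+w_t$ is observed; given the state path, the noises $w_t$ are independent with $w_t\sim f_{s_t}$. A *policy* chooses $x_t$ as a measurable function of $x_1,\dots,x_{t-1}$, $y_1,\dots,y_{t-1}$, $s_0,\dots,s_{t-1}$ and, possibly, a private random seed independent of the chain and the noise. Put $J(i,x)=\mathbb E(\|y^*-y_t\|_2^2\mid s_{t-1}=i,x_t=x)$ and $$x_i^*=\Bigl(\sum_j p_{i,j}A_j^{\top}A_j\Bigr)^{-1}\sum_j p_{i,j}A_j^{\top}(y^*-b_j),$$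 the minimizer of $J(i,\cdot)$. A system is *admissible* if $\theta\in\Theta$, every $A_k$ has full column rank, $x_i^*\in\Pi$ for every $i$, and every $f_k$ has mean zero with $\mathbb E w_l^2\le\sigma^2$ and $\mathbb E w_l^4\le\sigma^4$ for every coordinate $l$. For a policy $\mu$ let $$\bar{\mathcal E}_T^\mu=\sup\,\mathbb E\sum_{t=1}^T\|x_t^\mu-x^*_{s_{t-1}}\|_2^2,\qquad \bar{\mathcal R}_T^\mu=\sup\,\mathbb E\Bigl(\sum_{t=1}^T J(s_{t-1},x_t^\mu)-\sum_{t=1}^T J(s_{t-1},x^*_{s_{t-1}})\Bigr)$$ (values in $[0,\infty]$), the suprema being over all admissible systems. Assume that the model class is nondegenerate: there is an admissible system with $\theta$ in the interior of $\Theta$ and all $x_i^*$ in the interior of $\Pi$. **MSPSA.** For each state $i$ fix $\gamma_i,\gamma_i'>0$, integers $N_i,N_i'\ge0$ and $\hat x_{i,1}\in\Pi$; put $a_k=\gamma_i/(N_i+k)$, $c_k=\gamma_i'/(N_i'+k)^{1/4}$. Let $\Delta_{i,k}\in\mathbb R^n$ ($k\ge1$) have i.i.d. coordinates whose law is symmetric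 about $0$, bounded, and satisfies $\mathbb E(1/\Delta^2)<\infty$; write $\bar\Delta_{i,k}$ for the vector of inverse coordinates. At the $(2k-1)$-th and the $2k$-th stage whose preceding state is $i$, MSPSA applies $\hat x_{i,k}+c_k\Delta_{i,k}$ and $\hat x_{i,k}-c_k\Delta_{i,k}$, respectively; if $d^+,d^-$ are the two observed values of $\|y_t-y^*\|_2^2$, then $\hat x_{i,k+1}$ is the Euclidean projection onto $\Pi$ of $\hat x_{i,k}-a_k\,\frac{d^+-d^-}{c_k}\,\bar\Delta_{i,k}$. **Theorem.** (1) There are constants $C',C''>0$ such that, for every initial law of the chain, every policy $\mu$ and every $T\ge0$, $$\bar{\mathcal E}_T^\mu\ge C'\sqrt T\qquad\text{and}\qquad\bar{\mathcal R}_T^\mu\ge C''\sqrt T .$$ (2) MSPSA is order-optimal: it is a policy and, if $\gamma_i\ge 1/\bigl(8\lambda_{\min}(\sum_j p_{i,j}A_j^{\top}A_j)\bigr)$ for every $i$ and every admissible system, then its worst-case regret is $\Theta(\sqrt T)$: there are constants $c,C>0$ with $c\sqrt T\le\bar{\mathcal R}_T^{\mathrm{MSPSA}}\le C\sqrt T$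 for every initial law and every $T\ge0$. -/

import Mathlib

open MeasureTheory ProbabilityTheory
open scoped ENNReal

noncomputable section

namespace JumpAffine

/-- Parameters of the affine models: state `k` has the matrix `(θ k).1 = A_k` and the offset
`(θ k).2 = b_k`. -/
abbrev Params (K m n : ℕ) : Type :=
  Fin K → Matrix (Fin m) (Fin n) ℝ × EuclideanSpace ℝ (Fin m)

/-- `A_k x + b_k`. -/
def meanOutput {K m n : ℕ} (θ : Params K m n) (k : Fin K) (x : EuclideanSpace ℝ (Fin n)) :
    EuclideanSpace ℝ (Fin m) :=
  Matrix.toEuclideanLin (θ k).1 x + (θ k).2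

/-- A system: the parameters `θ`, the transition matrix `P` (row `i` is the law of the next state
given the present state `i`), and the noise law `f k` of each state `k`. -/
structure System (K m n : ℕ) where
  θ : Params K m n
  P : Fin K → PMF (Fin K)
  f : Fin K → ProbabilityMeasure (EuclideanSpace ℝ (Fin m))

/-- The transition probability `p_{i,j}` as a real number. -/
def System.p {K m n : ℕ} (e : System K m n) (i j : Fin K) : ℝ := (e.P i j).toReal

/-- `∑ j, p_{i,j} A_jᵀ A_j`. -/
def System.gram {K m n : ℕ} (e : System K m n) (i : Fin K) : Matrix (Fin n) (Fin n) ℝ :=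
  ∑ j, e.p i j • ((e.θ j).1.transpose * (e.θ j).1)

/-- The optimal input after state `i`,
`(∑ j, p_{i,j} A_jᵀ A_j)⁻¹ (∑ j, p_{i,j} A_jᵀ (y* - b_j))`. -/
def System.optInput {K m n : ℕ} (e : System K m n) (ystar : EuclideanSpace ℝ (Fin m))
    (i : Fin K) : EuclideanSpace ℝ (Fin n) :=
  Matrix.toEuclideanLin (e.gram i)⁻¹
    (∑ j, e.p i j • Matrix.toEuclideanLin (e.θ j).1.transpose (ystar - (e.θ j).2))

/-- The quadratic stage cost `E (‖y* - y_t‖² | s_{t-1} = i, x_t = x)`. -/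
def System.stageCost {K m n : ℕ} (e : System K m n) (ystar : EuclideanSpace ℝ (Fin m))
    (i : Fin K) (x : EuclideanSpace ℝ (Fin n)) : ℝ :=
  ∑ j, e.p i j * ∫ w, ‖ystar - (meanOutput e.θ j x + w)‖ ^ 2
    ∂(e.f j : Measure (EuclideanSpace ℝ (Fin m)))

/-- The systems over which the worst case is taken: the parameters lie in `Θ`, all matrices have
full column rank, all optimal inputs lie in `X`, and the noise laws have mean zero, coordinate
variances at most `σ ^ 2` and fourth moments at most `σ ^ 4`. -/
structure System.Admissible {K m n : ℕ} (e : System K m n) (Θ : Set (Params K m n))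
    (X : Set (EuclideanSpace ℝ (Fin n))) (ystar : EuclideanSpace ℝ (Fin m)) (σ : ℝ) : Prop where
  mem_params : e.θ ∈ Θ
  full_rank : ∀ k, (e.θ k).1.rank = n
  optInput_mem : ∀ i, e.optInput ystar i ∈ X
  noise_mean : ∀ k l, ∫ w, w l ∂(e.f k : Measure (EuclideanSpace ℝ (Fin m))) = 0
  noise_second : ∀ k l, ∫⁻ w, ENNReal.ofReal (w l ^ 2)
    ∂(e.f k : Measure (EuclideanSpace ℝ (Fin m))) ≤ ENNReal.ofReal (σ ^ 2)
  noise_fourth : ∀ k l, ∫⁻ w, ENNReal.ofReal (w l ^ 4)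
    ∂(e.f k : Measure (EuclideanSpace ℝ (Fin m))) ≤ ENNReal.ofReal (σ ^ 4)

lemma System.p_nonneg {K m n : ℕ} (e : System K m n) (i j : Fin K) : 0 ≤ e.p i j :=
  ENNReal.toReal_nonneg

lemma System.exists_p_pos {K m n : ℕ} (e : System K m n) (i : Fin K) : ∃ j, 0 < e.p i j := by
  obtain ⟨j, hj⟩ := (e.P i).support_nonempty
  refine ⟨j, ENNReal.toReal_pos ?_ ((e.P i).apply_ne_top j)⟩
  simpa [PMF.mem_support_iff] using hj

lemma eq_zero_of_rank {m n : ℕ} (A : Matrix (Fin m) (Fin n) ℝ)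
    (h : A.rank = n) {x : EuclideanSpace ℝ (Fin n)} (hx : Matrix.toEuclideanLin A x = 0) :
    x = 0 := by
  have hk := LinearMap.finrank_range_add_finrank_ker A.mulVecLin
  rw [← Matrix.rank, h, Module.finrank_fin_fun] at hk
  have hb : LinearMap.ker A.mulVecLin = ⊥ := Submodule.finrank_eq_zero.1 (by omega)
  have h0 : A.mulVecLin x.ofLp = 0 := by
    have := congrArg WithLp.ofLp hx
    simpa [Matrix.toLpLin_apply] using this
  have : x.ofLp = 0 := (LinearMap.ker_eq_bot'.1 hb) _ h0
  ext l
  simpa using congrFun this l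

lemma inner_transpose {m n : ℕ} (A : Matrix (Fin m) (Fin n) ℝ) (h : EuclideanSpace ℝ (Fin n))
    (y : EuclideanSpace ℝ (Fin m)) :
    inner ℝ h (Matrix.toEuclideanLin A.transpose y) = inner ℝ (Matrix.toEuclideanLin A h) y := by
  rw [← Matrix.conjTranspose_eq_transpose_of_trivial,
    Matrix.toEuclideanLin_conjTranspose_eq_adjoint, LinearMap.adjoint_inner_right]

lemma System.toEuclideanLin_gram {K m n : ℕ} (e : System K m n) (i : Fin K)
    (x : EuclideanSpace ℝ (Fin n)) :
    Matrix.toEuclideanLin (e.gram i) x = ∑ j, e.p i j •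
      Matrix.toEuclideanLin (e.θ j).1.transpose (Matrix.toEuclideanLin (e.θ j).1 x) := by
  simp only [System.gram, map_sum, map_smul, LinearMap.sum_apply, LinearMap.smul_apply]
  refine Finset.sum_congr rfl fun j _ => ?_
  congr 1
  ext l
  simp [Matrix.toLpLin_apply]

lemma System.gram_isUnit {K m n : ℕ} (e : System K m n) (hr : ∀ k, (e.θ k).1.rank = n)
    (i : Fin K) : IsUnit (e.gram i) := by
  rw [← Matrix.mulVec_injective_iff_isUnit]
  refine (injective_iff_map_eq_zero (e.gram i).mulVecLin).2 fun v hv => ?_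
  set x : EuclideanSpace ℝ (Fin n) := WithLp.toLp 2 v with hx
  have h0 : Matrix.toEuclideanLin (e.gram i) x = 0 := by
    have hv' : (e.gram i).mulVec v = 0 := hv
    simp [Matrix.toLpLin_apply, hx, hv']
  have h1 : ∑ j, e.p i j * ‖Matrix.toEuclideanLin (e.θ j).1 x‖ ^ 2 = 0 := by
    have h2 : inner ℝ x (Matrix.toEuclideanLin (e.gram i) x) = 0 := by rw [h0, inner_zero_right]
    rw [e.toEuclideanLin_gram, inner_sum] at h2
    simpa only [inner_smul_right, inner_transpose, real_inner_self_eq_norm_sq] using h2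
  obtain ⟨j, hj⟩ := e.exists_p_pos i
  have h3 := (Finset.sum_eq_zero_iff_of_nonneg fun j _ =>
    mul_nonneg (e.p_nonneg i j) (sq_nonneg _)).1 h1 j (Finset.mem_univ j)
  have h4 : Matrix.toEuclideanLin (e.θ j).1 x = 0 := by
    simpa [hj.ne'] using h3
  exact congrArg WithLp.ofLp (eq_zero_of_rank _ (hr j) h4)

lemma integral_norm_sub_sq {m : ℕ} (f : ProbabilityMeasure (EuclideanSpace ℝ (Fin m)))
    (σ : ℝ) (h1 : ∀ l, ∫ w, w l ∂(f : Measure (EuclideanSpace ℝ (Fin m))) = 0)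
    (h2 : ∀ l, ∫⁻ w, ENNReal.ofReal (w l ^ 2) ∂(f : Measure (EuclideanSpace ℝ (Fin m)))
      ≤ ENNReal.ofReal (σ ^ 2)) (c : EuclideanSpace ℝ (Fin m)) :
    ∫ w, ‖c - w‖ ^ 2 ∂(f : Measure (EuclideanSpace ℝ (Fin m))) =
      ‖c‖ ^ 2 + ∫ w, ‖w‖ ^ 2 ∂(f : Measure (EuclideanSpace ℝ (Fin m))) := by
  have hm : ∀ l : Fin m, MemLp (fun w : EuclideanSpace ℝ (Fin m) => w l) 2
      (f : Measure (EuclideanSpace ℝ (Fin m))) := fun l => by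
    rw [memLp_two_iff_integrable_sq (by fun_prop)]
    refine ⟨by fun_prop, ?_⟩
    rw [hasFiniteIntegral_iff_ofReal (Filter.Eventually.of_forall fun w => sq_nonneg _)]
    exact (h2 l).trans_lt ENNReal.ofReal_lt_top
  have hi : ∀ l : Fin m, Integrable (fun w : EuclideanSpace ℝ (Fin m) => w l)
      (f : Measure (EuclideanSpace ℝ (Fin m))) := fun l => (hm l).integrable (by norm_num)
  have hs : ∀ l : Fin m, Integrable (fun w : EuclideanSpace ℝ (Fin m) => w l ^ 2)
      (f : Measure (EuclideanSpace ℝ (Fin m))) := fun l => (hm l).integrable_sq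
  have e1 : ∀ (l : Fin m), (∫ w : EuclideanSpace ℝ (Fin m), (c l - w l) ^ 2
      ∂(f : Measure (EuclideanSpace ℝ (Fin m)))) = c l ^ 2 + ∫ w : EuclideanSpace ℝ (Fin m), w l ^ 2
      ∂(f : Measure (EuclideanSpace ℝ (Fin m))) := fun l => by
    have : ∀ w : EuclideanSpace ℝ (Fin m), (c l - w l) ^ 2 = c l ^ 2 + ((-2 * c l) * w l + w l ^ 2) :=
      fun w => by ring
    simp_rw [this]
    have hl : Integrable (fun w : EuclideanSpace ℝ (Fin m) => (-2 * c l) * w l + w l ^ 2)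
        (f : Measure (EuclideanSpace ℝ (Fin m))) := ((hi l).const_mul _).add (hs l)
    rw [integral_add (integrable_const _) hl,
      integral_add ((hi l).const_mul _) (hs l), integral_const_mul, h1 l]
    simp
  have hd : ∀ l : Fin m, Integrable (fun w : EuclideanSpace ℝ (Fin m) => (c l - w l) ^ 2)
      (f : Measure (EuclideanSpace ℝ (Fin m))) := fun l =>
    ((memLp_const (c l)).sub (hm l)).integrable_sq
  simp_rw [EuclideanSpace.real_norm_sq_eq, PiLp.sub_apply]
  rw [integral_finsetSum _ fun l _ => hd l, integral_finsetSum _ fun l _ => hs l,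
    ← Finset.sum_add_distrib]
  exact Finset.sum_congr rfl fun l _ => e1 l

/-- The optimal input minimizes the stage cost. -/
theorem System.Admissible.stageCost_optInput_le {K m n : ℕ} {e : System K m n}
    {Θ : Set (Params K m n)} {X : Set (EuclideanSpace ℝ (Fin n))}
    {ystar : EuclideanSpace ℝ (Fin m)} {σ : ℝ} (he : e.Admissible Θ X ystar σ) (i : Fin K)
    (x : EuclideanSpace ℝ (Fin n)) :
    e.stageCost ystar i (e.optInput ystar i) ≤ e.stageCost ystar i x := by
  have hcost : ∀ z, e.stageCost ystar i z = ∑ j, e.p i j * (‖ystar - meanOutput e.θ j z‖ ^ 2 +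
      ∫ w, ‖w‖ ^ 2 ∂(e.f j : Measure (EuclideanSpace ℝ (Fin m)))) := fun z => by
    refine Finset.sum_congr rfl fun j _ => ?_
    rw [← integral_norm_sub_sq (e.f j) σ (he.noise_mean j) (he.noise_second j)]
    simp_rw [sub_add_eq_sub_sub]
  set z := e.optInput ystar i with hz
  have hfoc : ∑ j, e.p i j * inner ℝ (Matrix.toEuclideanLin (e.θ j).1 (x - z))
      (ystar - meanOutput e.θ j z) = 0 := by
    have hg : Matrix.toEuclideanLin (e.gram i) z =
        ∑ j, e.p i j • Matrix.toEuclideanLin (e.θ j).1.transpose (ystar - (e.θ j).2) := by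
      have hdet := (Matrix.isUnit_iff_isUnit_det _).1 (e.gram_isUnit he.full_rank i)
      rw [hz, System.optInput]
      ext l
      simp [Matrix.toLpLin_apply, Matrix.mulVec_mulVec, Matrix.mul_nonsing_inv_cancel_left _ _ hdet]
    have h1 : inner ℝ (x - z) (∑ j, e.p i j • Matrix.toEuclideanLin (e.θ j).1.transpose
        (ystar - meanOutput e.θ j z)) = 0 := by
      have h2 : ∀ j, ystar - meanOutput e.θ j z =
          (ystar - (e.θ j).2) - Matrix.toEuclideanLin (e.θ j).1 z := fun j => by
        simp only [meanOutput]; abel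
      simp_rw [h2, map_sub, smul_sub]
      rw [Finset.sum_sub_distrib, ← e.toEuclideanLin_gram, hg]
      simp_rw [map_sub, smul_sub]
      rw [sub_self, inner_zero_right]
    rw [inner_sum] at h1
    simpa only [inner_smul_right, inner_transpose] using h1
  rw [hcost, hcost, ← sub_nonneg, ← Finset.sum_sub_distrib]
  have hexp : ∀ j, e.p i j * (‖ystar - meanOutput e.θ j x‖ ^ 2 +
        ∫ w, ‖w‖ ^ 2 ∂(e.f j : Measure (EuclideanSpace ℝ (Fin m)))) -
      e.p i j * (‖ystar - meanOutput e.θ j z‖ ^ 2 +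
        ∫ w, ‖w‖ ^ 2 ∂(e.f j : Measure (EuclideanSpace ℝ (Fin m)))) =
      e.p i j * ‖Matrix.toEuclideanLin (e.θ j).1 (x - z)‖ ^ 2 -
        2 * (e.p i j * inner ℝ (Matrix.toEuclideanLin (e.θ j).1 (x - z))
          (ystar - meanOutput e.θ j z)) := fun j => by
    have : ystar - meanOutput e.θ j x = (ystar - meanOutput e.θ j z) -
        Matrix.toEuclideanLin (e.θ j).1 (x - z) := by
      simp only [meanOutput, map_sub]; abel
    rw [this, norm_sub_sq_real, real_inner_comm]
    ring
  simp_rw [hexp]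
  rw [Finset.sum_sub_distrib, ← Finset.mul_sum, hfoc, mul_zero, sub_zero]
  exact Finset.sum_nonneg fun j _ => mul_nonneg (e.p_nonneg i j) (sq_nonneg _)

/-! ### Policies and the closed loop

Stages are numbered `0, 1, 2, …`: the input `x t` is chosen
after `s 0, …, s t` have been seen, and it produces an output in state `s (t + 1)`. -/

/-- Decision rules. At stage `t` the input is a function of the past inputs, the past outputs, the
states `s 0, …, s t`, and a private random seed (a deterministic policy ignores the seed). -/
structure Policy (K m n : ℕ) where
  Seed : Type
  [seedSpace : MeasurableSpace Seed]
  seedLaw : ProbabilityMeasure Seed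
  rule : (t : ℕ) → Seed → (Fin t → EuclideanSpace ℝ (Fin n)) →
    (Fin t → EuclideanSpace ℝ (Fin m)) → (Fin (t + 1) → Fin K) → EuclideanSpace ℝ (Fin n)

attribute [instance] Policy.seedSpace

/-- All decision rules are measurable. -/
def Policy.IsMeasurable {K m n : ℕ} (μ : Policy K m n) : Prop :=
  ∀ t, Measurable fun h : μ.Seed × (Fin t → EuclideanSpace ℝ (Fin n)) ×
      (Fin t → EuclideanSpace ℝ (Fin m)) × (Fin (t + 1) → Fin K) =>
    μ.rule t h.1 h.2.1 h.2.2.1 h.2.2.2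

/-- A point `(s, w, u)` of the sample space: the state path, the noise `w (t, k)` that is added at
stage `t` if the state is then `k`, and the seed of the policy. -/
abbrev Sample {K m n : ℕ} (μ : Policy K m n) : Type :=
  (ℕ → Fin K) × (ℕ × Fin K → EuclideanSpace ℝ (Fin m)) × μ.Seed

/-- The one-step kernel: given `s 0, …, s t`, the state `s (t + 1)` has law `P (s t)`. -/
def System.stepKernel {K m n : ℕ} (e : System K m n) (t : ℕ) :
    Kernel ((_ : Finset.Iic t) → Fin K) (Fin K) :=
  Kernel.ofFunOfCountable fun h => (e.P (h ⟨t, Finset.mem_Iic.2 le_rfl⟩)).toMeasure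

instance {K m n : ℕ} (e : System K m n) (t : ℕ) : IsMarkovKernel (e.stepKernel t) :=
  ⟨fun h => by
    change IsProbabilityMeasure (e.P (h ⟨t, Finset.mem_Iic.2 le_rfl⟩)).toMeasure
    infer_instance⟩

/-- The law of the Markov chain with initial law `ν` and transition matrix `P`. -/
def System.chainLaw {K m n : ℕ} (e : System K m n) (ν : PMF (Fin K)) : Measure (ℕ → Fin K) :=
  Kernel.trajMeasure (X := fun _ => Fin K) ν.toMeasure e.stepKernel

/-- The joint law: state path, noise and seed are independent, the `w (t, k)` are independent, and
`w (t, k)` has law `f k`. -/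
def System.law {K m n : ℕ} (e : System K m n) (ν : PMF (Fin K)) (μ : Policy K m n) :
    Measure (Sample μ) :=
  (e.chainLaw ν).prod
    ((Measure.infinitePi fun q : ℕ × Fin K =>
      (e.f q.2 : Measure (EuclideanSpace ℝ (Fin m)))).prod (μ.seedLaw : Measure μ.Seed))

/-- The inputs and outputs of the first `t` stages, when the parameters are `θ`. -/
def Policy.history {K m n : ℕ} (μ : Policy K m n) (θ : Params K m n) (ω : Sample μ) :
    (t : ℕ) → (Fin t → EuclideanSpace ℝ (Fin n)) × (Fin t → EuclideanSpace ℝ (Fin m))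
  | 0 => (Fin.elim0, Fin.elim0)
  | t + 1 =>
    let h := μ.history θ ω t
    let x := μ.rule t ω.2.2 h.1 h.2 fun r : Fin (t + 1) => ω.1 r
    (Fin.snoc h.1 x,
      Fin.snoc h.2 (meanOutput θ (ω.1 (t + 1)) x + ω.2.1 (t, ω.1 (t + 1))))

/-- The input at stage `t`. -/
def Policy.input {K m n : ℕ} (μ : Policy K m n) (θ : Params K m n) (ω : Sample μ) (t : ℕ) :
    EuclideanSpace ℝ (Fin n) :=
  μ.rule t ω.2.2 (μ.history θ ω t).1 (μ.history θ ω t).2 fun r : Fin (t + 1) => ω.1 r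

/-- The cumulative input-MSE `E (∑ t, ‖x_t - x*_{s_{t-1}}‖²)` over `T` stages. -/
def cumMSE {K m n : ℕ} (ystar : EuclideanSpace ℝ (Fin m)) (ν : PMF (Fin K)) (e : System K m n)
    (μ : Policy K m n) (T : ℕ) : ℝ≥0∞ :=
  ∫⁻ ω, ENNReal.ofReal
    (∑ t ∈ Finset.range T, ‖μ.input e.θ ω t - e.optInput ystar (ω.1 t)‖ ^ 2) ∂(e.law ν μ)

/-- The regret `E (∑ t, J (s_{t-1}, x_t) - ∑ t, J (s_{t-1}, x*_{s_{t-1}}))` over `T` stages. For an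
admissible system the difference is nonnegative (`System.Admissible.stageCost_optInput_le`); its
expectation may be infinite. -/
def regret {K m n : ℕ} (ystar : EuclideanSpace ℝ (Fin m)) (ν : PMF (Fin K)) (e : System K m n)
    (μ : Policy K m n) (T : ℕ) : ℝ≥0∞ :=
  ∫⁻ ω, ENNReal.ofReal
    (∑ t ∈ Finset.range T, e.stageCost ystar (ω.1 t) (μ.input e.θ ω t) -
      ∑ t ∈ Finset.range T, e.stageCost ystar (ω.1 t) (e.optInput ystar (ω.1 t))) ∂(e.law ν μ)

/-- The worst-case cumulative input-MSE. -/
def worstMSE {K m n : ℕ} (Θ : Set (Params K m n)) (X : Set (EuclideanSpace ℝ (Fin n)))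
    (ystar : EuclideanSpace ℝ (Fin m)) (σ : ℝ) (ν : PMF (Fin K)) (μ : Policy K m n) (T : ℕ) :
    ℝ≥0∞ :=
  ⨆ (e : System K m n) (_ : e.Admissible Θ X ystar σ), cumMSE ystar ν e μ T

/-- The worst-case regret. -/
def worstRegret {K m n : ℕ} (Θ : Set (Params K m n)) (X : Set (EuclideanSpace ℝ (Fin n)))
    (ystar : EuclideanSpace ℝ (Fin m)) (σ : ℝ) (ν : PMF (Fin K)) (μ : Policy K m n) (T : ℕ) :
    ℝ≥0∞ :=
  ⨆ (e : System K m n) (_ : e.Admissible Θ X ystar σ), regret ystar ν e μ T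

/-! ### The MSPSA policy -/

/-- Euclidean projection: a point of `X` closest to `x` (the only one if `X` is nonempty, compact
and convex). -/
def proj {n : ℕ} (X : Set (EuclideanSpace ℝ (Fin n))) (x : EuclideanSpace ℝ (Fin n)) :
    EuclideanSpace ℝ (Fin n) :=
  open Classical in
  if h : ∃ z ∈ X, dist x z = Metric.infDist x X then h.choose else x

/-- Parameters of MSPSA: the gains `γ i`, `γ' i`, the offsets `N i`, `N' i`, the initial estimates,
and the law of one coordinate of a perturbation. -/
structure MSPSA (K n : ℕ) where
  γ : Fin K → ℝ
  γ' : Fin K → ℝ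
  N : Fin K → ℕ
  N' : Fin K → ℕ
  init : Fin K → EuclideanSpace ℝ (Fin n)
  pert : ProbabilityMeasure ℝ

/-- The requirements on these parameters. (In the last one, the inverse of zero is `∞`.) -/
structure MSPSA.Valid {K n : ℕ} (α : MSPSA K n) (X : Set (EuclideanSpace ℝ (Fin n))) : Prop where
  γ_pos : ∀ i, 0 < α.γ i
  γ'_pos : ∀ i, 0 < α.γ' i
  init_mem : ∀ i, α.init i ∈ X
  pert_symm : (α.pert : Measure ℝ).map (fun x => -x) = α.pert
  pert_bdd : ∃ ξ : ℝ, ∀ᵐ x ∂(α.pert : Measure ℝ), |x| ≤ ξ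
  pert_inv : ∃ ξ : ℝ, ∫⁻ x, (ENNReal.ofReal (x ^ 2))⁻¹ ∂(α.pert : Measure ℝ) ≤ ENNReal.ofReal ξ

/-- The step size `a_k = γ_i / (N_i + k)`. -/
def MSPSA.stepSize {K n : ℕ} (α : MSPSA K n) (i : Fin K) (k : ℕ) : ℝ :=
  α.γ i / (α.N i + k)

/-- The perturbation gain `c_k = γ'_i / (N'_i + k) ^ (1/4)`. -/
def MSPSA.gain {K n : ℕ} (α : MSPSA K n) (i : Fin K) (k : ℕ) : ℝ :=
  α.γ' i / ((α.N' i + k : ℝ) ^ (1 / 4 : ℝ))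

/-- What MSPSA stores for one state: the present estimate of the optimal input, the counter `t_i`,
the flag `e_i` (is the first of the two observations for this estimate already taken?), and the
cost seen in that first observation. -/
structure Memory (n : ℕ) where
  est : EuclideanSpace ℝ (Fin n)
  count : ℕ
  flag : Bool
  dplus : ℝ

/-- The seed: coordinate `l` of the `k`-th perturbation used for state `i` is `u (i, k, l)`. -/
abbrev PertSeed (K n : ℕ) : Type := Fin K × ℕ × Fin n → ℝ

/-- The `k`-th perturbation `Δ_k` used for state `i`. -/
def pertVec {K n : ℕ} (u : PertSeed K n) (i : Fin K) (k : ℕ) : EuclideanSpace ℝ (Fin n) :=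
  WithLp.toLp 2 fun l => u (i, k, l)

/-- The coordinatewise inverse of `pertVec u i k`. -/
def pertInv {K n : ℕ} (u : PertSeed K n) (i : Fin K) (k : ℕ) : EuclideanSpace ℝ (Fin n) :=
  WithLp.toLp 2 fun l => (u (i, k, l))⁻¹

/-- The input that MSPSA applies when the last seen state is `i` and its memory is `M`. -/
def MSPSA.output {K n : ℕ} (α : MSPSA K n) (u : PertSeed K n) (i : Fin K) (M : Memory n) :
    EuclideanSpace ℝ (Fin n) :=
  if M.flag then M.est - α.gain i M.count • pertVec u i M.count
  else M.est + α.gain i (M.count + 1) • pertVec u i (M.count + 1)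

/-- The change of the memory of state `i` after that input has led to the cost `d`. -/
def MSPSA.update {K n : ℕ} (α : MSPSA K n) (X : Set (EuclideanSpace ℝ (Fin n)))
    (u : PertSeed K n) (i : Fin K) (M : Memory n) (d : ℝ) : Memory n :=
  if M.flag then
    { M with
      est := proj X (M.est -
        (α.stepSize i M.count * ((M.dplus - d) / α.gain i M.count)) • pertInv u i M.count)
      flag := false }
  else { M with count := M.count + 1, flag := true, dplus := d }

/-- The memory after `t` stages with outputs `y` and preceding states `s`. -/
def MSPSA.memory {K m n : ℕ} (α : MSPSA K n) (X : Set (EuclideanSpace ℝ (Fin n)))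
    (ystar : EuclideanSpace ℝ (Fin m)) (u : PertSeed K n) :
    (t : ℕ) → (Fin t → EuclideanSpace ℝ (Fin m)) → (Fin t → Fin K) → Fin K → Memory n
  | 0, _, _ => fun i => ⟨α.init i, 0, false, 0⟩
  | t + 1, y, s =>
    let M := α.memory X ystar u t (Fin.init y) (Fin.init s)
    let i := s (Fin.last t)
    Function.update M i (α.update X u i (M i) (‖y (Fin.last t) - ystar‖ ^ 2))

/-- The MSPSA policy for quadratic regulation. -/
def MSPSA.policy {K m n : ℕ} (α : MSPSA K n) (X : Set (EuclideanSpace ℝ (Fin n)))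
    (ystar : EuclideanSpace ℝ (Fin m)) : Policy K m n where
  Seed := PertSeed K n
  seedLaw := ⟨Measure.infinitePi fun _ => (α.pert : Measure ℝ), inferInstance⟩
  rule t u _ y s :=
    α.output u (s (Fin.last t)) (α.memory X ystar u t y (Fin.init s) (s (Fin.last t)))

/-- The smallest eigenvalue of a symmetric matrix. -/
def minEigenvalue {n : ℕ} (M : Matrix (Fin n) (Fin n) ℝ) : ℝ := sInf (spectrum ℝ M)

end JumpAffine

end

noncomputable section

namespace JumpAffine

/-! ### Resampling coordinates, Gaussian shifts, one step of the chain -/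

/-! Lower bound. A policy cannot stay at the optimal input and learn where it is. Near the given
nondegenerate system, `exists_base_system` finds one with independent states whose expected cost is
stationary at an interior point x₀ of the input set and whose residual r = y* - (A_k x₀ + b_k) is
nonzero for some state k. Replacing A_k by A_k + ε r vᵀ, and b_k so that the output at x₀ is
unchanged, changes the gradient at x₀ by order ε and hence moves the optimum by order ε
(`exists_hardFamily`). The outputs reveal ε only through ⟨v, x_t - x₀⟩. If the noise of state k is
Gaussian along r, passing from 0 to ε is a predictable shift of the noise with energy at most a
constant times ε² ∑ ‖x_t - x₀‖².

By `two_point_bound`, the cumulative errors around the optima for 0 and for ε cannot both be small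
unless this energy, taken under ε/2, is large. With ε of order T^(-1/4) the two optima are separated
by a cumulative error of order Tε² ~ √T, while a policy with error w has energy of order at most
ε²(w + Tε²), too small to distinguish them when w is a small multiple of √T
(`HardFamily.lower_bound`). Strong convexity of the cost, uniform over the family, carries the bound
over to the regret.

Upper bound. The cost is quadratic, so a symmetric difference along Δ gives its directional
derivative exactly, and E(Δ̄ Δᵀ) is the identity. One pair of measurements therefore multiplies the
mean squared error by at most 1 - 8 a_k λ_min ≤ 1 - 1/(N+k) and adds O(a_k²/c_k²) = O(k^(-3/2))
(`MSPSA.Valid.lintegral_iteration_le`). The error after k pairs is O(k^(-1/2)) by `rate_step`, the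
price c_k² of the perturbation has the same order, and summing over at most T pairs gives O(√T).

The number of visits to a state before T is random and may depend on the observed costs, so moments
of the iterates are not summed along the path. Instead a function W R k x bounds the expected cost
of R further pairs starting with pair k and estimate x. The resulting potential dominates, on
average, the error of each stage plus the next potential, whether or not the state is visited
(`MSPSA.lintegral_stage_le`); telescoping yields the bound W T 1 at the initial estimate. -/

theorem measurable_piecewise_pair {ι : Type*} {X : ι → Type*} [∀ i, MeasurableSpace (X i)]
    (S : Set ι) [DecidablePred (· ∈ S)] :
    Measurable fun p : (∀ i, X i) × (∀ i, X i) => S.piecewise p.1 p.2 := by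
  refine measurable_pi_lambda _ fun i => ?_
  by_cases h : i ∈ S
  · simp only [Set.piecewise, h, if_true]
    exact (measurable_pi_apply i).comp measurable_fst
  · simp only [Set.piecewise, h, if_false]
    exact (measurable_pi_apply i).comp measurable_snd

/-- Replacing the coordinates in `S` by those of an independent copy does not change a product
measure. -/
theorem infinitePi_map_piecewise {ι : Type*} {X : ι → Type*} [∀ i, MeasurableSpace (X i)]
    (μ : ∀ i, Measure (X i)) [∀ i, IsProbabilityMeasure (μ i)] (S : Set ι)
    [DecidablePred (· ∈ S)] :
    ((Measure.infinitePi μ).prod (Measure.infinitePi μ)).map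
      (fun p => S.piecewise p.1 p.2) = Measure.infinitePi μ := by
  classical
  refine Measure.eq_infinitePi μ fun s t ht => ?_
  have hpre : (fun p : (∀ i, X i) × (∀ i, X i) => S.piecewise p.1 p.2) ⁻¹'
      (Set.pi (s : Set ι) t) = (Set.pi ((s.filter (· ∈ S) : Finset ι) : Set ι) t) ×ˢ
        (Set.pi ((s.filter (· ∉ S) : Finset ι) : Set ι) t) := by
    ext p
    simp only [Set.mem_preimage, Set.mem_pi, Finset.mem_coe, Set.mem_prod, Finset.mem_filter,
      Set.piecewise]
    constructor
    · intro h
      exact ⟨fun i hi => by simpa [hi.2] using h i hi.1, fun i hi => by simpa [hi.2] using h i hi.1⟩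
    · rintro ⟨h1, h2⟩ i hi
      by_cases hS : i ∈ S
      · simpa [hS] using h1 i ⟨hi, hS⟩
      · simpa [hS] using h2 i ⟨hi, hS⟩
  rw [Measure.map_apply (measurable_piecewise_pair S)
    (MeasurableSet.pi s.countable_toSet fun i _ => ht i), hpre, Measure.prod_prod,
    Measure.infinitePi_pi _ fun i _ => ht i, Measure.infinitePi_pi _ fun i _ => ht i,
    Finset.prod_filter_mul_prod_filter_not]

/-- Replaces conditional expectations: coordinates that the rest of the integrand does not read can
be averaged first, with all others frozen. -/
theorem lintegral_infinitePi_resample {ι : Type*} {X : ι → Type*} [∀ i, MeasurableSpace (X i)]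
    (μ : ∀ i, Measure (X i)) [∀ i, IsProbabilityMeasure (μ i)] (S : Set ι)
    [DecidablePred (· ∈ S)] {F : (∀ i, X i) → ℝ≥0∞} (hF : Measurable F) :
    ∫⁻ x, F x ∂Measure.infinitePi μ =
      ∫⁻ x, ∫⁻ v, F (S.piecewise v x) ∂Measure.infinitePi μ ∂Measure.infinitePi μ := by
  conv_lhs => rw [← infinitePi_map_piecewise μ S]
  rw [lintegral_map hF (measurable_piecewise_pair S)]
  exact lintegral_prod_symm _ (hF.comp (measurable_piecewise_pair S)).aemeasurable

/-- If `F x` is a function of `x i` and of a quantity which does not depend on `x i`, then `x i` can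
be integrated out independently. -/
theorem lintegral_infinitePi_eval {ι : Type*} [DecidableEq ι] {X : ι → Type*}
    [∀ i, MeasurableSpace (X i)]
    (μ : ∀ i, Measure (X i)) [∀ i, IsProbabilityMeasure (μ i)] (i : ι)
    {F : (∀ i, X i) → X i → ℝ≥0∞} (hF : Measurable fun p : (∀ i, X i) × X i => F p.1 p.2)
    (hi : ∀ x y, (∀ j, j ≠ i → x j = y j) → F x = F y) :
    ∫⁻ x, F x (x i) ∂Measure.infinitePi μ =
      ∫⁻ x, ∫⁻ z, F x z ∂μ i ∂Measure.infinitePi μ := by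
  classical
  have h1 : Measurable fun x : ∀ i, X i => F x (x i) :=
    hF.comp (measurable_id.prodMk (measurable_pi_apply i))
  rw [lintegral_infinitePi_resample μ {i} h1]
  refine lintegral_congr fun x => ?_
  have h2 : ∀ v : ∀ i, X i, F (({i} : Set ι).piecewise v x) (({i} : Set ι).piecewise v x i)
      = F x (v i) := fun v => by
    rw [hi _ x fun j hj => by simp [Set.piecewise, hj]]
    simp [Set.piecewise]
  simp_rw [h2]
  exact (measurePreserving_eval_infinitePi μ i).lintegral_comp
    (f := fun z => F x z) (hF.comp measurable_prodMk_left)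

/-- Cameron–Martin formula in dimension one: the factor is the ratio of the densities with means δ
and 0. -/
theorem gaussianReal_shift (δ : ℝ) {F : ℝ → ℝ≥0∞} (hF : Measurable F) :
    ∫⁻ x, F (x + δ) ∂gaussianReal 0 1 =
      ∫⁻ x, ENNReal.ofReal (Real.exp (δ * x - δ ^ 2 / 2)) * F x ∂gaussianReal 0 1 := by
  have h1 : ∫⁻ x, F (x + δ) ∂gaussianReal 0 1 = ∫⁻ x, F x ∂gaussianReal δ 1 := by
    have := gaussianReal_map_add_const (μ := 0) (v := 1) δ
    rw [zero_add] at this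
    rw [← this, lintegral_map hF (by fun_prop)]
  rw [h1, gaussianReal_of_var_ne_zero _ one_ne_zero, gaussianReal_of_var_ne_zero _ one_ne_zero,
    lintegral_withDensity_eq_lintegral_mul _ (measurable_gaussianPDF _ _) hF,
    lintegral_withDensity_eq_lintegral_mul _ (measurable_gaussianPDF _ _) (by fun_prop)]
  refine lintegral_congr fun x => ?_
  simp only [Pi.mul_apply, gaussianPDF, gaussianPDFReal]
  rw [← mul_assoc, ← ENNReal.ofReal_mul (by positivity)]
  congr 2
  rw [mul_assoc (√_)⁻¹, ← Real.exp_add]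
  congr 2
  push_cast
  ring

/-- The joint law of the next state and its noise after state `i`. -/
def System.nextLaw {K m n : ℕ} (e : System K m n) (i : Fin K) :
    Measure (Fin K × EuclideanSpace ℝ (Fin m)) :=
  Measure.sum fun j => e.P i j • (Measure.dirac j).prod
    (e.f j : Measure (EuclideanSpace ℝ (Fin m)))

theorem System.lintegral_nextLaw {K m n : ℕ} (e : System K m n) (i : Fin K)
    {F : Fin K × EuclideanSpace ℝ (Fin m) → ℝ≥0∞} (hF : Measurable F) :
    ∫⁻ z, F z ∂e.nextLaw i = ∑ j, e.P i j *
      ∫⁻ w, F (j, w) ∂(e.f j : Measure (EuclideanSpace ℝ (Fin m))) := by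
  rw [System.nextLaw, lintegral_sum_measure, tsum_fintype]
  refine Finset.sum_congr rfl fun j _ => ?_
  rw [lintegral_smul_measure, lintegral_prod _ hF.aemeasurable, lintegral_dirac' _ hF.lintegral_prod_right']
  rfl

instance {K m n : ℕ} (e : System K m n) (i : Fin K) : IsProbabilityMeasure (e.nextLaw i) := by
  refine ⟨?_⟩
  have h := e.lintegral_nextLaw i (F := fun _ => 1) measurable_const
  simp only [lintegral_const, one_mul, measure_univ, mul_one] at h
  rw [h, ← tsum_fintype (L := .unconditional _)]
  exact (e.P i).tsum_coe

instance {K m n : ℕ} (e : System K m n) (ν : PMF (Fin K)) : IsProbabilityMeasure (e.chainLaw ν) := by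
  rw [System.chainLaw]; infer_instance

/-- The Markov property at one step. -/
theorem System.lintegral_chainLaw_succ {K m n : ℕ} (e : System K m n) (ν : PMF (Fin K)) (t : ℕ)
    {G : (ℕ → Fin K) → Fin K → ℝ≥0∞}
    (hpast : ∀ s s', (∀ r ≤ t, s r = s' r) → G s = G s') :
    ∫⁻ s, G s (s (t + 1)) ∂e.chainLaw ν = ∫⁻ s, ∑ j, e.P (s t) j * G s j ∂e.chainLaw ν := by
  classical
  -- A path is rebuilt from its restriction to times up to t, in an arbitrary way after t. The
  -- integrand becomes a function on a finite type, so G needs no measurability hypothesis.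
  let ext : ((_ : Finset.Iic t) → Fin K) → ℕ → Fin K := fun h r =>
    if hr : r ≤ t then h ⟨r, Finset.mem_Iic.2 hr⟩ else h ⟨t, Finset.mem_Iic.2 le_rfl⟩
  have hext : ∀ s : ℕ → Fin K, ∀ r ≤ t, ext (Preorder.frestrictLe (π := fun _ => Fin K) t s) r = s r := by
    intro s r hr
    simp [ext, hr, Preorder.frestrictLe]
  let G' : (((_ : Finset.Iic t) → Fin K) × Fin K) → ℝ≥0∞ := fun q => G (ext q.1) q.2
  have hG' : Measurable G' := measurable_of_countable _
  have key := Kernel.map_frestrictLe_trajMeasure_compProd_eq_map_trajMeasure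
    (X := fun _ => Fin K) (μ₀ := ν.toMeasure) (κ := e.stepKernel) (a := t)
  have h1 : ∫⁻ s, G s (s (t + 1)) ∂e.chainLaw ν =
      ∫⁻ q, G' q ∂((e.chainLaw ν).map
        (fun x ↦ (Preorder.frestrictLe (π := fun _ => Fin K) t x, x (t + 1)))) := by
    rw [lintegral_map hG' (by fun_prop)]
    refine lintegral_congr fun s => ?_
    simp only [G']
    rw [hpast _ s fun r hr => hext s r hr]
  rw [h1, System.chainLaw, ← key, Measure.lintegral_compProd hG', lintegral_map
    (measurable_of_countable _) (by fun_prop)]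
  refine lintegral_congr fun s => ?_
  have h2 : e.stepKernel t (Preorder.frestrictLe (π := fun _ => Fin K) t s) = (e.P (s t)).toMeasure := by
    rfl
  rw [h2, lintegral_fintype]
  refine Finset.sum_congr rfl fun j _ => ?_
  rw [PMF.toMeasure_apply_singleton _ _ (measurableSet_singleton j), mul_comm]
  simp only [G']
  rw [hpast _ s fun r hr => hext s r hr]

/-! ### The quadratic stage cost -/

theorem rank_eq_of_injective {m n : ℕ} (A : Matrix (Fin m) (Fin n) ℝ)
    (h : ∀ x, Matrix.toEuclideanLin A x = 0 → x = 0) : A.rank = n := by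
  have hinj : Function.Injective A.mulVecLin := by
    refine (injective_iff_map_eq_zero _).2 fun v hv => ?_
    have := h (WithLp.toLp 2 v) (by
      have hv' : A.mulVec v = 0 := hv
      simp [Matrix.toLpLin_apply, hv'])
    simpa using congrArg WithLp.ofLp this
  rw [Matrix.rank, LinearMap.finrank_range_of_inj hinj, Module.finrank_fin_fun]

theorem meanOutput_sub {K m n : ℕ} (θ : Params K m n) (k : Fin K)
    (x z : EuclideanSpace ℝ (Fin n)) :
    meanOutput θ k x - meanOutput θ k z = Matrix.toEuclideanLin (θ k).1 (x - z) := by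
  simp only [meanOutput, map_sub]; abel

theorem System.sum_p {K m n : ℕ} (e : System K m n) (i : Fin K) : ∑ j, e.p i j = 1 := by
  have h := (e.P i).tsum_coe
  rw [tsum_fintype] at h
  simp only [System.p]
  rw [← ENNReal.toReal_sum fun j _ => (e.P i).apply_ne_top j, h, ENNReal.toReal_one]

theorem System.inner_gram {K m n : ℕ} (e : System K m n) (i : Fin K)
    (h k : EuclideanSpace ℝ (Fin n)) :
    inner ℝ h (Matrix.toEuclideanLin (e.gram i) k) = ∑ j, e.p i j *
      inner ℝ (Matrix.toEuclideanLin (e.θ j).1 h) (Matrix.toEuclideanLin (e.θ j).1 k) := by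
  rw [e.toEuclideanLin_gram, inner_sum]
  simp only [inner_smul_right, inner_transpose]

theorem System.gram_optInput {K m n : ℕ} (e : System K m n) (hr : ∀ k, (e.θ k).1.rank = n)
    (ystar : EuclideanSpace ℝ (Fin m)) (i : Fin K) :
    Matrix.toEuclideanLin (e.gram i) (e.optInput ystar i) =
      ∑ j, e.p i j • Matrix.toEuclideanLin (e.θ j).1.transpose (ystar - (e.θ j).2) := by
  have hdet := (Matrix.isUnit_iff_isUnit_det _).1 (e.gram_isUnit hr i)
  rw [System.optInput]
  ext l
  simp [Matrix.toLpLin_apply, Matrix.mulVec_mulVec, Matrix.mul_nonsing_inv_cancel_left _ _ hdet]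

/-- The distance from `z` to the optimal input is governed by the gradient of the cost at `z`. -/
theorem System.gram_optInput_sub {K m n : ℕ} (e : System K m n) (hr : ∀ k, (e.θ k).1.rank = n)
    (ystar : EuclideanSpace ℝ (Fin m)) (i : Fin K) (z : EuclideanSpace ℝ (Fin n)) :
    Matrix.toEuclideanLin (e.gram i) (e.optInput ystar i - z) =
      ∑ j, e.p i j • Matrix.toEuclideanLin (e.θ j).1.transpose (ystar - meanOutput e.θ j z) := by
  rw [map_sub, e.gram_optInput hr, e.toEuclideanLin_gram, ← Finset.sum_sub_distrib]
  refine Finset.sum_congr rfl fun j _ => ?_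
  rw [← smul_sub, ← map_sub, meanOutput]
  congr 2
  abel

theorem System.sum_inner_residual {K m n : ℕ} (e : System K m n) (hr : ∀ k, (e.θ k).1.rank = n)
    (ystar : EuclideanSpace ℝ (Fin m)) (i : Fin K) (h : EuclideanSpace ℝ (Fin n)) :
    ∑ j, e.p i j * inner ℝ (Matrix.toEuclideanLin (e.θ j).1 h)
      (ystar - meanOutput e.θ j (e.optInput ystar i)) = 0 := by
  have h1 := congrArg (inner ℝ h) (e.gram_optInput_sub hr ystar i (e.optInput ystar i))
  rw [sub_self, map_zero, inner_zero_right, inner_sum] at h1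
  simpa only [inner_smul_right, inner_transpose] using h1.symm

/-- Mean zero and bounded second moments of the coordinates. -/
structure System.Centered {K m n : ℕ} (e : System K m n) (σ : ℝ) : Prop where
  full_rank : ∀ k, (e.θ k).1.rank = n
  noise_mean : ∀ k l, ∫ w, w l ∂(e.f k : Measure (EuclideanSpace ℝ (Fin m))) = 0
  noise_second : ∀ k l, ∫⁻ w, ENNReal.ofReal (w l ^ 2)
    ∂(e.f k : Measure (EuclideanSpace ℝ (Fin m))) ≤ ENNReal.ofReal (σ ^ 2)

/-- The centred noise adds a constant to the cost, and the linear term of the expansion at the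
optimal input vanishes by `System.sum_inner_residual`; only the quadratic form of the Gram matrix is
left. -/
theorem System.Centered.stageCost_eq {K m n : ℕ} {e : System K m n} {σ : ℝ} (he : e.Centered σ)
    (ystar : EuclideanSpace ℝ (Fin m)) (i : Fin K) (x : EuclideanSpace ℝ (Fin n)) :
    e.stageCost ystar i x = e.stageCost ystar i (e.optInput ystar i) + ∑ j, e.p i j *
      ‖Matrix.toEuclideanLin (e.θ j).1 (x - e.optInput ystar i)‖ ^ 2 := by
  have hcost : ∀ z, e.stageCost ystar i z = ∑ j, e.p i j * (‖ystar - meanOutput e.θ j z‖ ^ 2 +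
      ∫ w, ‖w‖ ^ 2 ∂(e.f j : Measure (EuclideanSpace ℝ (Fin m)))) := fun z => by
    refine Finset.sum_congr rfl fun j _ => ?_
    rw [← integral_norm_sub_sq (e.f j) σ (he.noise_mean j) (he.noise_second j)]
    simp_rw [sub_add_eq_sub_sub]
  have hfoc := e.sum_inner_residual he.full_rank ystar i (x - e.optInput ystar i)
  set z := e.optInput ystar i
  have hexp : ∀ j, e.p i j * (‖ystar - meanOutput e.θ j x‖ ^ 2 +
        ∫ w, ‖w‖ ^ 2 ∂(e.f j : Measure (EuclideanSpace ℝ (Fin m)))) =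
      e.p i j * (‖ystar - meanOutput e.θ j z‖ ^ 2 +
        ∫ w, ‖w‖ ^ 2 ∂(e.f j : Measure (EuclideanSpace ℝ (Fin m)))) +
      e.p i j * ‖Matrix.toEuclideanLin (e.θ j).1 (x - z)‖ ^ 2 -
        2 * (e.p i j * inner ℝ (Matrix.toEuclideanLin (e.θ j).1 (x - z))
          (ystar - meanOutput e.θ j z)) := fun j => by
    have : ystar - meanOutput e.θ j x = (ystar - meanOutput e.θ j z) -
        Matrix.toEuclideanLin (e.θ j).1 (x - z) := by
      rw [← meanOutput_sub]; abel
    rw [this, norm_sub_sq_real, real_inner_comm]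
    ring
  rw [hcost, hcost]
  simp_rw [hexp]
  rw [Finset.sum_sub_distrib, ← Finset.mul_sum, hfoc, mul_zero, sub_zero, Finset.sum_add_distrib]

theorem System.gram_isHermitian {K m n : ℕ} (e : System K m n) (i : Fin K) :
    (e.gram i).IsHermitian := by
  rw [Matrix.IsHermitian, Matrix.conjTranspose_eq_transpose_of_trivial, System.gram,
    Matrix.transpose_sum]
  refine Finset.sum_congr rfl fun j _ => ?_
  simp [Matrix.transpose_mul]

/-- Subtracting the infimum of the spectrum times the identity leaves a positive semidefinite
matrix. -/
theorem minEigenvalue_mul_le {n : ℕ} {M : Matrix (Fin n) (Fin n) ℝ} (hM : M.IsHermitian)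
    (h : EuclideanSpace ℝ (Fin n)) :
    minEigenvalue M * ‖h‖ ^ 2 ≤ inner ℝ h (Matrix.toEuclideanLin M h) := by
  have hb : BddBelow (spectrum ℝ M) := by
    rw [hM.spectrum_real_eq_range_eigenvalues]
    exact (Set.finite_range _).bddBelow
  have h2 : (M - minEigenvalue M • (1 : Matrix (Fin n) (Fin n) ℝ)).PosSemidef := by
    refine Matrix.posSemidef_iff_isHermitian_and_spectrum_nonneg.2 ⟨?_, ?_⟩
    · exact hM.sub (by simp [Matrix.IsHermitian])
    · intro x hx
      rw [← Algebra.algebraMap_eq_smul_one, ← spectrum.sub_singleton_eq] at hx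
      obtain ⟨y, hy, z, hz, rfl⟩ := hx
      rw [Set.mem_singleton_iff.1 hz]
      exact sub_nonneg.2 (csInf_le hb hy)
  have h3 := h2.re_dotProduct_nonneg h.ofLp
  have h4 : inner ℝ h (Matrix.toEuclideanLin M h) = h.ofLp ⬝ᵥ M.mulVec h.ofLp := by
    rw [EuclideanSpace.inner_eq_star_dotProduct]
    simp [Matrix.toLpLin_apply, dotProduct_comm]
  have h5 : ‖h‖ ^ 2 = h.ofLp ⬝ᵥ h.ofLp := by
    rw [EuclideanSpace.real_norm_sq_eq, dotProduct]
    exact Finset.sum_congr rfl fun _ _ => sq _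
  rw [h4, h5]
  simpa [Matrix.sub_mulVec, Matrix.smul_mulVec, dotProduct_sub] using h3

/-- Allows clearing the denominator in 1/(8λ) ≤ γ. For n = 0 the spectrum is empty and its infimum
is 0 by convention, hence `hn`. -/
theorem System.minEigenvalue_gram_pos {K m n : ℕ} (hn : 0 < n) (e : System K m n)
    (hr : ∀ k, (e.θ k).1.rank = n) (i : Fin K) : 0 < minEigenvalue (e.gram i) := by
  have : Nonempty (Fin n) := ⟨⟨0, hn⟩⟩
  have hH := e.gram_isHermitian i
  have hs : minEigenvalue (e.gram i) ∈ spectrum ℝ (e.gram i) := by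
    rw [minEigenvalue, hH.spectrum_real_eq_range_eigenvalues]
    exact (Set.range_nonempty _).csInf_mem (Set.finite_range _)
  have h0 : (e.gram i).PosSemidef := by
    refine Matrix.posSemidef_sum _ fun j _ => ?_
    have := Matrix.posSemidef_conjTranspose_mul_self (e.θ j).1
    rw [Matrix.conjTranspose_eq_transpose_of_trivial] at this
    exact this.smul (e.p_nonneg i j)
  refine lt_of_le_of_ne
    ((Matrix.posSemidef_iff_isHermitian_and_spectrum_nonneg.1 h0).2 hs) fun h => ?_
  rw [← h] at hs
  exact (spectrum.zero_notMem_iff ℝ).2 (e.gram_isUnit hr i) hs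

/-! ### Change of measure for predictable shifts of Gaussian noise -/

theorem measurable_snoc {Ω E : Type*} [MeasurableSpace Ω] [MeasurableSpace E] {t : ℕ}
    {f : Ω → Fin t → E} {g : Ω → E} (hf : Measurable f) (hg : Measurable g) :
    Measurable fun ω => (Fin.snoc (f ω) (g ω) : Fin (t + 1) → E) := by
  refine measurable_pi_lambda _ fun i => ?_
  refine Fin.lastCases ?_ (fun i => ?_) i
  · simpa using hg
  · simp only [Fin.snoc_castSucc]
    exact (measurable_pi_apply i).comp hf

theorem measurable_init {E : Type*} [MeasurableSpace E] {t : ℕ} :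
    Measurable fun z : Fin (t + 1) → E => (Fin.init z : Fin t → E) :=
  measurable_pi_lambda _ fun i => measurable_pi_apply i.castSucc

/-- The first `t` observations, if the noise `g (a r)` at time `r` is shifted by a function of the
past observations. -/
def shifted {ι : Type*} (a : ℕ → ι) (δ : (t : ℕ) → (Fin t → ℝ) → ℝ) (g : ι → ℝ) :
    (t : ℕ) → Fin t → ℝ
  | 0 => Fin.elim0
  | t + 1 => Fin.snoc (shifted a δ g t) (g (a t) + δ t (shifted a δ g t))

/-- The logarithm of the likelihood ratio between shifted and plain noise. -/
def logRatio (δ : (t : ℕ) → (Fin t → ℝ) → ℝ) : (t : ℕ) → (Fin t → ℝ) → ℝ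
  | 0, _ => 0
  | t + 1, z => logRatio δ t (Fin.init z) +
      (δ t (Fin.init z) * z (Fin.last t) - δ t (Fin.init z) ^ 2 / 2)

/-- The sum of the squared shifts. -/
def energy (δ : (t : ℕ) → (Fin t → ℝ) → ℝ) : (t : ℕ) → (Fin t → ℝ) → ℝ
  | 0, _ => 0
  | t + 1, z => energy δ t (Fin.init z) + δ t (Fin.init z) ^ 2

section

variable {ι : Type*} {a : ℕ → ι} {δ : (t : ℕ) → (Fin t → ℝ) → ℝ}

theorem measurable_shifted (hδ : ∀ t, Measurable (δ t)) (t : ℕ) :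
    Measurable fun g : ι → ℝ => shifted a δ g t := by
  induction t with
  | zero => exact measurable_const
  | succ t ih => exact measurable_snoc ih ((measurable_pi_apply _).add ((hδ t).comp ih))

theorem measurable_logRatio (hδ : ∀ t, Measurable (δ t)) (t : ℕ) : Measurable (logRatio δ t) := by
  induction t with
  | zero => exact measurable_const
  | succ t ih =>
    have h1 := (hδ t).comp (measurable_init (E := ℝ) (t := t))
    exact (ih.comp measurable_init).add
      ((h1.mul (measurable_pi_apply _)).sub ((h1.pow_const 2).div_const 2))

theorem measurable_energy (hδ : ∀ t, Measurable (δ t)) (t : ℕ) : Measurable (energy δ t) := by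
  induction t with
  | zero => exact measurable_const
  | succ t ih =>
    exact (ih.comp measurable_init).add (((hδ t).comp measurable_init).pow_const 2)

theorem energy_nonneg (t : ℕ) (z : Fin t → ℝ) : 0 ≤ energy δ t z := by
  induction t with
  | zero => exact le_rfl
  | succ t ih => exact add_nonneg (ih _) (sq_nonneg _)

/-- Completing the square: the square root of the likelihood ratio for the shift δ is the likelihood
ratio for δ/2 times exp(-energy/8). -/
theorem logRatio_half (t : ℕ) (z : Fin t → ℝ) :
    logRatio (fun t z => δ t z / 2) t z - energy δ t z / 8 = logRatio δ t z / 2 := by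
  induction t with
  | zero => simp [logRatio, energy]
  | succ t ih =>
    have := ih (Fin.init z)
    simp only [logRatio, energy]
    linarith

/-- The first t observations read only the noise at times before t, so by injectivity of a the
coordinate `a t` is still fresh. -/
theorem shifted_congr (ha : Function.Injective a) (t : ℕ) {g g' : ι → ℝ}
    (h : ∀ i, i ≠ a t → g i = g' i) : ∀ r ≤ t, shifted a δ g r = shifted a δ g' r := by
  intro r
  induction r with
  | zero => intro _; rfl
  | succ r ih =>
    intro hr
    simp only [shifted]
    rw [ih (by omega), h _ fun hc => by have := ha hc; omega]

/-- Girsanov's formula in discrete time. The last noise variable is independent of the earlier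
observations, which determine its shift; it is integrated out, moved by `gaussianReal_shift`, and
the induction hypothesis treats the rest. -/
theorem lintegral_shifted [DecidableEq ι] (ha : Function.Injective a)
    (hδ : ∀ t, Measurable (δ t)) (T : ℕ) {F : (Fin T → ℝ) → ℝ≥0∞} (hF : Measurable F) :
    ∫⁻ g, F (shifted a δ g T) ∂Measure.infinitePi (fun _ : ι => gaussianReal 0 1) =
      ∫⁻ g, ENNReal.ofReal (Real.exp (logRatio δ T (shifted a 0 g T))) * F (shifted a 0 g T)
        ∂Measure.infinitePi (fun _ : ι => gaussianReal 0 1) := by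
  induction T with
  | zero => simp [logRatio, shifted]
  | succ T ih =>
    have hsn : Measurable fun p : (Fin T → ℝ) × ℝ => (Fin.snoc p.1 p.2 : Fin (T + 1) → ℝ) :=
      measurable_snoc measurable_fst measurable_snd
    have hδ0 : ∀ t, Measurable ((0 : (t : ℕ) → (Fin t → ℝ) → ℝ) t) := fun t => measurable_const
    have hL : Measurable fun p : (Fin T → ℝ) × ℝ =>
        ENNReal.ofReal (Real.exp (δ T p.1 * p.2 - δ T p.1 ^ 2 / 2)) := by
      have : Measurable fun p : (Fin T → ℝ) × ℝ => δ T p.1 := (hδ T).comp measurable_fst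
      exact ((this.mul measurable_snd).sub ((this.pow_const 2).div_const 2)).exp.ennreal_ofReal
    have hF' : Measurable fun z => ∫⁻ x, F (Fin.snoc z (x + δ T z)) ∂gaussianReal 0 1 := by
      refine Measurable.lintegral_prod_right' (f := fun p : (Fin T → ℝ) × ℝ =>
        F (Fin.snoc p.1 (p.2 + δ T p.1))) (hF.comp ?_)
      exact measurable_snoc measurable_fst (measurable_snd.add ((hδ T).comp measurable_fst))
    have h1 : ∫⁻ g, F (shifted a δ g (T + 1)) ∂Measure.infinitePi (fun _ : ι => gaussianReal 0 1) =
        ∫⁻ g, ∫⁻ x, F (Fin.snoc (shifted a δ g T) (x + δ T (shifted a δ g T))) ∂gaussianReal 0 1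
          ∂Measure.infinitePi (fun _ : ι => gaussianReal 0 1) := by
      refine lintegral_infinitePi_eval (fun _ : ι => gaussianReal 0 1) (a T)
        (F := fun g x => F (Fin.snoc (shifted a δ g T) (x + δ T (shifted a δ g T)))) ?_ ?_
      · have : Measurable fun p : (ι → ℝ) × ℝ => shifted a δ p.1 T :=
          (measurable_shifted (a := a) hδ T).comp measurable_fst
        exact hF.comp (measurable_snoc this (measurable_snd.add ((hδ T).comp this)))
      · intro g g' h
        simp only [shifted_congr ha T h T le_rfl]
    rw [h1, ih hF']
    have h2 : ∀ g : ι → ℝ, ENNReal.ofReal (Real.exp (logRatio δ T (shifted a 0 g T))) *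
        ∫⁻ x, F (Fin.snoc (shifted a 0 g T) (x + δ T (shifted a 0 g T))) ∂gaussianReal 0 1 =
        ∫⁻ x, ENNReal.ofReal (Real.exp (logRatio δ T (shifted a 0 g T))) *
          (ENNReal.ofReal (Real.exp (δ T (shifted a 0 g T) * x - δ T (shifted a 0 g T) ^ 2 / 2)) *
            F (Fin.snoc (shifted a 0 g T) x)) ∂gaussianReal 0 1 := fun g => by
      rw [gaussianReal_shift _ (F := fun y => F (Fin.snoc (shifted a 0 g T) y))
        (hF.comp (hsn.comp measurable_prodMk_left)), lintegral_const_mul]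
      exact (hL.comp measurable_prodMk_left).mul (hF.comp (hsn.comp measurable_prodMk_left))
    simp_rw [h2]
    have hS := measurable_shifted (a := a) hδ0 T
    symm
    rw [← lintegral_infinitePi_eval (fun _ : ι => gaussianReal 0 1) (a T)
      (F := fun g x => ENNReal.ofReal (Real.exp (logRatio δ T (shifted a 0 g T))) *
          (ENNReal.ofReal (Real.exp (δ T (shifted a 0 g T) * x - δ T (shifted a 0 g T) ^ 2 / 2)) *
            F (Fin.snoc (shifted a 0 g T) x)))]
    · refine lintegral_congr fun g => ?_
      simp only [shifted, logRatio, Pi.zero_apply, add_zero, Fin.init_snoc, Fin.snoc_last]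
      rw [Real.exp_add, ENNReal.ofReal_mul (Real.exp_nonneg _), mul_assoc]
    · have hS' : Measurable fun p : (ι → ℝ) × ℝ => shifted a 0 p.1 T := hS.comp measurable_fst
      exact ((measurable_logRatio hδ T).comp hS').exp.ennreal_ofReal.mul
        ((hL.comp (hS'.prodMk measurable_snd)).mul (hF.comp (measurable_snoc hS' measurable_snd)))
    · intro g g' h
      simp only [shifted_congr (δ := 0) ha T h T le_rfl]

/-- With y = exp(l/2) the two cases are (y - 4)² + 1 ≥ 0 and (4y - 1)² + y² ≥ 0. The weight 1/8 is
chosen so that, for a likelihood ratio of mean 1, the last term has mean 1/4 < 1. -/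
theorem exp_half_le (l : ℝ) :
    Real.exp (l / 2) ≤ 2 * min 1 (Real.exp l) + (1 + Real.exp l) / 8 := by
  have hl : Real.exp l = Real.exp (l / 2) ^ 2 := by
    rw [sq, ← Real.exp_add]; ring_nf
  have h0 := Real.exp_pos (l / 2)
  rw [hl]
  rcases le_total 1 (Real.exp (l / 2)) with h | h
  · rw [min_eq_left (by nlinarith)]
    nlinarith [sq_nonneg (Real.exp (l / 2) - 4)]
  · rw [min_eq_right (by nlinarith)]
    nlinarith [sq_nonneg (4 * Real.exp (l / 2) - 1)]

/-- Two-point lower bound: if two losses cannot be small together, then one of them is large under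
the corresponding shift, unless the energy at half the shift is large. -/
theorem two_point_bound [DecidableEq ι] (ha : Function.Injective a) (hδ : ∀ t, Measurable (δ t))
    (T : ℕ) {F₀ F₁ : (Fin T → ℝ) → ℝ≥0∞} (hF₀ : Measurable F₀) (hF₁ : Measurable F₁) (c : ℝ≥0∞)
    (hc : ∀ z, c ≤ F₀ z + F₁ z) :
    c ≤ 2 * (∫⁻ g, F₀ (shifted a 0 g T) ∂Measure.infinitePi (fun _ : ι => gaussianReal 0 1) +
        ∫⁻ g, F₁ (shifted a δ g T) ∂Measure.infinitePi (fun _ : ι => gaussianReal 0 1)) +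
      c * ENNReal.ofReal (1 / 4) +
      c * ∫⁻ g, ENNReal.ofReal (energy δ T (shifted a (fun t z => δ t z / 2) g T) / 8)
        ∂Measure.infinitePi (fun _ : ι => gaussianReal 0 1) := by
  set G := Measure.infinitePi (fun _ : ι => gaussianReal 0 1) with hG
  have hδ0 : ∀ t, Measurable ((0 : (t : ℕ) → (Fin t → ℝ) → ℝ) t) := fun t => measurable_const
  have hδ2 : ∀ t, Measurable (fun z => δ t z / 2) := fun t => (hδ t).div_const 2
  have hS := measurable_shifted (a := a) hδ0 T
  have hS2 := measurable_shifted (a := a) hδ2 T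
  have hl : Measurable fun g : ι → ℝ => logRatio δ T (shifted a 0 g T) :=
    (measurable_logRatio hδ T).comp hS
  have hexp : ∫⁻ g, ENNReal.ofReal (Real.exp (logRatio δ T (shifted a 0 g T))) ∂G = 1 := by
    have := lintegral_shifted (a := a) ha hδ T (F := fun _ => 1) measurable_const
    simpa using this.symm
  -- The affinity of the two laws, written under half the shift. There 1 - x ≤ exp(-x) bounds it
  -- below by the first moment of the energy, so no exponential moment is needed.
  have hsqrt : ∫⁻ g, ENNReal.ofReal (Real.exp (-(energy δ T
      (shifted a (fun t z => δ t z / 2) g T) / 8))) ∂G =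
      ∫⁻ g, ENNReal.ofReal (Real.exp (logRatio δ T (shifted a 0 g T) / 2)) ∂G := by
    rw [lintegral_shifted (a := a) ha hδ2 T
      (F := fun z => ENNReal.ofReal (Real.exp (-(energy δ T z / 8))))
      (((measurable_energy hδ T).div_const 8).neg.exp.ennreal_ofReal)]
    refine lintegral_congr fun g => ?_
    rw [← ENNReal.ofReal_mul (Real.exp_nonneg _), ← Real.exp_add, ← logRatio_half, sub_eq_add_neg]
  have h1 : 1 ≤ ∫⁻ g, ENNReal.ofReal (Real.exp (logRatio δ T (shifted a 0 g T) / 2)) ∂G +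
      ∫⁻ g, ENNReal.ofReal (energy δ T (shifted a (fun t z => δ t z / 2) g T) / 8) ∂G := by
    have hm : Measurable fun g : ι → ℝ => ENNReal.ofReal (Real.exp (-(energy δ T
        (shifted a (fun t z => δ t z / 2) g T) / 8))) :=
      (((measurable_energy hδ T).comp hS2).div_const 8).neg.exp.ennreal_ofReal
    rw [← hsqrt, ← lintegral_add_left hm]
    calc (1 : ℝ≥0∞) = ∫⁻ _, 1 ∂G := by simp
      _ ≤ _ := lintegral_mono fun g => by
        have hE : 0 ≤ energy δ T (shifted a (fun t z => δ t z / 2) g T) / 8 :=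
          div_nonneg (energy_nonneg _ _) (by norm_num)
        rw [← ENNReal.ofReal_add (Real.exp_nonneg _) hE, ← ENNReal.ofReal_one]
        refine ENNReal.ofReal_le_ofReal ?_
        have := Real.add_one_le_exp (-(energy δ T (shifted a (fun t z => δ t z / 2) g T) / 8))
        linarith
  have h2 : ∫⁻ g, ENNReal.ofReal (Real.exp (logRatio δ T (shifted a 0 g T) / 2)) ∂G ≤
      2 * ∫⁻ g, ENNReal.ofReal (min 1 (Real.exp (logRatio δ T (shifted a 0 g T)))) ∂G +
        ENNReal.ofReal (1 / 4) := by
    calc _ ≤ ∫⁻ g, (2 * ENNReal.ofReal (min 1 (Real.exp (logRatio δ T (shifted a 0 g T)))) +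
          ENNReal.ofReal (1 / 8) * (1 + ENNReal.ofReal
            (Real.exp (logRatio δ T (shifted a 0 g T))))) ∂G := lintegral_mono fun g => by
          have hm : 0 ≤ min 1 (Real.exp (logRatio δ T (shifted a 0 g T))) :=
            le_min zero_le_one (Real.exp_nonneg _)
          have he := Real.exp_nonneg (logRatio δ T (shifted a 0 g T))
          rw [← ENNReal.ofReal_one, ← ENNReal.ofReal_add zero_le_one he,
            ← ENNReal.ofReal_mul (by norm_num), ← ENNReal.ofReal_ofNat 2,
            ← ENNReal.ofReal_mul (by norm_num), ← ENNReal.ofReal_add (by positivity) (by positivity)]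
          refine ENNReal.ofReal_le_ofReal ?_
          have := exp_half_le (logRatio δ T (shifted a 0 g T))
          linarith
      _ = _ := by
          have hmm : Measurable fun g : ι → ℝ =>
              ENNReal.ofReal (min 1 (Real.exp (logRatio δ T (shifted a 0 g T)))) :=
            (measurable_const.min hl.exp).ennreal_ofReal
          have hme : Measurable fun g : ι → ℝ =>
              1 + ENNReal.ofReal (Real.exp (logRatio δ T (shifted a 0 g T))) :=
            measurable_const.add hl.exp.ennreal_ofReal
          rw [lintegral_add_left (hmm.const_mul _), lintegral_const_mul _ hmm,
            lintegral_const_mul _ hme,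
            lintegral_add_left measurable_const, hexp]
          simp only [lintegral_const, measure_univ, mul_one]
          rw [← ENNReal.ofReal_one, ← ENNReal.ofReal_add zero_le_one zero_le_one,
            ← ENNReal.ofReal_mul (by norm_num)]
          norm_num
  -- Under the unshifted law the two losses carry the weights 1 and the likelihood ratio; both
  -- weights are at least their minimum, and the losses add up to at least c.
  have h3 : c * ∫⁻ g, ENNReal.ofReal (min 1 (Real.exp (logRatio δ T (shifted a 0 g T)))) ∂G ≤
      ∫⁻ g, F₀ (shifted a 0 g T) ∂G + ∫⁻ g, F₁ (shifted a δ g T) ∂G := by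
    have hm0 : Measurable fun g : ι → ℝ => F₀ (shifted a 0 g T) := hF₀.comp hS
    rw [lintegral_shifted (a := a) ha hδ T hF₁, ← hG, ← lintegral_add_left hm0,
      ← lintegral_const_mul _ (measurable_const.min hl.exp).ennreal_ofReal]
    refine lintegral_mono fun g => ?_
    have hm1 : ENNReal.ofReal (min 1 (Real.exp (logRatio δ T (shifted a 0 g T)))) ≤ 1 :=
      ENNReal.ofReal_le_one.2 (min_le_left _ _)
    have hm2 : ENNReal.ofReal (min 1 (Real.exp (logRatio δ T (shifted a 0 g T)))) ≤
        ENNReal.ofReal (Real.exp (logRatio δ T (shifted a 0 g T))) :=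
      ENNReal.ofReal_le_ofReal (min_le_right _ _)
    calc _ ≤ (F₀ (shifted a 0 g T) + F₁ (shifted a 0 g T)) *
          ENNReal.ofReal (min 1 (Real.exp (logRatio δ T (shifted a 0 g T)))) := by
          gcongr; exact hc _
      _ ≤ _ := by
          rw [add_mul, mul_comm (F₁ _)]
          refine add_le_add ?_ (mul_le_mul_left hm2 _)
          exact (mul_le_mul_right hm1 _).trans (mul_one _).le
  calc c = c * 1 := (mul_one c).symm
    _ ≤ c * (2 * ∫⁻ g, ENNReal.ofReal (min 1 (Real.exp (logRatio δ T (shifted a 0 g T)))) ∂G +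
        ENNReal.ofReal (1 / 4) + ∫⁻ g, ENNReal.ofReal
          (energy δ T (shifted a (fun t z => δ t z / 2) g T) / 8) ∂G) := by
        gcongr
        exact h1.trans (by gcongr)
    _ = 2 * (c * ∫⁻ g, ENNReal.ofReal (min 1 (Real.exp (logRatio δ T (shifted a 0 g T)))) ∂G) +
        c * ENNReal.ofReal (1 / 4) + c * ∫⁻ g, ENNReal.ofReal
          (energy δ T (shifted a (fun t z => δ t z / 2) g T) / 8) ∂G := by ring
    _ ≤ _ := by gcongr

end

/-! ### Closed loops under a rank-one change of the parameters -/

section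

variable {K m n : ℕ}

theorem measurable_apply_index {Ω ι E : Type*} [MeasurableSpace Ω] [MeasurableSpace ι]
    [MeasurableSpace E] [Countable ι] [MeasurableSingletonClass ι] {f : Ω → ι → E} {k : Ω → ι}
    (hf : ∀ i, Measurable fun ω => f ω i) (hk : Measurable k) : Measurable fun ω => f ω (k ω) := by
  have h : Measurable fun p : Ω × ι => f p.1 p.2 :=
    measurable_from_prod_countable_left fun i => hf i
  exact h.comp (measurable_id.prodMk hk)

theorem measurable_meanOutput {Ω : Type*} [MeasurableSpace Ω] (θ : Params K m n) {k : Ω → Fin K}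
    {x : Ω → EuclideanSpace ℝ (Fin n)} (hk : Measurable k) (hx : Measurable x) :
    Measurable fun ω => meanOutput θ (k ω) (x ω) := by
  refine measurable_apply_index (f := fun ω i => meanOutput θ i (x ω)) (fun i => ?_) hk
  have : Continuous (Matrix.toEuclideanLin (θ i).1) := LinearMap.continuous_of_finiteDimensional _
  exact (this.measurable.comp hx).add_const _

theorem Policy.IsMeasurable.history {μ : Policy K m n} (hμ : μ.IsMeasurable) (θ : Params K m n)
    (t : ℕ) : Measurable fun ω : Sample μ => μ.history θ ω t := by
  induction t with
  | zero => exact measurable_const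
  | succ t ih =>
    have hs : ∀ r : ℕ, Measurable fun ω : Sample μ => ω.1 r := fun r =>
      (measurable_pi_apply r).comp measurable_fst
    have hx : Measurable fun ω : Sample μ => μ.rule t ω.2.2 (μ.history θ ω t).1 (μ.history θ ω t).2
        fun r : Fin (t + 1) => ω.1 r :=
      (hμ t).comp (measurable_snd.snd.prodMk (ih.fst.prodMk (ih.snd.prodMk
        (measurable_pi_lambda _ fun r => hs r))))
    have hw : Measurable fun ω : Sample μ => ω.2.1 (t, ω.1 (t + 1)) :=
      measurable_apply_index (f := fun (ω : Sample μ) k => ω.2.1 (t, k))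
        (fun k => (measurable_pi_apply (t, k)).comp measurable_snd.fst) (hs (t + 1))
    exact (measurable_snoc ih.fst hx).prodMk
      (measurable_snoc ih.snd ((measurable_meanOutput θ (hs (t + 1)) hx).add hw))

/-- The sum of the squared distances from the inputs of a history to the point `z`. -/
def sumSq {t : ℕ} (z : EuclideanSpace ℝ (Fin n)) (x : Fin t → EuclideanSpace ℝ (Fin n)) : ℝ :=
  ∑ r, ‖x r - z‖ ^ 2

theorem sumSq_nonneg {t : ℕ} (z : EuclideanSpace ℝ (Fin n))
    (x : Fin t → EuclideanSpace ℝ (Fin n)) : 0 ≤ sumSq z x :=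
  Finset.sum_nonneg fun _ _ => sq_nonneg _

theorem measurable_sumSq {t : ℕ} (z : EuclideanSpace ℝ (Fin n)) :
    Measurable fun x : Fin t → EuclideanSpace ℝ (Fin n) => sumSq z x := by
  unfold sumSq
  fun_prop

theorem sumSq_le {t : ℕ} (z z' : EuclideanSpace ℝ (Fin n))
    (x : Fin t → EuclideanSpace ℝ (Fin n)) :
    sumSq z x ≤ 2 * sumSq z' x + 2 * (t * ‖z' - z‖ ^ 2) := by
  have h : ∀ r, ‖x r - z‖ ^ 2 ≤ 2 * ‖x r - z'‖ ^ 2 + 2 * ‖z' - z‖ ^ 2 := fun r => by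
    have h1 : ‖x r - z‖ ≤ ‖x r - z'‖ + ‖z' - z‖ := norm_sub_le_norm_sub_add_norm_sub _ _ _
    nlinarith [norm_nonneg (x r - z), sq_nonneg (‖x r - z'‖ - ‖z' - z‖)]
  calc sumSq z x ≤ ∑ r, (2 * ‖x r - z'‖ ^ 2 + 2 * ‖z' - z‖ ^ 2) :=
        Finset.sum_le_sum fun r _ => h r
    _ = _ := by
        rw [Finset.sum_add_distrib, ← Finset.mul_sum]
        simp [sumSq]
        ring

theorem le_sumSq_add_sumSq {t : ℕ} (z z' : EuclideanSpace ℝ (Fin n))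
    (x : Fin t → EuclideanSpace ℝ (Fin n)) :
    t * ‖z' - z‖ ^ 2 / 2 ≤ sumSq z x + sumSq z' x := by
  have h : ∀ r, ‖z' - z‖ ^ 2 / 2 ≤ ‖x r - z‖ ^ 2 + ‖x r - z'‖ ^ 2 := fun r => by
    have h1 : ‖z' - z‖ ≤ ‖x r - z‖ + ‖x r - z'‖ := by
      calc ‖z' - z‖ ≤ ‖z' - x r‖ + ‖x r - z‖ := norm_sub_le_norm_sub_add_norm_sub _ _ _
        _ = _ := by rw [norm_sub_rev z', add_comm]
    nlinarith [norm_nonneg (z' - z), sq_nonneg (‖x r - z'‖ - ‖x r - z‖)]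
  calc t * ‖z' - z‖ ^ 2 / 2 = ∑ _r : Fin t, ‖z' - z‖ ^ 2 / 2 := by simp; ring
    _ ≤ ∑ r, (‖x r - z‖ ^ 2 + ‖x r - z'‖ ^ 2) := Finset.sum_le_sum fun r _ => h r
    _ = _ := Finset.sum_add_distrib

theorem sumSq_snoc {t : ℕ} (z y : EuclideanSpace ℝ (Fin n))
    (x : Fin t → EuclideanSpace ℝ (Fin n)) :
    sumSq z (Fin.snoc x y : Fin (t + 1) → EuclideanSpace ℝ (Fin n)) = sumSq z x + ‖y - z‖ ^ 2 := by
  simp [sumSq, Fin.sum_univ_castSucc]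

theorem Policy.sum_input {μ : Policy K m n} (θ : Params K m n) (ω : Sample μ)
    (z : EuclideanSpace ℝ (Fin n)) (T : ℕ) :
    ∑ t ∈ Finset.range T, ‖μ.input θ ω t - z‖ ^ 2 = sumSq z (μ.history θ ω T).1 := by
  induction T with
  | zero => simp [sumSq]
  | succ T ih => rw [Finset.sum_range_succ, ih, Policy.history, sumSq_snoc]; rfl

/-- The parameters `θ` after the change `A_k + ε r vᵀ`, `b_k - ε ⟪v, x₀⟫ r` of state `k`. At `x₀`
the mean outputs stay the same. -/
def tilt (θ : Params K m n) (k : Fin K) (r : EuclideanSpace ℝ (Fin m))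
    (v x₀ : EuclideanSpace ℝ (Fin n)) (ε : ℝ) : Params K m n :=
  Function.update θ k ((θ k).1 + ε • Matrix.vecMulVec r.ofLp v.ofLp,
    (θ k).2 - (ε * inner ℝ v x₀) • r)

theorem toEuclideanLin_vecMulVec (r : EuclideanSpace ℝ (Fin m)) (v x : EuclideanSpace ℝ (Fin n)) :
    Matrix.toEuclideanLin (Matrix.vecMulVec r.ofLp v.ofLp) x = (inner ℝ v x : ℝ) • r := by
  ext l
  simp [Matrix.toLpLin_apply, Matrix.vecMulVec_mulVec, EuclideanSpace.inner_eq_star_dotProduct,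
    dotProduct_comm]

theorem toEuclideanLin_tilt (θ : Params K m n) (k : Fin K) (r : EuclideanSpace ℝ (Fin m))
    (v x₀ : EuclideanSpace ℝ (Fin n)) (ε : ℝ) (j : Fin K) (x : EuclideanSpace ℝ (Fin n)) :
    Matrix.toEuclideanLin (tilt θ k r v x₀ ε j).1 x = Matrix.toEuclideanLin (θ j).1 x +
      if j = k then (ε * inner ℝ v x) • r else 0 := by
  by_cases h : j = k
  · subst h
    simp [tilt, map_add, map_smul, toEuclideanLin_vecMulVec, mul_smul]
  · simp [tilt, h]

theorem meanOutput_tilt (θ : Params K m n) (k : Fin K) (r : EuclideanSpace ℝ (Fin m))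
    (v x₀ : EuclideanSpace ℝ (Fin n)) (ε : ℝ) (j : Fin K) (x : EuclideanSpace ℝ (Fin n)) :
    meanOutput (tilt θ k r v x₀ ε) j x = meanOutput θ j x +
      if j = k then (ε * inner ℝ v (x - x₀)) • r else 0 := by
  rw [meanOutput, toEuclideanLin_tilt, meanOutput]
  by_cases h : j = k
  · subst h
    simp only [tilt, Function.update_self, if_true, inner_sub_right, mul_sub, sub_smul]
    abel
  · simp [tilt, h]

/-- The history when the noise of state `k` at time `t` is `(τ * z t) • r` and the other states have
no noise. -/
def gameHistory (μ : Policy K m n) (θ : Params K m n) (k : Fin K) (r : EuclideanSpace ℝ (Fin m))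
    (τ : ℝ) (s : ℕ → Fin K) (u : μ.Seed) : (t : ℕ) → (Fin t → ℝ) →
      (Fin t → EuclideanSpace ℝ (Fin n)) × (Fin t → EuclideanSpace ℝ (Fin m))
  | 0, _ => (Fin.elim0, Fin.elim0)
  | t + 1, z =>
    let h := gameHistory μ θ k r τ s u t (Fin.init z)
    let x := μ.rule t u h.1 h.2 fun r : Fin (t + 1) => s r
    (Fin.snoc h.1 x, Fin.snoc h.2 (meanOutput θ (s (t + 1)) x +
      if s (t + 1) = k then (τ * z (Fin.last t)) • r else 0))

/-- The input at time `t` as a function of the noise. -/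
def gameInput (μ : Policy K m n) (θ : Params K m n) (k : Fin K) (r : EuclideanSpace ℝ (Fin m))
    (τ : ℝ) (s : ℕ → Fin K) (u : μ.Seed) (t : ℕ) (z : Fin t → ℝ) : EuclideanSpace ℝ (Fin n) :=
  μ.rule t u (gameHistory μ θ k r τ s u t z).1 (gameHistory μ θ k r τ s u t z).2
    fun r : Fin (t + 1) => s r

/-- The noise vectors made from standard normal variables. -/
def gameNoise (k : Fin K) (r : EuclideanSpace ℝ (Fin m)) (τ : ℝ) (q : ℕ × Fin K) (x : ℝ) :
    EuclideanSpace ℝ (Fin m) :=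
  if q.2 = k then (τ * x) • r else 0

variable {μ : Policy K m n} {θ : Params K m n} {k : Fin K} {r : EuclideanSpace ℝ (Fin m)} {τ : ℝ}

theorem measurable_gameHistory (hμ : μ.IsMeasurable) (s : ℕ → Fin K) (u : μ.Seed) (t : ℕ) :
    Measurable (gameHistory μ θ k r τ s u t) := by
  induction t with
  | zero => exact measurable_const
  | succ t ih =>
    have ih' : Measurable fun z : Fin (t + 1) → ℝ => gameHistory μ θ k r τ s u t (Fin.init z) :=
      ih.comp measurable_init
    have hx : Measurable fun z : Fin (t + 1) → ℝ =>
        μ.rule t u (gameHistory μ θ k r τ s u t (Fin.init z)).1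
          (gameHistory μ θ k r τ s u t (Fin.init z)).2 fun r : Fin (t + 1) => s r :=
      (hμ t).comp (measurable_const.prodMk (ih'.fst.prodMk (ih'.snd.prodMk measurable_const)))
    have hw : Measurable fun z : Fin (t + 1) → ℝ =>
        if s (t + 1) = k then (τ * z (Fin.last t)) • r else 0 := by
      split_ifs <;> fun_prop
    exact (measurable_snoc ih'.fst hx).prodMk
      (measurable_snoc ih'.snd ((measurable_meanOutput θ measurable_const hx).add hw))

theorem measurable_gameInput (hμ : μ.IsMeasurable) (s : ℕ → Fin K) (u : μ.Seed) (t : ℕ) :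
    Measurable (gameInput μ θ k r τ s u t) := by
  have h := measurable_gameHistory (θ := θ) (k := k) (r := r) (τ := τ) hμ s u t
  exact (hμ t).comp (measurable_const.prodMk (h.fst.prodMk (h.snd.prodMk measurable_const)))

/-- The tilt adds ε⟨v, x - x₀⟩ r to the output of state k, which is a shift of a noise variable with
direction τ r, as τ is nonzero. The coordinate (t, k) is shifted also when the state is not k; the
output then ignores it. -/
theorem history_tilt (hτ : τ ≠ 0) (v x₀ : EuclideanSpace ℝ (Fin n)) (ε : ℝ) (s : ℕ → Fin K)
    (u : μ.Seed) (g : ℕ × Fin K → ℝ) (t : ℕ) :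
    μ.history (tilt θ k r v x₀ ε) (s, fun q => gameNoise k r τ q (g q), u) t =
      gameHistory μ θ k r τ s u t (shifted (fun t => (t, k))
        (fun t z => ε * (τ⁻¹ * inner ℝ v (gameInput μ θ k r τ s u t z - x₀))) g t) := by
  induction t with
  | zero => rfl
  | succ t ih =>
    simp only [Policy.history, gameHistory, ih, shifted, Fin.init_snoc, Fin.snoc_last]
    congr 2
    rw [meanOutput_tilt, add_assoc]
    congr 1
    by_cases h : s (t + 1) = k
    · simp only [h, gameNoise, if_true, gameInput]
      rw [← add_smul, add_comm]
      congr 1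
      field_simp
    · simp [h, gameNoise]

/-- Information is paid for in error: inputs near x₀ make the shifts small, by Cauchy–Schwarz at
each time. -/
theorem energy_le_sumSq (v x₀ : EuclideanSpace ℝ (Fin n)) (ε : ℝ) (s : ℕ → Fin K)
    (u : μ.Seed) (t : ℕ) (z : Fin t → ℝ) :
    energy (fun t z => ε * (τ⁻¹ * inner ℝ v (gameInput μ θ k r τ s u t z - x₀))) t z ≤
      (ε * τ⁻¹ * ‖v‖) ^ 2 * sumSq x₀ (gameHistory μ θ k r τ s u t z).1 := by
  induction t with
  | zero => simp [energy, sumSq]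
  | succ t ih =>
    simp only [energy, gameHistory]
    rw [sumSq_snoc, mul_add]
    refine add_le_add (ih _) ?_
    have h1 := abs_real_inner_le_norm v (gameInput μ θ k r τ s u t (Fin.init z) - x₀)
    have h2 : inner ℝ v (gameInput μ θ k r τ s u t (Fin.init z) - x₀) ^ 2 ≤
        (‖v‖ * ‖gameInput μ θ k r τ s u t (Fin.init z) - x₀‖) ^ 2 := by
      rw [← sq_abs]; gcongr
    calc (ε * (τ⁻¹ * inner ℝ v (gameInput μ θ k r τ s u t (Fin.init z) - x₀))) ^ 2
        = (ε * τ⁻¹) ^ 2 * inner ℝ v (gameInput μ θ k r τ s u t (Fin.init z) - x₀) ^ 2 := by ring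
      _ ≤ (ε * τ⁻¹) ^ 2 * (‖v‖ * ‖gameInput μ θ k r τ s u t (Fin.init z) - x₀‖) ^ 2 := by gcongr
      _ = (ε * τ⁻¹ * ‖v‖) ^ 2 * ‖gameInput μ θ k r τ s u t (Fin.init z) - x₀‖ ^ 2 := by ring

end

/-! ### The two-point bound averaged over state path and seed -/

section

variable {K m n : ℕ}

/-- The noise is put innermost, so that it can be integrated with state path and seed frozen. -/
theorem System.lintegral_law (e : System K m n) (ν : PMF (Fin K)) (μ : Policy K m n)
    {F : Sample μ → ℝ≥0∞} (hF : Measurable F) :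
    ∫⁻ ω, F ω ∂e.law ν μ = ∫⁻ p, ∫⁻ w, F (p.1, w, p.2)
      ∂Measure.infinitePi (fun q : ℕ × Fin K => (e.f q.2 : Measure (EuclideanSpace ℝ (Fin m))))
      ∂(e.chainLaw ν).prod (μ.seedLaw : Measure μ.Seed) := by
  have hr : Measurable fun q : ((ℕ → Fin K) × μ.Seed) × (ℕ × Fin K → EuclideanSpace ℝ (Fin m)) =>
      F (q.1.1, q.2, q.1.2) :=
    hF.comp (measurable_fst.fst.prodMk (measurable_snd.prodMk measurable_fst.snd))
  rw [System.law, lintegral_prod _ hF.aemeasurable, lintegral_prod _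
    (Measurable.lintegral_prod_right' (f := fun q : ((ℕ → Fin K) × μ.Seed) ×
      (ℕ × Fin K → EuclideanSpace ℝ (Fin m)) => F (q.1.1, q.2, q.1.2)) hr).aemeasurable]
  refine lintegral_congr fun s => ?_
  exact lintegral_prod_symm _ (hF.comp measurable_prodMk_left).aemeasurable

theorem measurable_gameNoise (k : Fin K) (r : EuclideanSpace ℝ (Fin m)) (τ : ℝ)
    (q : ℕ × Fin K) : Measurable (gameNoise k r τ q) := by
  unfold gameNoise
  split_ifs <;> fun_prop

/-- The expected sum of squared distances to `z` under the parameters tilted by `ε`. -/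
def tiltMSE (e : System K m n) (ν : PMF (Fin K)) (μ : Policy K m n) (k : Fin K)
    (r : EuclideanSpace ℝ (Fin m)) (v x₀ : EuclideanSpace ℝ (Fin n)) (T : ℕ) (ε : ℝ)
    (z : EuclideanSpace ℝ (Fin n)) : ℝ≥0∞ :=
  ∫⁻ ω, ENNReal.ofReal (sumSq z (μ.history (tilt e.θ k r v x₀ ε) ω T).1) ∂e.law ν μ

/-- The noise law is the same for all tilts, so `two_point_bound` compares the closed loops at 0 and
ε, with the energy measured in the closed loop at ε/2. That loop belongs to the same family, which
lets its error be controlled in turn. -/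
theorem tiltMSE_game {e : System K m n} {k : Fin K} {r : EuclideanSpace ℝ (Fin m)} {τ : ℝ}
    (hτ : τ ≠ 0) (hf : ∀ j, (e.f j : Measure (EuclideanSpace ℝ (Fin m))) =
      (gaussianReal 0 1).map (gameNoise k r τ (0, j)))
    (ν : PMF (Fin K)) {μ : Policy K m n} (hμ : μ.IsMeasurable)
    (v x₀ : EuclideanSpace ℝ (Fin n)) (T : ℕ) (ε : ℝ) (c : ℝ≥0∞)
    (z : EuclideanSpace ℝ (Fin n)) (hc : ∀ x : Fin T → EuclideanSpace ℝ (Fin n),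
      c ≤ ENNReal.ofReal (sumSq x₀ x) + ENNReal.ofReal (sumSq z x)) :
    c ≤ 2 * (tiltMSE e ν μ k r v x₀ T 0 x₀ + tiltMSE e ν μ k r v x₀ T ε z) +
      c * ENNReal.ofReal (1 / 4) +
      c * (ENNReal.ofReal ((ε * τ⁻¹ * ‖v‖) ^ 2 / 8) * tiltMSE e ν μ k r v x₀ T (ε / 2) x₀) := by
  have hmeas : ∀ (ε : ℝ) (z : EuclideanSpace ℝ (Fin n)), Measurable fun ω : Sample μ =>
      ENNReal.ofReal (sumSq z (μ.history (tilt e.θ k r v x₀ ε) ω T).1) := fun ε z =>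
    ((measurable_sumSq z).comp (hμ.history _ T).fst).ennreal_ofReal
  set noise := Measure.infinitePi
    (fun q : ℕ × Fin K => (e.f q.2 : Measure (EuclideanSpace ℝ (Fin m)))) with hnoise
  set G := Measure.infinitePi (fun _ : ℕ × Fin K => gaussianReal 0 1) with hG
  have hmap : noise = G.map (fun g q => gameNoise k r τ q (g q)) := by
    have h := Measure.infinitePi_map_pi (μ := fun _ : ℕ × Fin K => gaussianReal 0 1)
      (f := fun q => gameNoise k r τ q) (measurable_gameNoise k r τ)
    rw [hG, h, hnoise]
    congr 1
    funext q
    rw [hf]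
    rfl
  let I : ℝ → EuclideanSpace ℝ (Fin n) → (ℕ → Fin K) × μ.Seed → ℝ≥0∞ := fun ε z p =>
    ∫⁻ w, ENNReal.ofReal (sumSq z (μ.history (tilt e.θ k r v x₀ ε) (p.1, w, p.2) T).1) ∂noise
  have hI : ∀ ε z, Measurable (I ε z) := fun ε z =>
    Measurable.lintegral_prod_right' (f := fun q : ((ℕ → Fin K) × μ.Seed) ×
      (ℕ × Fin K → EuclideanSpace ℝ (Fin m)) => ENNReal.ofReal
        (sumSq z (μ.history (tilt e.θ k r v x₀ ε) (q.1.1, q.2, q.1.2) T).1))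
      ((hmeas ε z).comp (measurable_fst.fst.prodMk (measurable_snd.prodMk measurable_fst.snd)))
  have hA : ∀ ε z, tiltMSE e ν μ k r v x₀ T ε z =
      ∫⁻ p, I ε z p ∂(e.chainLaw ν).prod (μ.seedLaw : Measure μ.Seed) := fun ε z =>
    e.lintegral_law ν μ (hmeas ε z)
  let D : (ℕ → Fin K) × μ.Seed → (t : ℕ) → (Fin t → ℝ) → ℝ := fun p t z =>
    τ⁻¹ * inner ℝ v (gameInput μ e.θ k r τ p.1 p.2 t z - x₀)
  have hD : ∀ p t, Measurable (D p t) := fun p t =>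
    (((measurable_gameInput hμ p.1 p.2 t).sub_const x₀).const_inner).const_mul _
  let S : EuclideanSpace ℝ (Fin n) → (ℕ → Fin K) × μ.Seed → (Fin T → ℝ) → ℝ≥0∞ := fun z p y =>
    ENNReal.ofReal (sumSq z (gameHistory μ e.θ k r τ p.1 p.2 T y).1)
  have hS : ∀ z p, Measurable (S z p) := fun z p =>
    ((measurable_sumSq z).comp (measurable_gameHistory hμ p.1 p.2 T).fst).ennreal_ofReal
  have hIS : ∀ ε z p, I ε z p =
      ∫⁻ g, S z p (shifted (fun t => (t, k)) (fun t y => ε * D p t y) g T) ∂G := fun ε z p => by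
    simp only [I]
    rw [hmap, lintegral_map]
    · refine lintegral_congr fun g => ?_
      rw [history_tilt hτ]
    · exact (hmeas ε z).comp (measurable_const.prodMk (measurable_id.prodMk measurable_const))
    · exact measurable_pi_lambda _ fun q =>
        (measurable_gameNoise k r τ q).comp (measurable_pi_apply q)
  -- Once path and seed are fixed, the inputs are functions of past Gaussian noise and the shifts
  -- are predictable.
  have hpt : ∀ p, c ≤ 2 * (I 0 x₀ p + I ε z p) + c * ENNReal.ofReal (1 / 4) +
      c * (ENNReal.ofReal ((ε * τ⁻¹ * ‖v‖) ^ 2 / 8) * I (ε / 2) x₀ p) := fun p => by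
    have h := two_point_bound (ι := ℕ × Fin K) (a := fun t => (t, k))
      (δ := fun t y => ε * D p t y) (fun t t' h => (Prod.ext_iff.1 h).1)
      (fun t => (hD p t).const_mul ε) T (hS x₀ p) (hS z p) c (fun y => hc _)
    refine h.trans ?_
    have h0 : (fun (t : ℕ) (y : Fin t → ℝ) => 0 * D p t y) = 0 := by
      funext t y; simp
    have h2 : (fun (t : ℕ) (y : Fin t → ℝ) => ε / 2 * D p t y) =
        fun (t : ℕ) (y : Fin t → ℝ) => ε * D p t y / 2 := by
      funext t y; ring
    rw [hIS, hIS, hIS, h0, h2]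
    gcongr
    have hSm : Measurable fun g : ℕ × Fin K → ℝ =>
        S x₀ p (shifted (fun t => (t, k)) (fun t y => ε * D p t y / 2) g T) :=
      (hS x₀ p).comp (measurable_shifted (fun t => ((hD p t).const_mul ε).div_const 2) T)
    rw [← lintegral_const_mul _ hSm]
    refine lintegral_mono fun g => ?_
    simp only [S]
    rw [← ENNReal.ofReal_mul (by positivity)]
    refine ENNReal.ofReal_le_ofReal ?_
    have := energy_le_sumSq (μ := μ) (θ := e.θ) (k := k) (r := r) (τ := τ) v x₀ ε p.1 p.2 T
      (shifted (fun t => (t, k)) (fun t y => ε * D p t y / 2) g T)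
    rw [div_mul_eq_mul_div]
    exact div_le_div_of_nonneg_right this (by norm_num)
  calc c = ∫⁻ _, c ∂(e.chainLaw ν).prod (μ.seedLaw : Measure μ.Seed) := by simp
    _ ≤ _ := lintegral_mono hpt
    _ = _ := by
      have h0 : Measurable fun p => I 0 x₀ p + I ε z p := (hI 0 x₀).add (hI ε z)
      rw [lintegral_add_left ((h0.const_mul 2).add_const _), lintegral_add_left (h0.const_mul 2),
        lintegral_const_mul _ h0, lintegral_add_left (hI 0 x₀),
        lintegral_const_mul _ ((hI (ε / 2) x₀).const_mul _), lintegral_const_mul _ (hI (ε / 2) x₀),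
        hA, hA, hA]
      simp

end

/-! ### Construction of a hard family of admissible systems -/

section

variable {K m n : ℕ}

theorem exists_lower_bound_of_rank {A : Matrix (Fin m) (Fin n) ℝ} (h : A.rank = n) :
    ∃ c > (0 : ℝ), ∀ x, c * ‖x‖ ≤ ‖Matrix.toEuclideanLin A x‖ := by
  obtain ⟨C, hC, h1⟩ := (Matrix.toEuclideanLin A).exists_antilipschitzWith
    (LinearMap.ker_eq_bot'.2 fun x hx => eq_zero_of_rank A h hx)
  refine ⟨(C : ℝ)⁻¹, by positivity, fun x => ?_⟩
  have h2 := h1.le_mul_dist x 0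
  simp only [map_zero, dist_zero_right] at h2
  rwa [inv_mul_le_iff₀ (by positivity)]

theorem exists_upper_bound (A : Matrix (Fin m) (Fin n) ℝ) :
    ∃ c, 0 ≤ c ∧ ∀ x, ‖Matrix.toEuclideanLin A x‖ ≤ c * ‖x‖ :=
  ⟨‖LinearMap.toContinuousLinearMap (Matrix.toEuclideanLin A)‖, norm_nonneg _, fun x =>
    (LinearMap.toContinuousLinearMap (Matrix.toEuclideanLin A)).le_opNorm x⟩

theorem exists_gaussian_moment_bound : ∃ M : ℝ, 0 ≤ M ∧
    ∫⁻ x, ENNReal.ofReal (x ^ 2) ∂gaussianReal 0 1 ≤ ENNReal.ofReal M ∧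
    ∫⁻ x, ENNReal.ofReal (x ^ 4) ∂gaussianReal 0 1 ≤ ENNReal.ofReal M := by
  have hi : ∀ p : ℕ, Even p → p ≠ 0 → Integrable (fun x : ℝ => x ^ p) (gaussianReal 0 1) := by
    intro p hp hp0
    have := (memLp_id_gaussianReal (μ := 0) (v := 1) p).integrable_norm_pow hp0
    refine this.congr (Filter.Eventually.of_forall fun x => ?_)
    simp [hp.pow_abs]
  have h2 := hi 2 (by decide) (by decide)
  have h4 := hi 4 (by decide) (by decide)
  refine ⟨max (∫ x, x ^ 2 ∂gaussianReal 0 1) (∫ x, x ^ 4 ∂gaussianReal 0 1),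
    le_max_of_le_left (integral_nonneg fun x => by positivity), ?_, ?_⟩
  · rw [← ofReal_integral_eq_lintegral_ofReal h2
      (Filter.Eventually.of_forall fun x => by positivity)]
    exact ENNReal.ofReal_le_ofReal (le_max_left _ _)
  · rw [← ofReal_integral_eq_lintegral_ofReal h4
      (Filter.Eventually.of_forall fun x => by positivity)]
    exact ENNReal.ofReal_le_ofReal (le_max_right _ _)

/-- The noise law of state `j`: Gaussian along `r` for `j = k`, none otherwise. -/
def gameLaw (k : Fin K) (r : EuclideanSpace ℝ (Fin m)) (τ : ℝ) (j : Fin K) :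
    ProbabilityMeasure (EuclideanSpace ℝ (Fin m)) :=
  ⟨(gaussianReal 0 1).map (gameNoise k r τ (0, j)),
    Measure.isProbabilityMeasure_map (measurable_gameNoise k r τ _).aemeasurable⟩

theorem gameNoise_apply (k : Fin K) (r : EuclideanSpace ℝ (Fin m)) (τ : ℝ) (q : ℕ × Fin K) (x : ℝ)
    (l : Fin m) : gameNoise k r τ q x l = (if q.2 = k then τ * r l else 0) * x := by
  unfold gameNoise
  split_ifs
  · simp; ring
  · simp

theorem gameLaw_mean (k : Fin K) (r : EuclideanSpace ℝ (Fin m)) (τ : ℝ) (j : Fin K) (l : Fin m) :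
    ∫ w, w l ∂(gameLaw k r τ j : Measure (EuclideanSpace ℝ (Fin m))) = 0 := by
  change ∫ w, w l ∂((gaussianReal 0 1).map (gameNoise k r τ (0, j))) = 0
  rw [integral_map (measurable_gameNoise k r τ _).aemeasurable (by fun_prop)]
  simp_rw [gameNoise_apply]
  rw [integral_const_mul, integral_id_gaussianReal, mul_zero]

/-- Each noise coordinate is a standard normal variable times a factor of size at most τ‖r‖. As M ≤
(1 + M)^p, one factor 1 + M in the choice of τ serves the second and the fourth moments. -/
theorem gameLaw_moment (k : Fin K) (r : EuclideanSpace ℝ (Fin m)) {τ σ M : ℝ} (hM : 0 ≤ M)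
    (hτ : 0 ≤ τ) (hτr : τ * ‖r‖ * (1 + M) ≤ σ) (j : Fin K) (l : Fin m) {p : ℕ}
    (hp : Even p) (hp0 : p ≠ 0)
    (h : ∫⁻ x, ENNReal.ofReal (x ^ p) ∂gaussianReal 0 1 ≤ ENNReal.ofReal M) :
    ∫⁻ w, ENNReal.ofReal (w l ^ p) ∂(gameLaw k r τ j : Measure (EuclideanSpace ℝ (Fin m))) ≤
      ENNReal.ofReal (σ ^ p) := by
  change ∫⁻ w, ENNReal.ofReal (w l ^ p) ∂((gaussianReal 0 1).map (gameNoise k r τ (0, j))) ≤ _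
  rw [lintegral_map (by fun_prop) (measurable_gameNoise k r τ _)]
  simp_rw [gameNoise_apply, mul_pow, ENNReal.ofReal_mul (hp.pow_nonneg _)]
  rw [lintegral_const_mul _ (by fun_prop)]
  have h1 : (if ((0, j) : ℕ × Fin K).2 = k then τ * r l else 0) ^ p ≤ (τ * ‖r‖) ^ p := by
    rw [← hp.pow_abs]
    refine pow_le_pow_left₀ (abs_nonneg _) ?_ _
    split_ifs
    · rw [abs_mul, abs_of_nonneg hτ]
      exact mul_le_mul_of_nonneg_left (PiLp.norm_apply_le r l) hτ
    · rw [abs_zero]; positivity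
  have h2 : (τ * ‖r‖) ^ p * M ≤ σ ^ p := by
    have h3 : M ≤ (1 + M) ^ p := by
      have := one_add_mul_le_pow (by linarith : (-2 : ℝ) ≤ M) p
      have h4 : (1 : ℝ) ≤ p := by exact_mod_cast Nat.one_le_iff_ne_zero.2 hp0
      nlinarith
    calc (τ * ‖r‖) ^ p * M ≤ (τ * ‖r‖) ^ p * (1 + M) ^ p := by gcongr
      _ = (τ * ‖r‖ * (1 + M)) ^ p := (mul_pow _ _ _).symm
      _ ≤ σ ^ p := by gcongr
  calc _ ≤ ENNReal.ofReal ((τ * ‖r‖) ^ p) * ENNReal.ofReal M := by gcongr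
    _ = ENNReal.ofReal ((τ * ‖r‖) ^ p * M) := (ENNReal.ofReal_mul (hp.pow_nonneg _)).symm
    _ ≤ _ := ENNReal.ofReal_le_ofReal h2

/-- The system with the tilted parameters. -/
def System.tilted (e : System K m n) (k : Fin K) (r : EuclideanSpace ℝ (Fin m))
    (v x₀ : EuclideanSpace ℝ (Fin n)) (ε : ℝ) : System K m n :=
  { e with θ := tilt e.θ k r v x₀ ε }

/-- A family of admissible systems which are hard to tell apart by inputs near `x₀`. -/
structure HardFamily (Θ : Set (Params K m n)) (X : Set (EuclideanSpace ℝ (Fin n)))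
    (ystar : EuclideanSpace ℝ (Fin m)) (σ : ℝ) (e : System K m n) (k : Fin K)
    (r : EuclideanSpace ℝ (Fin m)) (v x₀ : EuclideanSpace ℝ (Fin n))
    (z : ℝ → EuclideanSpace ℝ (Fin n)) (τ ε₀ cl cu lam : ℝ) : Prop where
  τ_ne : τ ≠ 0
  ε₀_pos : 0 < ε₀
  cl_pos : 0 < cl
  lam_pos : 0 < lam
  noise : ∀ j, (e.f j : Measure (EuclideanSpace ℝ (Fin m))) =
    (gaussianReal 0 1).map (gameNoise k r τ (0, j))
  admissible : ∀ ε, 0 ≤ ε → ε ≤ ε₀ → (e.tilted k r v x₀ ε).Admissible Θ X ystar σ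
  optInput : ∀ ε i, (e.tilted k r v x₀ ε).optInput ystar i = z ε
  lower : ∀ ε, 0 ≤ ε → ε ≤ ε₀ → cl * ε ≤ ‖z ε - x₀‖
  upper : ∀ ε, 0 ≤ ε → ε ≤ ε₀ → ‖z ε - x₀‖ ≤ cu * ε
  curved : ∀ ε, 0 ≤ ε → ε ≤ ε₀ → ∀ i x, (e.tilted k r v x₀ ε).stageCost ystar i (z ε) +
    lam * ‖x - z ε‖ ^ 2 ≤ (e.tilted k r v x₀ ε).stageCost ystar i x

variable {Θ : Set (Params K m n)} {X : Set (EuclideanSpace ℝ (Fin n))}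
  {ystar : EuclideanSpace ℝ (Fin m)} {σ : ℝ}

theorem System.Admissible.centered {e : System K m n} (he : e.Admissible Θ X ystar σ) :
    e.Centered σ := ⟨he.full_rank, he.noise_mean, he.noise_second⟩

/-- Every row of the transition matrix is π, so the optimum does not depend on the state. The
outputs at x₀ are fixed by the tilt, and the gradient there changes only through the transpose of ε
r vᵀ acting on the residual r, giving a multiple of v; a bounded, uniformly positive Hessian turns
this into a displacement of order ε. -/
theorem exists_hardFamily (hn : 0 < n) (hσ : 0 < σ) {θ : Params K m n} (hθ : θ ∈ interior Θ)
    (hr : ∀ j, (θ j).1.rank = n) {x₀ : EuclideanSpace ℝ (Fin n)} (hx₀ : x₀ ∈ interior X)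
    (π : PMF (Fin K)) {k k' : Fin K} (hkk : k' ≠ k) (hk : 0 < (π k).toReal)
    (hk' : 0 < (π k').toReal) (hres : ystar - meanOutput θ k x₀ ≠ 0)
    (hgrad : ∀ h, ∑ j, (π j).toReal * inner ℝ (Matrix.toEuclideanLin (θ j).1 h)
      (ystar - meanOutput θ j x₀) = 0) :
    ∃ e k r v z τ ε₀ cl cu lam, HardFamily Θ X ystar σ e k r v x₀ z τ ε₀ cl cu lam := by
  obtain ⟨M, hM, hM2, hM4⟩ := exists_gaussian_moment_bound
  obtain ⟨c, hc, hcA⟩ := exists_lower_bound_of_rank (hr k)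
  obtain ⟨c', hc', hcA'⟩ := exists_lower_bound_of_rank (hr k')
  choose Λ hΛ0 hΛ using fun j => exists_upper_bound (θ j).1
  set r := ystar - meanOutput θ k x₀ with hrdef
  have hr0 : 0 < ‖r‖ := norm_pos_iff.2 hres
  set v : EuclideanSpace ℝ (Fin n) := EuclideanSpace.single ⟨0, hn⟩ 1 with hv
  have hv1 : ‖v‖ = 1 := by simp [hv]
  set τ := σ / (‖r‖ * (1 + M)) with hτdef
  have hτ : 0 < τ := by positivity
  have hτr : τ * ‖r‖ * (1 + M) ≤ σ := by
    rw [hτdef]; field_simp; rfl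
  set e : System K m n := ⟨θ, fun _ => π, gameLaw k r τ⟩ with he
  have hp : ∀ ε i j, (e.tilted k r v x₀ ε).p i j = (π j).toReal := fun ε i j => rfl
  -- The tilt does not touch A_k', so state k' alone supplies a curvature bound valid for every ε.
  set lam := (π k').toReal * c' ^ 2 with hlam
  have hlam0 : 0 < lam := by positivity
  set L := (∑ j, Λ j) + ‖r‖ with hL
  have hL0 : 0 < L := add_pos_of_nonneg_of_pos (Finset.sum_nonneg fun j _ => hΛ0 j) hr0
  set g := (π k).toReal * ‖r‖ ^ 2 with hg
  have hg0 : 0 < g := by positivity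
  obtain ⟨ε₁, hε₁, hΘ⟩ : ∃ ε₁ > 0, ∀ ε : ℝ, |ε| < ε₁ → tilt θ k r v x₀ ε ∈ Θ := by
    have hcont : Continuous fun ε : ℝ => tilt θ k r v x₀ ε := by
      unfold tilt
      refine continuous_const.update k (Continuous.prodMk ?_ ?_)
      · exact continuous_const.add (continuous_id.smul continuous_const)
      · fun_prop
    have h0 : tilt θ k r v x₀ 0 = θ := by simp [tilt]
    have := hcont.continuousAt.preimage_mem_nhds (x := 0)
      (t := interior Θ) (isOpen_interior.mem_nhds (by rwa [h0]))
    obtain ⟨ε₁, hε₁, h⟩ := Metric.mem_nhds_iff.1 this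
    exact ⟨ε₁, hε₁, fun ε hε => interior_subset (h (by simpa using hε))⟩
  obtain ⟨ρ, hρ, hball⟩ := Metric.mem_nhds_iff.1 (mem_interior_iff_mem_nhds.1 hx₀)
  set cu := g / lam with hcu
  have hcu0 : 0 < cu := by positivity
  -- The four bounds keep, in this order, the parameters in Θ, the matrix norms below L, the tilted
  -- A_k injective, and the optimum in the ball around x₀ inside X.
  set ε₀ := min (min (ε₁ / 2) 1) (min (c / (2 * ‖r‖)) (ρ / (2 * cu))) with hε₀
  have hε₀pos : 0 < ε₀ := by
    refine lt_min (lt_min ?_ ?_) (lt_min ?_ ?_) <;> positivity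
  have hrank : ∀ ε, 0 ≤ ε → ε ≤ ε₀ → ∀ j, (tilt θ k r v x₀ ε j).1.rank = n := by
    intro ε h0 h1 j
    by_cases hj : j = k
    · refine rank_eq_of_injective _ fun x hx => ?_
      rw [toEuclideanLin_tilt, if_pos hj, hj] at hx
      have h2 : ‖Matrix.toEuclideanLin (θ k).1 x‖ ≤ ε * ‖x‖ * ‖r‖ := by
        rw [eq_neg_of_add_eq_zero_left hx, norm_neg, norm_smul, norm_mul, Real.norm_of_nonneg h0]
        gcongr
        have := abs_real_inner_le_norm v x
        rwa [hv1, one_mul] at this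
      have h3 := hcA x
      have h4 : ε ≤ c / (2 * ‖r‖) := h1.trans ((min_le_right _ _).trans (min_le_left _ _))
      rw [le_div_iff₀ (by positivity)] at h4
      have h5 : ‖x‖ = 0 := by nlinarith [norm_nonneg x]
      exact norm_eq_zero.1 h5
    · have : tilt θ k r v x₀ ε j = θ j := by simp [tilt, hj]
      rw [this]; exact hr j
  have hlow : ∀ ε i h, lam * ‖h‖ ^ 2 ≤ ∑ j, (e.tilted k r v x₀ ε).p i j *
      ‖Matrix.toEuclideanLin ((e.tilted k r v x₀ ε).θ j).1 h‖ ^ 2 := by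
    intro ε i h
    refine le_trans ?_ (Finset.single_le_sum (fun j _ => mul_nonneg
      ((e.tilted k r v x₀ ε).p_nonneg i j) (sq_nonneg _)) (Finset.mem_univ k'))
    rw [hp, hlam, mul_assoc, ← mul_pow]
    have h1 : Matrix.toEuclideanLin ((e.tilted k r v x₀ ε).θ k').1 h =
        Matrix.toEuclideanLin (θ k').1 h := by
      change Matrix.toEuclideanLin (tilt θ k r v x₀ ε k').1 h = _
      rw [toEuclideanLin_tilt, if_neg hkk, add_zero]
    rw [h1]
    gcongr
    exact hcA' h
  set z : ℝ → EuclideanSpace ℝ (Fin n) := fun ε => (e.tilted k r v x₀ ε).optInput ystar k with hz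
  have hopt : ∀ ε i, (e.tilted k r v x₀ ε).optInput ystar i = z ε := fun ε i => rfl
  -- Stationarity at the new optimum: the Hessian applied to z ε - x₀ is ε g v. Testing with z ε -
  -- x₀ gives the upper bound on the displacement, testing with v the lower one.
  have hkey : ∀ ε, 0 ≤ ε → ε ≤ ε₀ → ∀ h, ∑ j, (π j).toReal * inner ℝ
      (Matrix.toEuclideanLin (tilt θ k r v x₀ ε j).1 h)
      (Matrix.toEuclideanLin (tilt θ k r v x₀ ε j).1 (z ε - x₀)) = ε * g * inner ℝ v h := by
    intro ε h0 h1 h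
    have h2 := congrArg (inner ℝ h)
      ((e.tilted k r v x₀ ε).gram_optInput_sub (hrank ε h0 h1) ystar k x₀)
    rw [System.inner_gram, inner_sum] at h2
    simp only [inner_smul_right, inner_transpose, hp] at h2
    refine h2.trans ?_
    have h3 : ∀ j, (π j).toReal * inner ℝ
        (Matrix.toEuclideanLin ((e.tilted k r v x₀ ε).θ j).1 h)
        (ystar - meanOutput (e.tilted k r v x₀ ε).θ j x₀) =
        (π j).toReal * inner ℝ (Matrix.toEuclideanLin (θ j).1 h) (ystar - meanOutput θ j x₀) +
        if j = k then ε * g * inner ℝ v h else 0 := fun j => by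
      change (π j).toReal * inner ℝ (Matrix.toEuclideanLin (tilt θ k r v x₀ ε j).1 h)
        (ystar - meanOutput (tilt θ k r v x₀ ε) j x₀) = _
      rw [meanOutput_tilt, toEuclideanLin_tilt]
      by_cases hj : j = k
      · subst hj
        simp only [if_true, sub_self, inner_zero_right, mul_zero, zero_smul, add_zero]
        rw [inner_add_left, inner_smul_left, mul_add, ← hrdef, real_inner_self_eq_norm_sq, hg]
        simp only [conj_trivial]
        ring
      · simp [hj]
    rw [Finset.sum_congr rfl fun j _ => h3 j, Finset.sum_add_distrib, hgrad, zero_add,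
      Finset.sum_ite_eq' Finset.univ k, if_pos (Finset.mem_univ _)]
  have hupper : ∀ ε, 0 ≤ ε → ε ≤ ε₀ → ‖z ε - x₀‖ ≤ cu * ε := by
    intro ε h0 h1
    have h2 := hkey ε h0 h1 (z ε - x₀)
    simp only [real_inner_self_eq_norm_sq] at h2
    have h3 : lam * ‖z ε - x₀‖ ^ 2 ≤ ε * g * inner ℝ v (z ε - x₀) := (hlow ε k _).trans h2.le
    have h4 : inner ℝ v (z ε - x₀) ≤ ‖z ε - x₀‖ := by
      have := real_inner_le_norm v (z ε - x₀)
      rwa [hv1, one_mul] at this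
    have h5 : lam * ‖z ε - x₀‖ ^ 2 ≤ ε * g * ‖z ε - x₀‖ := h3.trans (by gcongr)
    rcases (norm_nonneg (z ε - x₀)).eq_or_lt with h6 | h6
    · rw [← h6]; positivity
    · have h7 : lam * ‖z ε - x₀‖ ≤ ε * g := by
        rw [sq, ← mul_assoc] at h5
        exact le_of_mul_le_mul_right h5 h6
      rw [hcu, div_mul_eq_mul_div, le_div_iff₀ hlam0]
      linarith
  have hlower : ∀ ε, 0 ≤ ε → ε ≤ ε₀ → g / L ^ 2 * ε ≤ ‖z ε - x₀‖ := by
    intro ε h0 h1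
    have h2 := hkey ε h0 h1 v
    rw [real_inner_self_eq_norm_sq, hv1] at h2
    have hε1 : ε ≤ 1 := h1.trans ((min_le_left _ _).trans (min_le_right _ _))
    have hA : ∀ j x, ‖Matrix.toEuclideanLin (tilt θ k r v x₀ ε j).1 x‖ ≤ L * ‖x‖ := by
      intro j x
      rw [toEuclideanLin_tilt, hL, add_mul]
      refine (norm_add_le _ _).trans (add_le_add ((hΛ j x).trans ?_) ?_)
      · gcongr
        exact Finset.single_le_sum (fun j _ => hΛ0 j) (Finset.mem_univ j)
      · split_ifs
        · rw [norm_smul, norm_mul, Real.norm_of_nonneg h0]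
          have := abs_real_inner_le_norm v x
          rw [hv1, one_mul] at this
          calc ε * ‖inner ℝ v x‖ * ‖r‖ ≤ 1 * ‖x‖ * ‖r‖ := by gcongr; exact this
            _ = ‖r‖ * ‖x‖ := by ring
        · rw [norm_zero]; positivity
    have h3 : ε * g * 1 ^ 2 ≤ L ^ 2 * ‖z ε - x₀‖ := by
      rw [← h2]
      calc _ ≤ ∑ j, (π j).toReal * (L ^ 2 * ‖z ε - x₀‖) := by
            refine Finset.sum_le_sum fun j _ => mul_le_mul_of_nonneg_left ?_ ENNReal.toReal_nonneg
            refine (real_inner_le_norm _ _).trans ?_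
            calc _ ≤ L * ‖v‖ * (L * ‖z ε - x₀‖) := by
                  gcongr
                  · exact hA _ _
                  · exact hA _ _
              _ = _ := by rw [hv1]; ring
        _ = _ := by
            rw [← Finset.sum_mul]
            have := e.sum_p k
            change ∑ j, (π j).toReal = 1 at this
            rw [this, one_mul]
    rw [div_mul_eq_mul_div, div_le_iff₀ (by positivity)]
    linarith
  have hadm : ∀ ε, 0 ≤ ε → ε ≤ ε₀ → (e.tilted k r v x₀ ε).Admissible Θ X ystar σ := by
    intro ε h0 h1
    refine ⟨hΘ ε ?_, hrank ε h0 h1, fun i => ?_, fun j l => gameLaw_mean k r τ j l,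
      fun j l => gameLaw_moment k r hM hτ.le hτr j l (by decide) (by decide) hM2,
      fun j l => gameLaw_moment k r hM hτ.le hτr j l (by decide) (by decide) hM4⟩
    · rw [abs_of_nonneg h0]
      have : ε ≤ ε₁ / 2 := h1.trans ((min_le_left _ _).trans (min_le_left _ _))
      linarith
    · rw [hopt]
      refine hball (mem_ball_iff_norm.2 ((hupper ε h0 h1).trans_lt ?_))
      have h2 : ε ≤ ρ / (2 * cu) := h1.trans ((min_le_right _ _).trans (min_le_right _ _))
      rw [le_div_iff₀ (by positivity)] at h2
      linarith
  refine ⟨e, k, r, v, z, τ, ε₀, g / L ^ 2, cu, lam, hτ.ne', hε₀pos, by positivity, hlam0,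
    fun j => rfl, hadm, hopt, hlower, hupper, fun ε h0 h1 i x => ?_⟩
  rw [(hadm ε h0 h1).centered.stageCost_eq ystar i x, hopt]
  gcongr
  exact hlow ε i _

end

/-! ### The base system and the lower bounds -/

section

variable {K m n : ℕ} {Θ : Set (Params K m n)} {X : Set (EuclideanSpace ℝ (Fin n))}
  {ystar : EuclideanSpace ℝ (Fin m)} {σ : ℝ}

theorem inner_transpose_left (A : Matrix (Fin m) (Fin n) ℝ) (h : EuclideanSpace ℝ (Fin n))
    (y : EuclideanSpace ℝ (Fin m)) :
    inner ℝ (Matrix.toEuclideanLin A.transpose y) h = inner ℝ y (Matrix.toEuclideanLin A h) := by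
  rw [real_inner_comm, inner_transpose, real_inner_comm]

/-- A vector orthogonal to the range of Aᵀ satisfies ‖A x‖² = 0, so full column rank makes Aᵀ
surjective; any gradient can then be produced by changing one offset. -/
theorem exists_rightInverse_transpose {A : Matrix (Fin m) (Fin n) ℝ} (h : A.rank = n) :
    ∃ S : EuclideanSpace ℝ (Fin n) →ₗ[ℝ] EuclideanSpace ℝ (Fin m),
      ∀ x, Matrix.toEuclideanLin A.transpose (S x) = x := by
  have hsurj : Function.Surjective (Matrix.toEuclideanLin A.transpose) := by
    rw [← LinearMap.range_eq_top, ← Submodule.orthogonal_eq_bot_iff, Submodule.eq_bot_iff]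
    intro x hx
    refine eq_zero_of_rank A h ?_
    have h1 := (Submodule.mem_orthogonal _ _).1 hx _
      (LinearMap.mem_range_self (Matrix.toEuclideanLin A.transpose) (Matrix.toEuclideanLin A x))
    rw [inner_transpose_left] at h1
    exact inner_self_eq_zero.1 h1
  obtain ⟨S, hS⟩ := (Matrix.toEuclideanLin A.transpose).exists_rightInverse_of_surjective
    (LinearMap.range_eq_top.2 hsurj)
  exact ⟨S, fun x => LinearMap.congr_fun hS x⟩

/-- A law on the states with density proportional to `q`. -/
theorem exists_pmf_of_weights (q : Fin K → ℝ) (hq : ∀ j, 0 ≤ q j) (hs : 0 < ∑ j, q j) :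
    ∃ π : PMF (Fin K), ∀ j, (π j).toReal = q j / ∑ j, q j := by
  refine ⟨PMF.ofFintype (fun j => ENNReal.ofReal (q j / ∑ j, q j)) ?_, fun j => ?_⟩
  · rw [← ENNReal.ofReal_sum_of_nonneg fun j _ => div_nonneg (hq j) hs.le, ← Finset.sum_div,
      div_self hs.ne', ENNReal.ofReal_one]
  · rw [PMF.ofFintype_apply, ENNReal.toReal_ofReal (div_nonneg (hq j) hs.le)]

/-- Near every nondegenerate system there is one with independent states, the same optimal input
and a residual that does not vanish. -/
theorem exists_base_system (hK : 1 < K) (hn : 0 < n) {e : System K m n}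
    (he : e.Admissible Θ X ystar σ) (hθ : e.θ ∈ interior Θ) (i : Fin K) :
    ∃ (θ : Params K m n) (π : PMF (Fin K)) (k k' : Fin K), θ ∈ interior Θ ∧
      (∀ j, (θ j).1.rank = n) ∧ k' ≠ k ∧ 0 < (π k).toReal ∧ 0 < (π k').toReal ∧
      ystar - meanOutput θ k (e.optInput ystar i) ≠ 0 ∧
      ∀ h, ∑ j, (π j).toReal * inner ℝ (Matrix.toEuclideanLin (θ j).1 h)
        (ystar - meanOutput θ j (e.optInput ystar i)) = 0 := by
  set x₀ := e.optInput ystar i with hx₀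
  obtain ⟨k', hk'⟩ := e.exists_p_pos i
  have : Nontrivial (Fin K) := Fin.nontrivial_iff_two_le.2 hK
  obtain ⟨k, hk⟩ := exists_ne k'
  obtain ⟨S, hS⟩ := exists_rightInverse_transpose (he.full_rank k')
  have hSc : Continuous S := LinearMap.continuous_of_finiteDimensional S
  set r := ystar - meanOutput e.θ k x₀ with hr
  have hm : 0 < m := by
    have := (e.θ k').1.rank_le_height
    rw [he.full_rank k'] at this
    omega
  -- A direction along which every positive displacement leaves a nonzero residual: any unit vector
  -- if r = 0, and r itself otherwise.
  obtain ⟨d, hd⟩ : ∃ d : EuclideanSpace ℝ (Fin m), ∀ η : ℝ, 0 < η → r + η • d ≠ 0 := by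
    by_cases h0 : r = 0
    · refine ⟨EuclideanSpace.single ⟨0, hm⟩ 1, fun η hη h => ?_⟩
      rw [h0, zero_add, smul_eq_zero] at h
      rcases h with h | h
      · exact hη.ne' h
      · simpa using congrArg norm h
    · refine ⟨r, fun η hη h => h0 ?_⟩
      have h1 : (1 + η) • r = 0 := by rw [add_smul, one_smul]; exact h
      exact (smul_eq_zero.1 h1).resolve_left (by positivity)
  set B := Matrix.toEuclideanLin (e.θ k).1.transpose with hB
  -- The correction of the offset of k' that restores stationarity at x₀: it cancels A_kᵀ((p_k +
  -- η)(r + η d) - p_k r), the gradient created by changing weight and offset of k. It vanishes at η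
  -- = 0.
  let ζ : ℝ → EuclideanSpace ℝ (Fin m) := fun η =>
    (e.p i k')⁻¹ • S (η • B r + ((e.p i k + η) * η) • B d)
  have hζ : Continuous ζ := by
    have h1 : Continuous fun η : ℝ => η • B r + ((e.p i k + η) * η) • B d := by fun_prop
    exact (hSc.comp h1).const_smul (e.p i k')⁻¹
  let θ : ℝ → Params K m n := fun η j => ((e.θ j).1, (e.θ j).2 +
    if j = k then -(η • d) else if j = k' then ζ η else 0)
  have hθc : Continuous θ := by
    refine continuous_pi fun j => continuous_const.prodMk (continuous_const.add ?_)
    split_ifs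
    · fun_prop
    · exact hζ
    · exact continuous_const
  have hθ0 : θ 0 = e.θ := by
    funext j
    simp [θ, ζ]
  have hev := hθc.continuousAt.preimage_mem_nhds (x := 0) (t := interior Θ)
    (isOpen_interior.mem_nhds (by rwa [hθ0]))
  obtain ⟨ρ, hρ, hball⟩ := Metric.mem_nhds_iff.1 hev
  set η := ρ / 2 with hη
  have hη0 : 0 < η := by positivity
  have hθη : θ η ∈ interior Θ := hball (by
    rw [Metric.mem_ball, Real.dist_0_eq_abs, abs_of_pos hη0]; linarith)
  -- State k may have probability 0 after i; the added weight makes it visible. Normalization by the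
  -- total weight does not affect stationarity.
  let q : Fin K → ℝ := fun j => e.p i j + if j = k then η else 0
  have hq : ∀ j, 0 ≤ q j := fun j =>
    add_nonneg (e.p_nonneg i j) (by split_ifs <;> positivity)
  have hqk : 0 < q k := by
    simp only [q, if_true]; linarith [e.p_nonneg i k]
  have hqk' : 0 < q k' := by
    simp only [q, if_neg hk.symm]; linarith
  have hqs : 0 < ∑ j, q j := hqk.trans_le (Finset.single_le_sum (fun j _ => hq j) (Finset.mem_univ k))
  obtain ⟨π, hπ⟩ := exists_pmf_of_weights q hq hqs
  have hres : ∀ j, ystar - meanOutput (θ η) j x₀ = ystar - meanOutput e.θ j x₀ +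
      if j = k then η • d else if j = k' then -ζ η else 0 := fun j => by
    simp only [meanOutput, θ]
    split_ifs <;> abel
  refine ⟨θ η, π, k, k', hθη, he.full_rank, hk.symm, ?_, ?_, ?_, fun h => ?_⟩
  · rw [hπ]; positivity
  · rw [hπ]; positivity
  · rw [hres, if_pos rfl]
    exact hd η hη0
  · have h0 := e.sum_inner_residual he.full_rank ystar i h
    simp_rw [hπ, hres]
    have hk2 : inner ℝ (Matrix.toEuclideanLin (e.θ k').1 h) (ζ η) = (e.p i k')⁻¹ *
        (η * inner ℝ (Matrix.toEuclideanLin (e.θ k).1 h) r +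
          (e.p i k + η) * η * inner ℝ (Matrix.toEuclideanLin (e.θ k).1 h) d) := by
      simp only [ζ]
      rw [inner_smul_right, ← inner_transpose, hS, inner_add_right, inner_smul_right,
        inner_smul_right, hB, inner_transpose, inner_transpose]
    have h1 : ∀ j, q j / (∑ j, q j) * inner ℝ (Matrix.toEuclideanLin (e.θ j).1 h)
        (ystar - meanOutput e.θ j x₀ + if j = k then η • d else if j = k' then -ζ η else 0) =
        (∑ j, q j)⁻¹ * (e.p i j * inner ℝ (Matrix.toEuclideanLin (e.θ j).1 h)
          (ystar - meanOutput e.θ j x₀) +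
        ((if j = k then η * inner ℝ (Matrix.toEuclideanLin (e.θ k).1 h) r +
          (e.p i k + η) * η * inner ℝ (Matrix.toEuclideanLin (e.θ k).1 h) d else 0) +
        if j = k' then -(e.p i k' * inner ℝ (Matrix.toEuclideanLin (e.θ k').1 h) (ζ η)) else 0)) := by
      intro j
      rw [div_eq_inv_mul, mul_assoc]
      congr 1
      by_cases hj : j = k
      · subst hj
        simp only [q, if_true, if_neg hk, inner_add_right, inner_smul_right]
        rw [← hr]
        ring
      · by_cases hj' : j = k'
        · subst hj'
          simp only [q, if_true, if_neg hk.symm, inner_add_right, inner_neg_right]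
          ring
        · simp [q, hj, hj']
    change ∑ j, q j / (∑ j, q j) * inner ℝ (Matrix.toEuclideanLin (e.θ j).1 h)
        (ystar - meanOutput e.θ j x₀ + if j = k then η • d else if j = k' then -ζ η else 0) = 0
    rw [Finset.sum_congr rfl fun j _ => h1 j, ← Finset.mul_sum]
    refine mul_eq_zero_of_right _ ?_
    rw [Finset.sum_add_distrib, h0,
      Finset.sum_add_distrib, Finset.sum_ite_eq' Finset.univ k, Finset.sum_ite_eq' Finset.univ k',
      if_pos (Finset.mem_univ _), if_pos (Finset.mem_univ _), hk2, mul_inv_cancel_left₀ hk'.ne']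
    ring

theorem cumMSE_tilted {e : System K m n} {k : Fin K} {r : EuclideanSpace ℝ (Fin m)}
    {v x₀ : EuclideanSpace ℝ (Fin n)} {ε : ℝ} {z : EuclideanSpace ℝ (Fin n)}
    (hz : ∀ i, (e.tilted k r v x₀ ε).optInput ystar i = z) (ν : PMF (Fin K)) (μ : Policy K m n)
    (T : ℕ) : cumMSE ystar ν (e.tilted k r v x₀ ε) μ T = tiltMSE e ν μ k r v x₀ T ε z := by
  simp only [cumMSE, hz, Policy.sum_input]
  rfl

/-- Recentring, used because the energy involves distances to x₀ while the error at ε/2 is measured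
from another optimum. -/
theorem tiltMSE_le (e : System K m n) (ν : PMF (Fin K)) {μ : Policy K m n} (hμ : μ.IsMeasurable)
    (k : Fin K) (r : EuclideanSpace ℝ (Fin m)) (v x₀ : EuclideanSpace ℝ (Fin n)) (T : ℕ) (ε : ℝ)
    (z z' : EuclideanSpace ℝ (Fin n)) : tiltMSE e ν μ k r v x₀ T ε z ≤
      2 * tiltMSE e ν μ k r v x₀ T ε z' + ENNReal.ofReal (2 * (T * ‖z' - z‖ ^ 2)) := by
  have hm : Measurable fun ω : Sample μ =>
      ENNReal.ofReal (sumSq z' (μ.history (tilt e.θ k r v x₀ ε) ω T).1) :=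
    ((measurable_sumSq z').comp (hμ.history _ T).fst).ennreal_ofReal
  have : IsProbabilityMeasure (e.law ν μ) := by rw [System.law]; infer_instance
  calc tiltMSE e ν μ k r v x₀ T ε z ≤ ∫⁻ ω, (2 * ENNReal.ofReal
        (sumSq z' (μ.history (tilt e.θ k r v x₀ ε) ω T).1) +
          ENNReal.ofReal (2 * (T * ‖z' - z‖ ^ 2))) ∂e.law ν μ := lintegral_mono fun ω => by
        have h2 : ∀ x : ℝ, 2 * ENNReal.ofReal x = ENNReal.ofReal (2 * x) := fun x => by
          rw [ENNReal.ofReal_mul (by norm_num), ENNReal.ofReal_ofNat]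
        rw [h2, ← ENNReal.ofReal_add (mul_nonneg (by norm_num) (sumSq_nonneg _ _)) (by positivity)]
        exact ENNReal.ofReal_le_ofReal (sumSq_le _ _ _)
    _ = _ := by
        rw [lintegral_add_right _ measurable_const, lintegral_const_mul _ hm]
        simp [tiltMSE]

/-- No policy does well on all members of a hard family. -/
theorem HardFamily.lower_bound {e : System K m n} {k : Fin K} {r : EuclideanSpace ℝ (Fin m)}
    {v x₀ : EuclideanSpace ℝ (Fin n)} {z : ℝ → EuclideanSpace ℝ (Fin n)} {τ ε₀ cl cu lam : ℝ}
    (hF : HardFamily Θ X ystar σ e k r v x₀ z τ ε₀ cl cu lam) :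
    ∃ c > (0 : ℝ), ∀ (ν : PMF (Fin K)) (μ : Policy K m n), μ.IsMeasurable → ∀ T : ℕ, ∀ W : ℝ≥0∞,
      (∀ ε, 0 ≤ ε → ε ≤ ε₀ → cumMSE ystar ν (e.tilted k r v x₀ ε) μ T ≤ W) →
      ENNReal.ofReal (c * √T) ≤ W := by
  obtain ⟨hτ, hε₀, hcl, -, hnoise, -, hopt, hlow, hup, -⟩ := hF
  set κ := ‖v‖ ^ 2 / (8 * τ ^ 2) with hκ
  have hκ0 : 0 ≤ κ := by positivity
  -- Chosen so that q⁴ κ cu² ≤ 1/4, where κ ε² is the energy per unit of squared distance to x₀,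
  -- divided by 8.
  set q := min (min ε₀ 1) (1 / (4 * (κ * cu ^ 2 + 1))) with hq
  have hq0 : 0 < q := lt_min (lt_min hε₀ one_pos) (by positivity)
  have hqε : q ≤ ε₀ := (min_le_left _ _).trans (min_le_left _ _)
  have hq1 : q ≤ 1 := (min_le_left _ _).trans (min_le_right _ _)
  have hqκ : q ^ 4 * (κ * cu ^ 2) ≤ 1 / 4 := by
    have h1 : q ≤ 1 / (4 * (κ * cu ^ 2 + 1)) := min_le_right _ _
    rw [le_div_iff₀ (by positivity)] at h1
    have h2 : q ^ 4 ≤ q := pow_le_of_le_one hq0.le hq1 (by norm_num)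
    have h3 : 0 ≤ κ * cu ^ 2 := by positivity
    nlinarith
  refine ⟨cl ^ 2 * q ^ 2 / 80, by positivity, fun ν μ hμ T W hW => ?_⟩
  rcases Nat.eq_zero_or_pos T with rfl | hT
  · simp
  rcases eq_or_ne W ∞ with rfl | hWtop
  · exact le_top
  obtain ⟨w, hw0, hWw⟩ : ∃ w : ℝ, 0 ≤ w ∧ W = ENNReal.ofReal w :=
    ⟨W.toReal, ENNReal.toReal_nonneg, (ENNReal.ofReal_toReal hWtop).symm⟩
  have hT1 : (1 : ℝ) ≤ √T := Real.one_le_sqrt.2 (by exact_mod_cast hT)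
  have hTT : √(T : ℝ) * √T = T := Real.mul_self_sqrt (Nat.cast_nonneg T)
  have hs1 : 1 ≤ √(√(T : ℝ)) := Real.one_le_sqrt.2 hT1
  have hss : √(√(T : ℝ)) * √(√T) = √T := Real.mul_self_sqrt (Real.sqrt_nonneg _)
  -- At the scale T^(-1/4) the separation Tε² is q²√T, while Tε⁴ = q⁴ stays bounded.
  set ε := q / √(√(T : ℝ)) with hε
  have hε0 : 0 < ε := by positivity
  have hεq : ε ≤ ε₀ := (div_le_self hq0.le hs1).trans hqε
  have hTε : T * ε ^ 2 = q ^ 2 * √T := by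
    rw [hε, div_pow, sq √(√(T : ℝ)), hss]
    field_simp
    nlinarith
  have hTε4 : T * ε ^ 4 = q ^ 4 := by
    calc T * ε ^ 4 = (T * ε ^ 2) * ε ^ 2 := by ring
      _ = q ^ 2 * √T * ε ^ 2 := by rw [hTε]
      _ = q ^ 4 := by
        rw [hε, div_pow, sq √(√(T : ℝ)), hss]
        field_simp
  have hz0 : z 0 = x₀ := by
    have h := hup 0 le_rfl hε₀.le
    rw [mul_zero] at h
    exact sub_eq_zero.1 (norm_le_zero_iff.1 h)
  set D := ‖z ε - x₀‖ with hD
  set c := T * D ^ 2 / 2 with hc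
  have hc0 : 0 ≤ c := by positivity
  have hDl := hlow ε hε0.le hεq
  have hDu := hup ε hε0.le hεq
  have h0 : tiltMSE e ν μ k r v x₀ T 0 x₀ ≤ ENNReal.ofReal w := by
    have := hW 0 le_rfl hε₀.le
    rwa [cumMSE_tilted (hopt 0), hz0, hWw] at this
  have h1 : tiltMSE e ν μ k r v x₀ T ε (z ε) ≤ ENNReal.ofReal w := by
    have := hW ε hε0.le hεq
    rwa [cumMSE_tilted (hopt ε), hWw] at this
  -- The system at ε/2 is also admissible, so its error is at most w as well; moving the centre to
  -- x₀ costs a multiple of Tε².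
  have h2 : tiltMSE e ν μ k r v x₀ T (ε / 2) x₀ ≤
      ENNReal.ofReal (2 * w + 2 * (T * (cu * (ε / 2)) ^ 2)) := by
    have h3 := hW (ε / 2) (by positivity) (by linarith)
    rw [cumMSE_tilted (hopt _), hWw] at h3
    refine (tiltMSE_le e ν hμ k r v x₀ T (ε / 2) x₀ (z (ε / 2))).trans ?_
    rw [ENNReal.ofReal_add (by positivity) (by positivity),
      ENNReal.ofReal_mul (p := 2) (q := w) (by norm_num), ENNReal.ofReal_ofNat 2]
    refine add_le_add (mul_le_mul_right h3 _) (ENNReal.ofReal_le_ofReal ?_)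
    gcongr
    exact hup (ε / 2) (by positivity) (by linarith)
  have hgame := tiltMSE_game hτ hnoise ν hμ v x₀ T ε (ENNReal.ofReal c) (z ε) (fun x => by
    rw [← ENNReal.ofReal_add (sumSq_nonneg _ _) (sumSq_nonneg _ _)]
    exact ENNReal.ofReal_le_ofReal (le_sumSq_add_sumSq _ _ _))
  have hgame2 : ENNReal.ofReal c ≤ ENNReal.ofReal (2 * (w + w) + c * (1 / 4) +
      c * ((ε * τ⁻¹ * ‖v‖) ^ 2 / 8 * (2 * w + 2 * (T * (cu * (ε / 2)) ^ 2)))) := by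
    refine hgame.trans ?_
    rw [ENNReal.ofReal_add (by positivity) (by positivity),
      ENNReal.ofReal_add (by positivity) (by positivity), ENNReal.ofReal_mul (by norm_num),
      ENNReal.ofReal_add hw0 hw0, ENNReal.ofReal_mul hc0, ENNReal.ofReal_mul hc0,
      ENNReal.ofReal_mul (by positivity), ENNReal.ofReal_ofNat 2]
    gcongr
  have hreal := (ENNReal.ofReal_le_ofReal_iff (by positivity)).1 hgame2
  have hκε : (ε * τ⁻¹ * ‖v‖) ^ 2 / 8 = κ * ε ^ 2 := by
    rw [hκ]; field_simp
  rw [hκε] at hreal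
  have hcu : c ≤ cu ^ 2 * (T * ε ^ 2) / 2 := by
    have : D ^ 2 ≤ (cu * ε) ^ 2 := pow_le_pow_left₀ (norm_nonneg _) hDu 2
    have hT0 : (0 : ℝ) ≤ T := Nat.cast_nonneg T
    rw [hc]; nlinarith
  -- Separation times information is of order Tε⁴ w = q⁴ w, hence absorbed by w itself. The next
  -- estimate absorbs the recentring cost into c in the same way.
  have e1 : c * (κ * ε ^ 2 * (2 * w)) ≤ w := by
    calc c * (κ * ε ^ 2 * (2 * w)) ≤ cu ^ 2 * (T * ε ^ 2) / 2 * (κ * ε ^ 2 * (2 * w)) := by gcongr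
      _ = (T * ε ^ 4) * (κ * cu ^ 2) * w := by ring
      _ ≤ 1 / 4 * w := by rw [hTε4]; gcongr
      _ ≤ w := by linarith
  have e2 : c * (κ * ε ^ 2 * (2 * (T * (cu * (ε / 2)) ^ 2))) ≤ c / 4 := by
    calc c * (κ * ε ^ 2 * (2 * (T * (cu * (ε / 2)) ^ 2)))
        = c * ((T * ε ^ 4) * (κ * cu ^ 2) / 2) := by ring
      _ ≤ c * (1 / 4 / 2) := by rw [hTε4]; gcongr
      _ ≤ c / 4 := by linarith
  have e3 : c / 2 ≤ 5 * w := by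
    rw [mul_add (κ * ε ^ 2), mul_add c] at hreal
    linarith
  have e4 : cl ^ 2 * q ^ 2 * √T ≤ 2 * c := by
    have h3 : (cl * ε) ^ 2 ≤ D ^ 2 := pow_le_pow_left₀ (by positivity) hDl 2
    calc cl ^ 2 * q ^ 2 * √T = T * (cl * ε) ^ 2 := by rw [mul_assoc, ← hTε]; ring
      _ ≤ T * D ^ 2 := by gcongr
      _ = 2 * c := by rw [hc]; ring
  rw [hWw]
  refine ENNReal.ofReal_le_ofReal ?_
  have : cl ^ 2 * q ^ 2 / 80 * √T = cl ^ 2 * q ^ 2 * √T / 80 := by ring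
  linarith

/-- A uniform growth condition turns the cumulative input error into a lower bound of the regret. -/
theorem mul_cumMSE_le_regret {e : System K m n} {lam : ℝ} (hlam : 0 ≤ lam)
    (h : ∀ i x, e.stageCost ystar i (e.optInput ystar i) + lam * ‖x - e.optInput ystar i‖ ^ 2 ≤
      e.stageCost ystar i x) (ν : PMF (Fin K)) (μ : Policy K m n) (T : ℕ) :
    ENNReal.ofReal lam * cumMSE ystar ν e μ T ≤ regret ystar ν e μ T := by
  rw [cumMSE, regret, ← lintegral_const_mul' _ _ ENNReal.ofReal_ne_top]
  refine lintegral_mono fun ω => ?_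
  rw [← ENNReal.ofReal_mul hlam, Finset.mul_sum, ← Finset.sum_sub_distrib]
  refine ENNReal.ofReal_le_ofReal (Finset.sum_le_sum fun t _ => ?_)
  linarith [h (ω.1 t) (μ.input e.θ ω t)]

theorem cumMSE_le_worstMSE {e : System K m n} (he : e.Admissible Θ X ystar σ) (ν : PMF (Fin K))
    (μ : Policy K m n) (T : ℕ) : cumMSE ystar ν e μ T ≤ worstMSE Θ X ystar σ ν μ T :=
  le_iSup₂ (f := fun (e : System K m n) (_ : e.Admissible Θ X ystar σ) => cumMSE ystar ν e μ T) e he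

theorem regret_le_worstRegret {e : System K m n} (he : e.Admissible Θ X ystar σ)
    (ν : PMF (Fin K)) (μ : Policy K m n) (T : ℕ) :
    regret ystar ν e μ T ≤ worstRegret Θ X ystar σ ν μ T :=
  le_iSup₂ (f := fun (e : System K m n) (_ : e.Admissible Θ X ystar σ) => regret ystar ν e μ T) e he

/-- The lower bounds for all policies. -/
theorem exists_worst_lower_bounds (hK : 1 < K) (hn : 0 < n) (hσ : 0 < σ)
    (hint : ∃ e : System K m n, e.Admissible Θ X ystar σ ∧ e.θ ∈ interior Θ ∧
      ∀ i, e.optInput ystar i ∈ interior X) :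
    ∃ C' > (0 : ℝ), ∃ C'' > (0 : ℝ), ∀ (ν : PMF (Fin K)) (μ : Policy K m n),
      μ.IsMeasurable → ∀ T : ℕ,
        ENNReal.ofReal (C' * √T) ≤ worstMSE Θ X ystar σ ν μ T ∧
        ENNReal.ofReal (C'' * √T) ≤ worstRegret Θ X ystar σ ν μ T := by
  obtain ⟨e₀, he₀, hθ₀, hx₀⟩ := hint
  obtain ⟨θ, π, k, k', hθ, hr, hkk, hk, hk', hres, hgrad⟩ :=
    exists_base_system hK hn he₀ hθ₀ ⟨0, by omega⟩
  obtain ⟨e, k, r, v, z, τ, ε₀, cl, cu, lam, hF⟩ := exists_hardFamily hn hσ hθ hr (hx₀ ⟨0, by omega⟩)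
    π hkk hk hk' hres hgrad
  obtain ⟨c, hc, hlow⟩ := hF.lower_bound
  have hl := hF.lam_pos
  refine ⟨c, hc, lam * c, by positivity, fun ν μ hμ T => ⟨?_, ?_⟩⟩
  · exact hlow ν μ hμ T _ fun ε h0 h1 => cumMSE_le_worstMSE (hF.admissible ε h0 h1) ν μ T
  -- The uniform curvature makes worst-case regret divided by `lam` a bound for the error on the
  -- whole family.
  · have hW := hlow ν μ hμ T ((ENNReal.ofReal lam)⁻¹ * worstRegret Θ X ystar σ ν μ T)
      fun ε h0 h1 => by
        have h2 := mul_cumMSE_le_regret (ystar := ystar) hl.le (fun i x => by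
          rw [hF.optInput]; exact hF.curved ε h0 h1 i x) ν μ T
        have h3 := regret_le_worstRegret (hF.admissible ε h0 h1) ν μ T
        rw [mul_comm (ENNReal.ofReal lam)⁻¹, ← div_eq_mul_inv, ENNReal.le_div_iff_mul_le
          (Or.inl (by simpa using hl)) (Or.inl ENNReal.ofReal_ne_top), mul_comm]
        exact h2.trans h3
    rw [mul_comm (ENNReal.ofReal lam)⁻¹, ← div_eq_mul_inv, ENNReal.le_div_iff_mul_le
      (Or.inl (by simpa using hl)) (Or.inl ENNReal.ofReal_ne_top),
      ← ENNReal.ofReal_mul (by positivity)] at hW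
    convert hW using 2
    ring

end

/-! ### Euclidean projection -/

section

variable {n : ℕ} {X : Set (EuclideanSpace ℝ (Fin n))}

theorem proj_spec (hX : IsCompact X) (hne : X.Nonempty) (x : EuclideanSpace ℝ (Fin n)) :
    proj X x ∈ X ∧ dist x (proj X x) = Metric.infDist x X := by
  have h : ∃ z ∈ X, dist x z = Metric.infDist x X := by
    obtain ⟨z, hz, h⟩ := hX.exists_infDist_eq_dist hne x
    exact ⟨z, hz, h.symm⟩
  rw [proj, dif_pos h]
  exact h.choose_spec

theorem proj_inner_le (hX : IsCompact X) (hXc : Convex ℝ X) (hne : X.Nonempty)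
    (x : EuclideanSpace ℝ (Fin n)) {z : EuclideanSpace ℝ (Fin n)} (hz : z ∈ X) :
    inner ℝ (x - proj X x) (z - proj X x) ≤ 0 := by
  obtain ⟨h1, h2⟩ := proj_spec hX hne x
  refine (norm_eq_iInf_iff_real_inner_le_zero hXc h1).1 ?_ z hz
  rw [← dist_eq_norm, h2, Metric.infDist_eq_iInf]
  exact iInf_congr fun w => dist_eq_norm _ _

theorem norm_proj_sub_proj_le (hX : IsCompact X) (hXc : Convex ℝ X) (hne : X.Nonempty)
    (x y : EuclideanSpace ℝ (Fin n)) : ‖proj X x - proj X y‖ ≤ ‖x - y‖ := by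
  have h1 := proj_inner_le hX hXc hne x (proj_spec hX hne y).1
  have h2 := proj_inner_le hX hXc hne y (proj_spec hX hne x).1
  set p := proj X x
  set q := proj X y
  have h3 : ‖p - q‖ * ‖p - q‖ ≤ inner ℝ (x - y) (p - q) := by
    rw [← real_inner_self_eq_norm_mul_norm]
    have e1 : inner ℝ (x - p) (q - p) = - inner ℝ (x - p) (p - q) := by
      rw [← inner_neg_right, neg_sub]
    have e2 : inner ℝ (x - y) (p - q) = inner ℝ (x - p) (p - q) - inner ℝ (y - q) (p - q) +
        inner ℝ (p - q) (p - q) := by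
      rw [← inner_sub_left, ← inner_add_left]
      congr 1
      abel
    linarith
  have h4 := real_inner_le_norm (x - y) (p - q)
  rcases (norm_nonneg (p - q)).eq_or_lt with h | h
  · rw [← h]; exact norm_nonneg _
  · exact le_of_mul_le_mul_right (h3.trans h4) h

theorem measurable_proj (hX : IsCompact X) (hXc : Convex ℝ X) (hne : X.Nonempty) :
    Measurable (proj X) := by
  refine (LipschitzWith.of_dist_le_mul (K := 1) fun x y => ?_).continuous.measurable
  rw [dist_eq_norm, dist_eq_norm, NNReal.coe_one, one_mul]
  exact norm_proj_sub_proj_le hX hXc hne x y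

theorem proj_eq_self {x : EuclideanSpace ℝ (Fin n)} (hX : IsCompact X) (hx : x ∈ X) :
    proj X x = x := by
  have h := (proj_spec hX ⟨x, hx⟩ x).2
  rw [Metric.infDist_zero_of_mem hx, dist_eq_zero] at h
  exact h.symm

theorem norm_proj_sub_le (hX : IsCompact X) (hXc : Convex ℝ X) (x : EuclideanSpace ℝ (Fin n))
    {z : EuclideanSpace ℝ (Fin n)} (hz : z ∈ X) : ‖proj X x - z‖ ≤ ‖x - z‖ := by
  have := norm_proj_sub_proj_le hX hXc ⟨z, hz⟩ x z
  rwa [proj_eq_self hX hz] at this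

end

/-! ### MSPSA is a measurable policy -/

section

variable {K m n : ℕ}

instance : MeasurableSpace (Memory n) :=
  MeasurableSpace.comap (fun M => (M.est, M.count, M.flag, M.dplus)) inferInstance

theorem measurable_memory_iff {Ω : Type*} [MeasurableSpace Ω] {f : Ω → Memory n} :
    Measurable f ↔ Measurable (fun ω => (f ω).est) ∧ Measurable (fun ω => (f ω).count) ∧
      Measurable (fun ω => (f ω).flag) ∧ Measurable (fun ω => (f ω).dplus) := by
  refine measurable_comap_iff.trans ?_
  constructor
  · intro h
    exact ⟨h.fst, h.snd.fst, h.snd.snd.fst, h.snd.snd.snd⟩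
  · rintro ⟨h1, h2, h3, h4⟩
    exact h1.prodMk (h2.prodMk (h3.prodMk h4))

variable {Ω : Type*} [MeasurableSpace Ω]

theorem measurable_toLp {f : Ω → Fin n → ℝ} (hf : ∀ l, Measurable fun ω => f ω l) :
    Measurable fun ω => (WithLp.toLp 2 (f ω) : EuclideanSpace ℝ (Fin n)) :=
  (WithLp.measurable_toLp 2 (Fin n → ℝ)).comp (measurable_pi_lambda _ hf)

theorem measurable_pertVec {u : Ω → PertSeed K n} {i : Ω → Fin K} {k : Ω → ℕ} (hu : Measurable u)
    (hi : Measurable i) (hk : Measurable k) : Measurable fun ω => pertVec (u ω) (i ω) (k ω) := by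
  refine measurable_apply_index (f := fun ω (p : Fin K × ℕ) => pertVec (u ω) p.1 p.2)
    (fun p => ?_) (hi.prodMk hk)
  exact measurable_toLp fun l => (measurable_pi_apply _).comp hu

/-- The coordinatewise inverse of a vector. -/
def invVec (x : EuclideanSpace ℝ (Fin n)) : EuclideanSpace ℝ (Fin n) :=
  WithLp.toLp 2 fun l => (x l)⁻¹

theorem measurable_invVec : Measurable (invVec (n := n)) :=
  measurable_toLp fun l => Measurable.inv (by fun_prop)

theorem pertInv_eq (u : PertSeed K n) (i : Fin K) (k : ℕ) :
    pertInv u i k = invVec (pertVec u i k) := rfl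

theorem MSPSA.measurable_output (α : MSPSA K n) {u : Ω → PertSeed K n} {i : Ω → Fin K}
    {M : Ω → Memory n} (hu : Measurable u) (hi : Measurable i) (hM : Measurable M) :
    Measurable fun ω => α.output (u ω) (i ω) (M ω) := by
  obtain ⟨h1, h2, h3, -⟩ := measurable_memory_iff.1 hM
  have hg : ∀ k : Ω → ℕ, Measurable k → Measurable fun ω => α.gain (i ω) (k ω) := fun k hk =>
    (measurable_of_countable fun p : Fin K × ℕ => α.gain p.1 p.2).comp (hi.prodMk hk)
  refine Measurable.ite (h3 (measurableSet_singleton true)) ?_ ?_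
  · exact h1.sub ((hg _ h2).smul (measurable_pertVec hu hi h2))
  · exact h1.add ((hg _ (h2.add_const 1)).smul (measurable_pertVec hu hi (h2.add_const 1)))

theorem MSPSA.measurable_update (α : MSPSA K n) {X : Set (EuclideanSpace ℝ (Fin n))}
    (hproj : Measurable (proj X)) {u : Ω → PertSeed K n} {i : Ω → Fin K}
    {M : Ω → Memory n} {d : Ω → ℝ} (hu : Measurable u) (hi : Measurable i) (hM : Measurable M)
    (hd : Measurable d) : Measurable fun ω => α.update X (u ω) (i ω) (M ω) (d ω) := by
  obtain ⟨h1, h2, h3, h4⟩ := measurable_memory_iff.1 hM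
  have hg : Measurable fun ω => α.gain (i ω) (M ω).count :=
    (measurable_of_countable fun p : Fin K × ℕ => α.gain p.1 p.2).comp (hi.prodMk h2)
  have ha : Measurable fun ω => α.stepSize (i ω) (M ω).count :=
    (measurable_of_countable fun p : Fin K × ℕ => α.stepSize p.1 p.2).comp (hi.prodMk h2)
  refine Measurable.ite (h3 (measurableSet_singleton true)) ?_ ?_
  · refine measurable_memory_iff.2 ⟨hproj.comp (h1.sub ((ha.mul ((h4.sub hd).div hg)).smul ?_)),
      h2, measurable_const, h4⟩
    exact measurable_invVec.comp (measurable_pertVec hu hi h2)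
  · exact measurable_memory_iff.2 ⟨h1, h2.add_const 1, measurable_const, hd⟩

theorem MSPSA.measurable_memory (α : MSPSA K n) {X : Set (EuclideanSpace ℝ (Fin n))}
    (hproj : Measurable (proj X)) (ystar : EuclideanSpace ℝ (Fin m)) (t : ℕ)
    {u : Ω → PertSeed K n} {y : Ω → Fin t → EuclideanSpace ℝ (Fin m)} {s : Ω → Fin t → Fin K}
    (hu : Measurable u) (hy : Measurable y) (hs : Measurable s) (i : Fin K) :
    Measurable fun ω => α.memory X ystar (u ω) t (y ω) (s ω) i := by
  induction t generalizing i with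
  | zero => exact measurable_const
  | succ t ih =>
    have hy' : Measurable fun ω => (Fin.init (y ω) : Fin t → _) := measurable_init.comp hy
    have hs' : Measurable fun ω => (Fin.init (s ω) : Fin t → _) := measurable_init.comp hs
    have hl : Measurable fun ω => s ω (Fin.last t) := (measurable_pi_apply _).comp hs
    have hM := ih hy' hs'
    have hMi : Measurable fun ω => α.memory X ystar (u ω) t (Fin.init (y ω)) (Fin.init (s ω))
        (s ω (Fin.last t)) := measurable_apply_index hM hl
    have hyl : Measurable fun ω => ‖y ω (Fin.last t) - ystar‖ ^ 2 :=
      (((measurable_pi_apply _).comp hy).sub_const ystar).norm.pow_const 2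
    simp only [MSPSA.memory, Function.update_apply]
    exact Measurable.ite (measurableSet_eq_fun measurable_const hl)
      (α.measurable_update hproj hu hl hMi hyl) (hM i)

theorem MSPSA.isMeasurable_policy (α : MSPSA K n) {X : Set (EuclideanSpace ℝ (Fin n))}
    (hproj : Measurable (proj X)) (ystar : EuclideanSpace ℝ (Fin m)) :
    (α.policy X ystar).IsMeasurable := by
  intro t
  have hl : Measurable fun h : PertSeed K n × (Fin t → EuclideanSpace ℝ (Fin n)) ×
      (Fin t → EuclideanSpace ℝ (Fin m)) × (Fin (t + 1) → Fin K) => h.2.2.2 (Fin.last t) :=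
    (measurable_pi_apply _).comp measurable_snd.snd.snd
  exact α.measurable_output measurable_fst hl (measurable_apply_index (fun i =>
    α.measurable_memory hproj ystar t measurable_fst measurable_snd.snd.fst
      (measurable_init.comp measurable_snd.snd.snd) i) hl)

/-! ### The recursion for the memory -/

/-- The cost seen in the next state and with the noise `z`, when the input is `x`. -/
def seenCost (θ : Params K m n) (ystar : EuclideanSpace ℝ (Fin m)) (x : EuclideanSpace ℝ (Fin n))
    (z : Fin K × EuclideanSpace ℝ (Fin m)) : ℝ :=
  ‖meanOutput θ z.1 x + z.2 - ystar‖ ^ 2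

/-- One stage of MSPSA after state `j`. -/
def MSPSA.step (α : MSPSA K n) (X : Set (EuclideanSpace ℝ (Fin n)))
    (ystar : EuclideanSpace ℝ (Fin m)) (θ : Params K m n) (u : PertSeed K n)
    (M : Fin K → Memory n) (j : Fin K) (z : Fin K × EuclideanSpace ℝ (Fin m)) :
    Fin K → Memory n :=
  Function.update M j (α.update X u j (M j) (seenCost θ ystar (α.output u j (M j)) z))

/-- The memory of MSPSA as a function of the state path, the noise and the seed. -/
def MSPSA.run (α : MSPSA K n) (X : Set (EuclideanSpace ℝ (Fin n)))
    (ystar : EuclideanSpace ℝ (Fin m)) (θ : Params K m n) (s : ℕ → Fin K)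
    (w : ℕ × Fin K → EuclideanSpace ℝ (Fin m)) (u : PertSeed K n) : ℕ → Fin K → Memory n
  | 0 => fun i => ⟨α.init i, 0, false, 0⟩
  | t + 1 => α.step X ystar θ u (α.run X ystar θ s w u t) (s t) (s (t + 1), w (t, s (t + 1)))

variable (α : MSPSA K n) (X : Set (EuclideanSpace ℝ (Fin n)))
    (ystar : EuclideanSpace ℝ (Fin m)) (θ : Params K m n)

/-- Reduces the closed loop to the recursion `MSPSA.run` on the sample space, which no longer
mentions histories. -/
theorem MSPSA.memory_history (ω : Sample (α.policy X ystar)) (t : ℕ) :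
    α.memory X ystar ω.2.2 t ((α.policy X ystar).history θ ω t).2 (fun r : Fin t => ω.1 r) =
      α.run X ystar θ ω.1 ω.2.1 ω.2.2 t := by
  induction t with
  | zero => rfl
  | succ t ih =>
    have hinit : (Fin.init fun r : Fin (t + 1) => ω.1 r) = fun r : Fin t => ω.1 r := rfl
    simp only [MSPSA.memory, Policy.history, Fin.init_snoc, Fin.snoc_last, MSPSA.run, MSPSA.step,
      hinit, ih, seenCost, Fin.val_last]
    congr 4
    simp only [MSPSA.policy, hinit]
    have ih' := ih
    simp only [MSPSA.policy] at ih'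
    rw [ih']
    rfl

theorem MSPSA.input_policy (ω : Sample (α.policy X ystar)) (t : ℕ) :
    (α.policy X ystar).input θ ω t =
      α.output ω.2.2 (ω.1 t) (α.run X ystar θ ω.1 ω.2.1 ω.2.2 t (ω.1 t)) := by
  rw [← MSPSA.memory_history]
  rfl

variable {α X ystar θ}

theorem measurable_seenCost {x : Ω → EuclideanSpace ℝ (Fin n)}
    {z : Ω → Fin K × EuclideanSpace ℝ (Fin m)} (hx : Measurable x) (hz : Measurable z) :
    Measurable fun ω => seenCost θ ystar (x ω) (z ω) :=
  (((measurable_meanOutput θ hz.fst hx).add hz.snd).sub_const ystar).norm.pow_const 2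

theorem MSPSA.measurable_step (hproj : Measurable (proj X)) {u : Ω → PertSeed K n}
    {M : Ω → Fin K → Memory n} {j : Ω → Fin K} {z : Ω → Fin K × EuclideanSpace ℝ (Fin m)}
    (hu : Measurable u) (hM : Measurable M) (hj : Measurable j) (hz : Measurable z) :
    Measurable fun ω => α.step X ystar θ (u ω) (M ω) (j ω) (z ω) := by
  have hMj : Measurable fun ω => M ω (j ω) :=
    measurable_apply_index (fun i => (measurable_pi_apply i).comp hM) hj
  refine measurable_pi_lambda _ fun i => ?_
  simp only [MSPSA.step, Function.update_apply]
  exact Measurable.ite (measurableSet_eq_fun measurable_const hj)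
    (α.measurable_update hproj hu hj hMj
      (measurable_seenCost (α.measurable_output hu hj hMj) hz)) ((measurable_pi_apply i).comp hM)

theorem MSPSA.measurable_run (hproj : Measurable (proj X)) (t : ℕ) :
    Measurable fun ω : (ℕ → Fin K) × (ℕ × Fin K → EuclideanSpace ℝ (Fin m)) × PertSeed K n =>
      α.run X ystar θ ω.1 ω.2.1 ω.2.2 t := by
  induction t with
  | zero => exact measurable_const
  | succ t ih =>
    have hs : ∀ r : ℕ, Measurable fun ω : (ℕ → Fin K) × (ℕ × Fin K → EuclideanSpace ℝ (Fin m)) ×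
        PertSeed K n => ω.1 r := fun r => (measurable_pi_apply r).comp measurable_fst
    exact MSPSA.measurable_step hproj measurable_snd.snd ih (hs t) ((hs (t + 1)).prodMk
      (measurable_apply_index (f := fun (ω : (ℕ → Fin K) × (ℕ × Fin K →
        EuclideanSpace ℝ (Fin m)) × PertSeed K n) j => ω.2.1 (t, j))
        (fun j => (measurable_pi_apply (t, j)).comp measurable_snd.fst) (hs (t + 1))))

/-- Stage r reads the states at r and r + 1 but only the noise with time index r. After t stages the
states up to t and the noise strictly before t have been read, exactly what
`System.lintegral_law_next` requires. -/
theorem MSPSA.run_congr {s s' : ℕ → Fin K} {w w' : ℕ × Fin K → EuclideanSpace ℝ (Fin m)}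
    (u : PertSeed K n) (t : ℕ) (hs : ∀ r ≤ t, s r = s' r) (hw : ∀ r < t, ∀ j, w (r, j) = w' (r, j)) :
    α.run X ystar θ s w u t = α.run X ystar θ s' w' u t := by
  induction t with
  | zero => rfl
  | succ t ih =>
    rw [MSPSA.run, MSPSA.run, ih (fun r hr => hs r (by omega)) fun r hr => hw r (by omega),
      hs t (by omega), hs (t + 1) le_rfl, hw t (by omega)]

theorem MSPSA.update_count (u u' : PertSeed K n) (i : Fin K) {M M' : Memory n}
    (hc : M.count = M'.count) (hf : M.flag = M'.flag) (d d' : ℝ) :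
    (α.update X u i M d).count = (α.update X u' i M' d').count ∧
      (α.update X u i M d).flag = (α.update X u' i M' d').flag := by
  unfold MSPSA.update
  rw [← hf]
  split_ifs <;> simp [hc]

/-- Counters and flags depend only on the state path. -/
theorem MSPSA.run_count (s : ℕ → Fin K) (w w' : ℕ × Fin K → EuclideanSpace ℝ (Fin m))
    (u u' : PertSeed K n) (t : ℕ) (i : Fin K) :
    (α.run X ystar θ s w u t i).count = (α.run X ystar θ s w' u' t i).count ∧
      (α.run X ystar θ s w u t i).flag = (α.run X ystar θ s w' u' t i).flag := by
  induction t generalizing i with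
  | zero => exact ⟨rfl, rfl⟩
  | succ t ih =>
    simp only [MSPSA.run, MSPSA.step, Function.update_apply]
    split_ifs with h
    · exact MSPSA.update_count u u' _ (ih (s t)).1 (ih (s t)).2 _ _
    · exact ih i

theorem MSPSA.count_le_update (u : PertSeed K n) (i : Fin K) (M : Memory n) (d : ℝ) :
    M.count ≤ (α.update X u i M d).count := by
  unfold MSPSA.update
  split_ifs
  · exact le_rfl
  · exact Nat.le_succ _

/-- The memory depends only on the perturbations that have been used. -/
theorem MSPSA.run_congr_seed (s : ℕ → Fin K) (w : ℕ × Fin K → EuclideanSpace ℝ (Fin m))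
    {u u' : PertSeed K n} (t : ℕ)
    (h : ∀ i k l, k ≤ (α.run X ystar θ s w u t i).count → u (i, k, l) = u' (i, k, l)) :
    α.run X ystar θ s w u t = α.run X ystar θ s w u' t := by
  induction t with
  | zero => rfl
  | succ t ih =>
    have hmono : ∀ i, (α.run X ystar θ s w u t i).count ≤
        (α.run X ystar θ s w u (t + 1) i).count := fun i => by
      simp only [MSPSA.run, MSPSA.step, Function.update_apply]
      split_ifs with hi
      · rw [hi]; exact MSPSA.count_le_update _ _ _ _
      · exact le_rfl
    have ih' := ih fun i k l hk => h i k l (hk.trans (hmono i))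
    rw [MSPSA.run, MSPSA.run, ← ih']
    set M := α.run X ystar θ s w u t with hM
    have hvec : ∀ k, k ≤ (α.run X ystar θ s w u (t + 1) (s t)).count →
        pertVec u (s t) k = pertVec u' (s t) k := fun k hk => by
      simp only [pertVec]
      congr 1
      funext l
      exact h _ _ _ hk
    have hcount : (α.run X ystar θ s w u (t + 1) (s t)).count =
        if (M (s t)).flag then (M (s t)).count else (M (s t)).count + 1 := by
      simp only [MSPSA.run, MSPSA.step, Function.update_self, ← hM, MSPSA.update]
      split_ifs <;> rfl
    rw [hcount] at hvec
    simp only [MSPSA.step]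
    congr 1
    by_cases hf : (M (s t)).flag = true
    · simp only [hf, if_true] at hvec
      simp only [MSPSA.update, MSPSA.output, hf, if_true, pertInv_eq, hvec _ le_rfl]
    · rw [if_neg hf] at hvec
      simp only [MSPSA.update, MSPSA.output, if_neg hf, hvec _ le_rfl]

theorem MSPSA.run_invariant (hX : IsCompact X) (hinit : ∀ i, α.init i ∈ X) (s : ℕ → Fin K)
    (w : ℕ × Fin K → EuclideanSpace ℝ (Fin m)) (u : PertSeed K n) (t : ℕ) (i : Fin K) :
    (α.run X ystar θ s w u t i).est ∈ X ∧
      ((α.run X ystar θ s w u t i).flag = true → 1 ≤ (α.run X ystar θ s w u t i).count) := by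
  induction t generalizing i with
  | zero => exact ⟨hinit i, fun h => by simp [MSPSA.run] at h⟩
  | succ t ih =>
    simp only [MSPSA.run, MSPSA.step, Function.update_apply]
    split_ifs with h
    · unfold MSPSA.update
      split_ifs
      · exact ⟨(proj_spec hX ⟨_, hinit i⟩ _).1, fun h => by simp at h⟩
      · exact ⟨(ih (s t)).1, fun _ => by simp⟩
    · exact ih i

end

/-! ### Integrating out the next state and its noise -/

section

variable {K m n : ℕ}

/-- The Markov property of the closed loop: given a past that has read the states up to t and the
noise before t, the pair of next state and noise has the law `System.nextLaw`. -/
theorem System.lintegral_law_next (e : System K m n) (ν : PMF (Fin K)) (μ : Policy K m n) (t : ℕ)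
    {F : (ℕ → Fin K) → (ℕ × Fin K → EuclideanSpace ℝ (Fin m)) → μ.Seed →
      Fin K × EuclideanSpace ℝ (Fin m) → ℝ≥0∞}
    (hF : Measurable fun q : Sample μ × (Fin K × EuclideanSpace ℝ (Fin m)) =>
      F q.1.1 q.1.2.1 q.1.2.2 q.2)
    (hs : ∀ s s', (∀ r ≤ t, s r = s' r) → F s = F s')
    (hw : ∀ s w w', (∀ r < t, ∀ j, w (r, j) = w' (r, j)) → F s w = F s w') :
    ∫⁻ ω, F ω.1 ω.2.1 ω.2.2 (ω.1 (t + 1), ω.2.1 (t, ω.1 (t + 1))) ∂e.law ν μ =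
      ∫⁻ ω, ∫⁻ z, F ω.1 ω.2.1 ω.2.2 z ∂e.nextLaw (ω.1 t) ∂e.law ν μ := by
  set noise := Measure.infinitePi
    (fun q : ℕ × Fin K => (e.f q.2 : Measure (EuclideanSpace ℝ (Fin m)))) with hnoise
  set seed := (μ.seedLaw : Measure μ.Seed) with hseed
  have hnext : Measurable fun ω : Sample μ => (ω.1 (t + 1), ω.2.1 (t, ω.1 (t + 1))) := by
    have h1 : Measurable fun ω : Sample μ => ω.1 (t + 1) :=
      (measurable_pi_apply _).comp measurable_fst
    exact h1.prodMk (measurable_apply_index (f := fun (ω : Sample μ) j => ω.2.1 (t, j))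
      (fun j => (measurable_pi_apply (t, j)).comp measurable_snd.fst) h1)
  have hj : ∀ j, Measurable fun q : Sample μ × EuclideanSpace ℝ (Fin m) =>
      F q.1.1 q.1.2.1 q.1.2.2 (j, q.2) := fun j =>
    hF.comp (measurable_fst.prodMk (measurable_const.prodMk measurable_snd))
  have hjx : ∀ j, Measurable fun ω : Sample μ => ∫⁻ x, F ω.1 ω.2.1 ω.2.2 (j, x)
      ∂(e.f j : Measure (EuclideanSpace ℝ (Fin m))) := fun j =>
    Measurable.lintegral_prod_right' (hj j)
  have hR : ∀ ω : Sample μ, ∫⁻ z, F ω.1 ω.2.1 ω.2.2 z ∂e.nextLaw (ω.1 t) =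
      ∑ j, e.P (ω.1 t) j * ∫⁻ x, F ω.1 ω.2.1 ω.2.2 (j, x)
        ∂(e.f j : Measure (EuclideanSpace ℝ (Fin m))) := fun ω =>
    e.lintegral_nextLaw _ (hF.comp measurable_prodMk_left)
  have hRm : Measurable fun ω : Sample μ => ∑ j, e.P (ω.1 t) j *
      ∫⁻ x, F ω.1 ω.2.1 ω.2.2 (j, x) ∂(e.f j : Measure (EuclideanSpace ℝ (Fin m))) := by
    refine Finset.measurable_fun_sum _ fun j _ => Measurable.mul ?_ (hjx j)
    exact (measurable_of_countable fun i : Fin K => e.P i j).comp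
      ((measurable_pi_apply t).comp measurable_fst)
  simp_rw [hR]
  have hFn : Measurable fun ω : Sample μ =>
      F ω.1 ω.2.1 ω.2.2 (ω.1 (t + 1), ω.2.1 (t, ω.1 (t + 1))) :=
    hF.comp (measurable_id.prodMk hnext)
  rw [System.law, ← hnoise, ← hseed, lintegral_prod _ hFn.aemeasurable,
    lintegral_prod _ hRm.aemeasurable]
  -- The noise goes first, for a fixed path: the past does not read the coordinate (t, s (t + 1)).
  -- Only then is the next state averaged by the one-step property of the chain.
  have h1 : ∀ s : ℕ → Fin K, ∫⁻ p, F s p.1 p.2 (s (t + 1), p.1 (t, s (t + 1)))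
      ∂noise.prod seed = ∫⁻ p, ∫⁻ x, F s p.1 p.2 (s (t + 1), x)
        ∂(e.f (s (t + 1)) : Measure (EuclideanSpace ℝ (Fin m))) ∂noise.prod seed := by
    intro s
    have m1 : Measurable fun p : (ℕ × Fin K → EuclideanSpace ℝ (Fin m)) × μ.Seed =>
        F s p.1 p.2 (s (t + 1), p.1 (t, s (t + 1))) := hFn.comp measurable_prodMk_left
    have m2 : Measurable fun p : (ℕ × Fin K → EuclideanSpace ℝ (Fin m)) × μ.Seed =>
        ∫⁻ x, F s p.1 p.2 (s (t + 1), x)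
          ∂(e.f (s (t + 1)) : Measure (EuclideanSpace ℝ (Fin m))) :=
      (hjx (s (t + 1))).comp measurable_prodMk_left
    rw [lintegral_prod_symm _ m1.aemeasurable, lintegral_prod_symm _ m2.aemeasurable]
    refine lintegral_congr fun u => ?_
    refine lintegral_infinitePi_eval
      (fun q : ℕ × Fin K => (e.f q.2 : Measure (EuclideanSpace ℝ (Fin m)))) (t, s (t + 1))
      (F := fun w x => F s w u (s (t + 1), x)) ?_ fun w w' h => ?_
    · exact (hj (s (t + 1))).comp (((measurable_const.prodMk
        (measurable_fst.prodMk measurable_const))).prodMk measurable_snd)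
    · funext x
      rw [hw s w w' fun r hr j => h _ fun hc => by
        have := (Prod.ext_iff.1 hc).1
        simp only at this
        omega]
  simp_rw [h1]
  rw [System.lintegral_chainLaw_succ e ν t (G := fun s j => ∫⁻ p, ∫⁻ x, F s p.1 p.2 (j, x)
        ∂(e.f j : Measure (EuclideanSpace ℝ (Fin m))) ∂noise.prod seed)
      fun s s' h => by funext j; rw [hs s s' h]]
  refine lintegral_congr fun s => ?_
  have m3 : ∀ j, Measurable fun p : (ℕ × Fin K → EuclideanSpace ℝ (Fin m)) × μ.Seed =>
      ∫⁻ x, F s p.1 p.2 (j, x) ∂(e.f j : Measure (EuclideanSpace ℝ (Fin m))) := fun j =>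
    (hjx j).comp measurable_prodMk_left
  rw [lintegral_finsetSum _ fun j _ => (m3 j).const_mul _]
  exact Finset.sum_congr rfl fun j _ => (lintegral_const_mul _ (m3 j)).symm

end

/-! ### One pair of measurements -/

theorem integral_quadratic {Z : Type*} [MeasurableSpace Z] {ρ : Measure Z} [IsProbabilityMeasure ρ]
    {d : Z → ℝ} (hd : MemLp d 2 ρ) (a b c : ℝ) :
    Integrable (fun z => a + b * d z + c * d z ^ 2) ρ ∧
    ∫ z, a + b * d z + c * d z ^ 2 ∂ρ = a + b * ∫ z, d z ∂ρ + c * ∫ z, d z ^ 2 ∂ρ := by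
  have h0 : Integrable (fun _ : Z => a) ρ := integrable_const a
  have h1 : Integrable (fun z => b * d z) ρ := (hd.integrable (by norm_num)).const_mul b
  have h2 : Integrable (fun z => c * d z ^ 2) ρ := hd.integrable_sq.const_mul c
  have h3 : Integrable (fun z => a + b * d z) ρ := h0.add h1
  refine ⟨h3.add h2, ?_⟩
  rw [integral_add h3 h2, integral_add h0 h1, integral_const_mul, integral_const_mul]
  simp

/-- Second moment of a step along `q` whose length is the difference of two independent nonnegative
measurements. -/
theorem lintegral_difference_step {E Z : Type*} [NormedAddCommGroup E] [InnerProductSpace ℝ E]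
    [MeasurableSpace Z] {ρ : Measure Z} [IsProbabilityMeasure ρ] {d d' : Z → ℝ}
    (hd : MemLp d 2 ρ) (hd' : MemLp d' 2 ρ) (h0 : ∀ z, 0 ≤ d z) (h0' : ∀ z, 0 ≤ d' z) (h q : E) :
    0 ≤ ‖h‖ ^ 2 - 2 * (∫ z, d z ∂ρ - ∫ z, d' z ∂ρ) * inner ℝ h q +
      (∫ z, d z ^ 2 ∂ρ + ∫ z, d' z ^ 2 ∂ρ) * ‖q‖ ^ 2 ∧
    ∫⁻ z, ∫⁻ z', ENNReal.ofReal (‖h - (d z - d' z') • q‖ ^ 2) ∂ρ ∂ρ ≤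
      ENNReal.ofReal (‖h‖ ^ 2 - 2 * (∫ z, d z ∂ρ - ∫ z, d' z ∂ρ) * inner ℝ h q +
        (∫ z, d z ^ 2 ∂ρ + ∫ z, d' z ^ 2 ∂ρ) * ‖q‖ ^ 2) := by
  let f : Z → Z → ℝ := fun z z' => ‖h‖ ^ 2 - 2 * (d z - d' z') * inner ℝ h q +
    (d z ^ 2 + d' z' ^ 2) * ‖q‖ ^ 2
  -- Nonnegativity of the measurements gives (d - d')² ≤ d² + d'², which decouples the two
  -- integrals.
  have hle : ∀ z z', ‖h - (d z - d' z') • q‖ ^ 2 ≤ f z z' := fun z z' => by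
    rw [norm_sub_sq_real, inner_smul_right, norm_smul, mul_pow, Real.norm_eq_abs, sq_abs]
    have := mul_nonneg (h0 z) (h0' z')
    simp only [f]
    nlinarith [sq_nonneg ‖q‖]
  have hf0 : ∀ z z', 0 ≤ f z z' := fun z z' => (sq_nonneg _).trans (hle z z')
  have hfe : ∀ z, f z = fun z' => (‖h‖ ^ 2 - 2 * d z * inner ℝ h q + d z ^ 2 * ‖q‖ ^ 2) +
      2 * inner ℝ h q * d' z' + ‖q‖ ^ 2 * d' z' ^ 2 := fun z => by
    funext z'; simp only [f]; ring
  have hfi : ∀ z, Integrable (f z) ρ := fun z => by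
    rw [hfe]; exact (integral_quadratic hd' _ _ _).1
  let g : Z → ℝ := fun z => (‖h‖ ^ 2 + 2 * inner ℝ h q * ∫ z', d' z' ∂ρ +
    ‖q‖ ^ 2 * ∫ z', d' z' ^ 2 ∂ρ) + -2 * inner ℝ h q * d z + ‖q‖ ^ 2 * d z ^ 2
  have hg : ∀ z, ∫ z', f z z' ∂ρ = g z := fun z => by
    rw [hfe, (integral_quadratic hd' _ _ _).2]
    simp only [g]; ring
  have hg0 : ∀ z, 0 ≤ g z := fun z => by
    rw [← hg]; exact integral_nonneg (hf0 z)
  have hgi : Integrable g ρ := (integral_quadratic hd _ _ _).1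
  have hgint : ∫ z, g z ∂ρ = ‖h‖ ^ 2 - 2 * (∫ z, d z ∂ρ - ∫ z, d' z ∂ρ) * inner ℝ h q +
      (∫ z, d z ^ 2 ∂ρ + ∫ z, d' z ^ 2 ∂ρ) * ‖q‖ ^ 2 := by
    rw [(integral_quadratic hd _ _ _).2]; ring
  rw [← hgint]
  refine ⟨integral_nonneg hg0, ?_⟩
  rw [ofReal_integral_eq_lintegral_ofReal hgi (Filter.Eventually.of_forall hg0)]
  refine lintegral_mono fun z => ?_
  simp only
  rw [← hg, ofReal_integral_eq_lintegral_ofReal (hfi z) (Filter.Eventually.of_forall (hf0 z))]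
  exact lintegral_mono fun z' => ENNReal.ofReal_le_ofReal (hle z z')

/-! ### The observed cost: moments and symmetric differences -/

section

variable {K m n : ℕ}

theorem norm_pow_four_le (w : EuclideanSpace ℝ (Fin m)) : ‖w‖ ^ 4 ≤ m * ∑ l, w l ^ 4 := by
  have h1 : ‖w‖ ^ 4 = (∑ l, w l ^ 2) ^ 2 := by
    rw [← EuclideanSpace.real_norm_sq_eq]; ring
  rw [h1]
  have h2 := sq_sum_le_card_mul_sum_sq (s := Finset.univ) (f := fun l => w l ^ 2)
  refine h2.trans (le_of_eq ?_)
  simp only [Finset.card_univ, Fintype.card_fin]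
  congr 1
  exact Finset.sum_congr rfl fun l _ => by ring

theorem seenCost_sq_le (θ : Params K m n) (ystar : EuclideanSpace ℝ (Fin m))
    (x : EuclideanSpace ℝ (Fin n)) (z : Fin K × EuclideanSpace ℝ (Fin m)) {A : ℝ}
    (hA : ‖meanOutput θ z.1 x - ystar‖ ≤ A) :
    seenCost θ ystar x z ^ 2 ≤ 8 * A ^ 4 + 8 * m * ∑ l, z.2 l ^ 4 := by
  have h1 : ‖meanOutput θ z.1 x + z.2 - ystar‖ ≤ A + ‖z.2‖ := by
    have : meanOutput θ z.1 x + z.2 - ystar = (meanOutput θ z.1 x - ystar) + z.2 := by abel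
    rw [this]
    exact (norm_add_le _ _).trans (add_le_add_left hA _)
  have hA0 : 0 ≤ A := (norm_nonneg _).trans hA
  have h2 := norm_pow_four_le z.2
  have h3 : seenCost θ ystar x z ^ 2 ≤ (A + ‖z.2‖) ^ 4 := by
    rw [seenCost, ← pow_mul]
    exact pow_le_pow_left₀ (norm_nonneg _) h1 4
  have h4 : (A + ‖z.2‖) ^ 4 ≤ 8 * A ^ 4 + 8 * ‖z.2‖ ^ 4 := by
    have := norm_nonneg z.2
    have h5 : (A + ‖z.2‖) ^ 2 ≤ 2 * A ^ 2 + 2 * ‖z.2‖ ^ 2 := by nlinarith [sq_nonneg (A - ‖z.2‖)]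
    calc (A + ‖z.2‖) ^ 4 = ((A + ‖z.2‖) ^ 2) ^ 2 := by ring
      _ ≤ (2 * A ^ 2 + 2 * ‖z.2‖ ^ 2) ^ 2 := by gcongr
      _ ≤ _ := by nlinarith [sq_nonneg (A ^ 2 - ‖z.2‖ ^ 2)]
  nlinarith

variable {Θ : Set (Params K m n)} {X : Set (EuclideanSpace ℝ (Fin n))}
  {ystar : EuclideanSpace ℝ (Fin m)} {σ : ℝ}

theorem measurable_seenCost_right (θ : Params K m n) (x : EuclideanSpace ℝ (Fin n)) :
    Measurable (seenCost θ ystar x) :=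
  measurable_seenCost measurable_const measurable_id

theorem seenCost_nonneg (θ : Params K m n) (x : EuclideanSpace ℝ (Fin n))
    (z : Fin K × EuclideanSpace ℝ (Fin m)) : 0 ≤ seenCost θ ystar x z := sq_nonneg _

/-- The observed cost is a squared norm, so its second moment needs the fourth moments of the noise.
The bound does not depend on the transition matrix. -/
theorem System.Admissible.lintegral_seenCost_sq_le {e : System K m n}
    (he : e.Admissible Θ X ystar σ) (i : Fin K) {x : EuclideanSpace ℝ (Fin n)} {A : ℝ}
    (hA : ∀ j, ‖meanOutput e.θ j x - ystar‖ ≤ A) :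
    ∫⁻ z, ENNReal.ofReal (seenCost e.θ ystar x z ^ 2) ∂e.nextLaw i ≤
      ENNReal.ofReal (8 * A ^ 4 + 8 * m ^ 2 * σ ^ 4) := by
  have h4 : ∀ j, ∫⁻ w, ∑ l, ENNReal.ofReal (w l ^ 4)
      ∂(e.f j : Measure (EuclideanSpace ℝ (Fin m))) ≤ ENNReal.ofReal (m * σ ^ 4) := fun j => by
    rw [lintegral_finsetSum _ fun l _ => by fun_prop]
    refine (Finset.sum_le_sum fun l _ => he.noise_fourth j l).trans ?_
    rw [ENNReal.ofReal_mul (by positivity)]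
    simp
  have hm4 : Measurable fun z : Fin K × EuclideanSpace ℝ (Fin m) =>
      ∑ l, ENNReal.ofReal (z.2 l ^ 4) := by fun_prop
  calc _ ≤ ∫⁻ z, (ENNReal.ofReal (8 * A ^ 4) + ENNReal.ofReal (8 * m) *
        ∑ l, ENNReal.ofReal (z.2 l ^ 4)) ∂e.nextLaw i := by
        refine lintegral_mono fun z => ?_
        rw [← ENNReal.ofReal_sum_of_nonneg fun l _ => by positivity,
          ← ENNReal.ofReal_mul (by positivity), ← ENNReal.ofReal_add
          (mul_nonneg (by norm_num) (Even.pow_nonneg (by decide) A))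
          (mul_nonneg (by positivity) (Finset.sum_nonneg fun l _ => by positivity))]
        exact ENNReal.ofReal_le_ofReal (seenCost_sq_le e.θ ystar x z (hA z.1))
    _ = ENNReal.ofReal (8 * A ^ 4) + ENNReal.ofReal (8 * m) *
          ∫⁻ z, ∑ l, ENNReal.ofReal (z.2 l ^ 4) ∂e.nextLaw i := by
        rw [lintegral_add_left measurable_const, lintegral_const_mul _ hm4]
        simp
    _ ≤ ENNReal.ofReal (8 * A ^ 4) + ENNReal.ofReal (8 * m) * ENNReal.ofReal (m * σ ^ 4) := by
        gcongr
        rw [e.lintegral_nextLaw i hm4]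
        calc _ ≤ ∑ j, e.P i j * ENNReal.ofReal (m * σ ^ 4) := by
              gcongr with j; exact h4 j
          _ = _ := by
              rw [← Finset.sum_mul, ← tsum_fintype (L := .unconditional _), (e.P i).tsum_coe,
                one_mul]
    _ = _ := by
        rw [← ENNReal.ofReal_mul (by positivity), ← ENNReal.ofReal_add
          (mul_nonneg (by norm_num) (Even.pow_nonneg (by decide) A)) (by positivity)]
        congr 1
        ring

theorem System.Admissible.memLp_seenCost {e : System K m n}
    (he : e.Admissible Θ X ystar σ) (i : Fin K) (x : EuclideanSpace ℝ (Fin n)) :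
    MemLp (seenCost e.θ ystar x) 2 (e.nextLaw i) := by
  rw [memLp_two_iff_integrable_sq (measurable_seenCost_right _ _).aestronglyMeasurable]
  refine ⟨((measurable_seenCost_right _ _).pow_const 2).aestronglyMeasurable, ?_⟩
  rw [hasFiniteIntegral_iff_ofReal (Filter.Eventually.of_forall fun w => sq_nonneg _)]
  exact (he.lintegral_seenCost_sq_le i (A := ∑ j, ‖meanOutput e.θ j x - ystar‖) fun j =>
    Finset.single_le_sum (f := fun j => ‖meanOutput e.θ j x - ystar‖)
      (fun j _ => norm_nonneg _) (Finset.mem_univ j)).trans_lt ENNReal.ofReal_lt_top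

theorem System.Admissible.integral_seenCost_sq_le {e : System K m n}
    (he : e.Admissible Θ X ystar σ) (i : Fin K) {x : EuclideanSpace ℝ (Fin n)} {A : ℝ}
    (hA : ∀ j, ‖meanOutput e.θ j x - ystar‖ ≤ A) :
    ∫ z, seenCost e.θ ystar x z ^ 2 ∂e.nextLaw i ≤ 8 * A ^ 4 + 8 * m ^ 2 * σ ^ 4 := by
  have hA4 : 0 ≤ A ^ 4 := Even.pow_nonneg (by decide) A
  rw [← ENNReal.ofReal_le_ofReal_iff (by positivity), ofReal_integral_eq_lintegral_ofReal
    (he.memLp_seenCost i x).integrable_sq (Filter.Eventually.of_forall fun z => sq_nonneg _)]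
  exact he.lintegral_seenCost_sq_le i hA

theorem System.Admissible.integral_seenCost {e : System K m n}
    (he : e.Admissible Θ X ystar σ) (i : Fin K) (x : EuclideanSpace ℝ (Fin n)) :
    ∫ z, seenCost e.θ ystar x z ∂e.nextLaw i = e.stageCost ystar i x := by
  have hi := (he.memLp_seenCost i x).integrable (by norm_num)
  have hm : Measurable fun z : Fin K × EuclideanSpace ℝ (Fin m) =>
    ENNReal.ofReal (seenCost e.θ ystar x z) := (measurable_seenCost_right _ _).ennreal_ofReal
  have h1 := ofReal_integral_eq_lintegral_ofReal hi
    (Filter.Eventually.of_forall fun z => seenCost_nonneg _ _ z)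
  have hfin : ∑ j, e.P i j * ∫⁻ w, ENNReal.ofReal (seenCost e.θ ystar x (j, w))
      ∂(e.f j : Measure (EuclideanSpace ℝ (Fin m))) ≠ ∞ := by
    rw [← e.lintegral_nextLaw i hm, ← h1]
    exact ENNReal.ofReal_ne_top
  rw [integral_eq_lintegral_of_nonneg_ae (Filter.Eventually.of_forall fun z => seenCost_nonneg _ _ z)
    (measurable_seenCost_right _ _).aestronglyMeasurable, e.lintegral_nextLaw i hm,
    ENNReal.toReal_sum fun j _ => (ENNReal.sum_ne_top.1 hfin) j (Finset.mem_univ j)]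
  refine Finset.sum_congr rfl fun j _ => ?_
  rw [ENNReal.toReal_mul, ← integral_eq_lintegral_of_nonneg_ae
    (Filter.Eventually.of_forall fun z => seenCost_nonneg _ _ _)
    ((measurable_seenCost_right _ _).comp measurable_prodMk_left).aestronglyMeasurable]
  simp only [System.p, seenCost]
  congr 1
  refine integral_congr_ae (Filter.Eventually.of_forall fun w => ?_)
  simp only
  rw [norm_sub_rev]

/-- The difference quotient of the quadratic cost is exact. -/
theorem System.Centered.stageCost_sub {e : System K m n} (he : e.Centered σ) (i : Fin K)
    (x d : EuclideanSpace ℝ (Fin n)) (c : ℝ) :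
    e.stageCost ystar i (x + c • d) - e.stageCost ystar i (x - c • d) =
      4 * c * inner ℝ d (Matrix.toEuclideanLin (e.gram i) (x - e.optInput ystar i)) := by
  rw [he.stageCost_eq ystar i (x + c • d), he.stageCost_eq ystar i (x - c • d),
    add_sub_add_left_eq_sub, System.inner_gram, ← Finset.sum_sub_distrib, Finset.mul_sum]
  refine Finset.sum_congr rfl fun j _ => ?_
  have e1 : x + c • d - e.optInput ystar i = (x - e.optInput ystar i) + c • d := by abel
  have e2 : x - c • d - e.optInput ystar i = (x - e.optInput ystar i) - c • d := by abel
  rw [e1, e2, map_add, map_sub (Matrix.toEuclideanLin (e.θ j).1) (x - e.optInput ystar i), map_smul,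
    norm_add_sq_real, norm_sub_sq_real,
    inner_smul_right, real_inner_comm]
  ring

end

/-! ### Perturbations -/

section

variable {K n : ℕ} {X : Set (EuclideanSpace ℝ (Fin n))}

/-- Since the inverse of zero counts as ∞ in the hypothesis, finiteness excludes an atom at 0; the
real inverse, with value 0 at 0, then agrees with it almost everywhere. -/
theorem MSPSA.memLp_inv {α : MSPSA K n} {ξ : ℝ}
    (hξ : ∫⁻ x, (ENNReal.ofReal (x ^ 2))⁻¹ ∂(α.pert : Measure ℝ) ≤ ENNReal.ofReal ξ) :
    (∀ᵐ x ∂(α.pert : Measure ℝ), x ≠ 0) ∧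
    MemLp (fun x : ℝ => x⁻¹) 2 (α.pert : Measure ℝ) ∧
    ∫⁻ x, ENNReal.ofReal (x⁻¹ ^ 2) ∂(α.pert : Measure ℝ) ≤ ENNReal.ofReal ξ := by
  have h0 : ∀ᵐ x ∂(α.pert : Measure ℝ), x ≠ 0 := by
    have := ae_lt_top' (μ := (α.pert : Measure ℝ))
      (f := fun x : ℝ => (ENNReal.ofReal (x ^ 2))⁻¹) (by fun_prop)
      (hξ.trans_lt ENNReal.ofReal_lt_top).ne
    filter_upwards [this] with x hx h
    simp [h] at hx
  have h1 : ∫⁻ x, ENNReal.ofReal (x⁻¹ ^ 2) ∂(α.pert : Measure ℝ) ≤ ENNReal.ofReal ξ := by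
    refine le_trans (le_of_eq ?_) hξ
    refine lintegral_congr_ae ?_
    filter_upwards [h0] with x hx
    rw [inv_pow, ENNReal.ofReal_inv_of_pos (by positivity)]
  refine ⟨h0, ?_, h1⟩
  rw [memLp_two_iff_integrable_sq (by fun_prop)]
  refine ⟨by fun_prop, ?_⟩
  rw [hasFiniteIntegral_iff_ofReal (Filter.Eventually.of_forall fun w => sq_nonneg _)]
  exact h1.trans_lt ENNReal.ofReal_lt_top

theorem MSPSA.Valid.integral_id {α : MSPSA K n} (hα : α.Valid X) :
    ∫ x, x ∂(α.pert : Measure ℝ) = 0 := by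
  have h : ∫ x, x ∂(α.pert : Measure ℝ) = -∫ x, x ∂(α.pert : Measure ℝ) := by
    conv_lhs => rw [← hα.pert_symm]
    rw [integral_map (by fun_prop) (by fun_prop), integral_neg]
  linarith

/-- The law of the seed of MSPSA. -/
abbrev MSPSA.seedMeasure (α : MSPSA K n) : Measure (PertSeed K n) :=
  Measure.infinitePi fun _ => (α.pert : Measure ℝ)

/-- Coordinatewise, E(Δ Δ̄ᵀ) is the identity: the diagonal products are almost surely 1, and off the
diagonal independence and the zero mean of the perturbation apply. -/
theorem MSPSA.Valid.integral_mul_inv {α : MSPSA K n} (hα : α.Valid X) (i : Fin K) (k : ℕ)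
    (l l' : Fin n) :
    Integrable (fun v : PertSeed K n => v (i, k, l) * (v (i, k, l'))⁻¹) α.seedMeasure ∧
    ∫ v, v (i, k, l) * (v (i, k, l'))⁻¹ ∂α.seedMeasure = if l = l' then 1 else 0 := by
  obtain ⟨ξ, hξ⟩ := hα.pert_inv
  obtain ⟨b, hb⟩ := hα.pert_bdd
  obtain ⟨h0, h2, -⟩ := MSPSA.memLp_inv hξ
  have hid : Integrable (fun x : ℝ => x) (α.pert : Measure ℝ) :=
    Integrable.of_bound (by fun_prop) b hb
  have hinv := h2.integrable (by norm_num)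
  by_cases hl : l = l'
  · subst hl
    have h1 : (fun v : PertSeed K n => v (i, k, l) * (v (i, k, l))⁻¹) =ᵐ[α.seedMeasure] 1 := by
      have := (measurePreserving_eval_infinitePi (fun _ : Fin K × ℕ × Fin n =>
        (α.pert : Measure ℝ)) (i, k, l)).quasiMeasurePreserving.ae h0
      filter_upwards [this] with v hv
      simp only [Pi.one_apply]
      exact mul_inv_cancel₀ hv
    refine ⟨(integrable_const (1 : ℝ)).congr h1.symm, ?_⟩
    rw [integral_congr_ae h1]
    simp
  · have hne : (i, k, l) ≠ (i, k, l') := fun h => hl (by simpa using h)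
    have hmap := Measure.infinitePi_map_eval_prod
      (P := fun _ : Fin K × ℕ × Fin n => (α.pert : Measure ℝ)) hne
    have hi := hid.mul_prod hinv
    rw [← hmap] at hi
    have hm : Measurable fun v : PertSeed K n => (v (i, k, l), v (i, k, l')) := by fun_prop
    refine ⟨hi.comp_measurable hm, ?_⟩
    rw [if_neg hl, ← integral_map (φ := fun v : PertSeed K n => (v (i, k, l), v (i, k, l')))
      (f := fun p => p.1 * p.2⁻¹) hm.aemeasurable hi.aestronglyMeasurable, hmap,
      integral_prod_mul (fun x : ℝ => x) fun x : ℝ => x⁻¹, hα.integral_id, zero_mul]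

/-- Unbiasedness of the gradient estimate: the derivative along Δ, multiplied by Δ̄, averages to the
gradient. -/
theorem MSPSA.Valid.integral_inner_mul_inner {α : MSPSA K n} (hα : α.Valid X) (i : Fin K) (k : ℕ)
    (g h : EuclideanSpace ℝ (Fin n)) :
    Integrable (fun v => inner ℝ (pertVec v i k) g * inner ℝ h (invVec (pertVec v i k)))
      α.seedMeasure ∧
    ∫ v, inner ℝ (pertVec v i k) g * inner ℝ h (invVec (pertVec v i k)) ∂α.seedMeasure =
      inner ℝ h g := by
  have h1 : ∀ v : PertSeed K n, inner ℝ (pertVec v i k) g * inner ℝ h (invVec (pertVec v i k)) =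
      ∑ l, ∑ l', g l * h l' * (v (i, k, l) * (v (i, k, l'))⁻¹) := fun v => by
    simp only [PiLp.inner_apply, pertVec, invVec, Finset.sum_mul_sum]
    refine Finset.sum_congr rfl fun l _ => Finset.sum_congr rfl fun l' _ => ?_
    simp
    ring
  have h2 := fun l l' => hα.integral_mul_inv i k l l'
  simp_rw [h1]
  refine ⟨integrable_finsetSum _ fun l _ => integrable_finsetSum _ fun l' _ =>
    (h2 l l').1.const_mul _, ?_⟩
  rw [integral_finsetSum _ fun l _ => integrable_finsetSum _ fun l' _ => (h2 l l').1.const_mul _]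
  rw [PiLp.inner_apply]
  refine Finset.sum_congr rfl fun l _ => ?_
  rw [integral_finsetSum _ fun l' _ => (h2 l l').1.const_mul _]
  simp_rw [integral_const_mul, (h2 l _).2]
  simp

theorem MSPSA.integral_norm_invVec_sq {α : MSPSA K n} {ξ : ℝ} (hξ0 : 0 ≤ ξ)
    (hξ : ∫⁻ x, (ENNReal.ofReal (x ^ 2))⁻¹ ∂(α.pert : Measure ℝ) ≤ ENNReal.ofReal ξ)
    (i : Fin K) (k : ℕ) :
    Integrable (fun v => ‖invVec (pertVec v i k)‖ ^ 2) α.seedMeasure ∧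
    ∫ v, ‖invVec (pertVec v i k)‖ ^ 2 ∂α.seedMeasure ≤ n * ξ := by
  obtain ⟨-, h2, h3⟩ := MSPSA.memLp_inv hξ
  have hx : Integrable (fun x : ℝ => x⁻¹ ^ 2) (α.pert : Measure ℝ) := h2.integrable_sq
  have hle : ∫ x, x⁻¹ ^ 2 ∂(α.pert : Measure ℝ) ≤ ξ := by
    rw [← ENNReal.ofReal_le_ofReal_iff hξ0, ofReal_integral_eq_lintegral_ofReal hx
      (Filter.Eventually.of_forall fun x => sq_nonneg _)]
    exact h3
  have hmp := fun l : Fin n => measurePreserving_eval_infinitePi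
    (fun _ : Fin K × ℕ × Fin n => (α.pert : Measure ℝ)) (i, k, l)
  have hc : ∀ l : Fin n, Integrable (fun v : PertSeed K n => (v (i, k, l))⁻¹ ^ 2) α.seedMeasure :=
    fun l => (hmp l).integrable_comp_of_integrable hx
  have hcl : ∀ l : Fin n, ∫ v, (v (i, k, l))⁻¹ ^ 2 ∂α.seedMeasure ≤ ξ := fun l => by
    have := integral_map (μ := α.seedMeasure) (φ := fun v : PertSeed K n => v (i, k, l))
      (f := fun x : ℝ => x⁻¹ ^ 2) (measurable_pi_apply (i, k, l)).aemeasurable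
      (measurable_inv.pow_const 2).aestronglyMeasurable
    rw [← this, show α.seedMeasure.map (fun v : PertSeed K n => v (i, k, l)) = α.pert from
      (hmp l).map_eq]
    exact hle
  simp_rw [EuclideanSpace.real_norm_sq_eq, invVec, pertVec]
  refine ⟨integrable_finsetSum _ fun l _ => hc l, ?_⟩
  rw [integral_finsetSum _ fun l _ => hc l]
  calc _ ≤ ∑ _l : Fin n, ξ := Finset.sum_le_sum fun l _ => hcl l
    _ = _ := by simp

theorem ae_norm_pertVec_le {α : MSPSA K n} {b : ℝ}
    (hb : ∀ᵐ x ∂(α.pert : Measure ℝ), |x| ≤ b) (i : Fin K) (k : ℕ) :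
    ∀ᵐ v ∂α.seedMeasure, ‖pertVec v i k‖ ^ 2 ≤ n * b ^ 2 := by
  have h : ∀ᵐ v ∂α.seedMeasure, ∀ l : Fin n, |v (i, k, l)| ≤ b := by
    refine ae_all_iff.2 fun l => ?_
    exact (measurePreserving_eval_infinitePi (fun _ : Fin K × ℕ × Fin n =>
      (α.pert : Measure ℝ)) (i, k, l)).quasiMeasurePreserving.ae hb
  filter_upwards [h] with v hv
  rw [EuclideanSpace.real_norm_sq_eq]
  calc _ ≤ ∑ _l : Fin n, b ^ 2 := Finset.sum_le_sum fun l _ => by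
        rw [← sq_abs]
        exact pow_le_pow_left₀ (abs_nonneg _) (hv l) 2
    _ = _ := by simp

end

/-! ### A recursion for worst-case sums of squared errors -/

/-- Slope of the bound on the costs of `R` pairs of stages that start with the `k`-th pair. -/
def slope (ρ : ℕ → ℝ) : ℕ → ℕ → ℝ
  | 0, _ => 0
  | R + 1, k => 2 + ρ k * slope ρ R (k + 1)

/-- Intercept of the bound on the costs of `R` pairs of stages that start with the `k`-th pair. -/
def intercept (ρ β δ : ℕ → ℝ) : ℕ → ℕ → ℝ
  | 0, _ => 0
  | R + 1, k => β k + δ k * slope ρ R (k + 1) + intercept ρ β δ R (k + 1)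

section

variable {ρ β δ : ℕ → ℝ}

theorem slope_nonneg (hρ : ∀ k, 1 ≤ k → 0 ≤ ρ k) (R k : ℕ) (hk : 1 ≤ k) : 0 ≤ slope ρ R k := by
  induction R generalizing k with
  | zero => exact le_rfl
  | succ R ih =>
    have := mul_nonneg (hρ k hk) (ih (k + 1) (by omega))
    simp only [slope]
    linarith

theorem intercept_nonneg (hρ : ∀ k, 1 ≤ k → 0 ≤ ρ k) (hβ : ∀ k, 0 ≤ β k) (hδ : ∀ k, 0 ≤ δ k)
    (R k : ℕ) (hk : 1 ≤ k) : 0 ≤ intercept ρ β δ R k := by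
  induction R generalizing k with
  | zero => exact le_rfl
  | succ R ih =>
    have := mul_nonneg (hδ k) (slope_nonneg hρ R (k + 1) (by omega))
    have h1 := ih (k + 1) (by omega)
    have h2 := hβ k
    simp only [intercept]
    linarith

theorem slope_le_succ (hρ : ∀ k, 1 ≤ k → 0 ≤ ρ k) (R k : ℕ) (hk : 1 ≤ k) :
    slope ρ R k ≤ slope ρ (R + 1) k := by
  induction R generalizing k with
  | zero => exact slope_nonneg hρ _ _ hk
  | succ R ih =>
    have := mul_le_mul_of_nonneg_left (ih (k + 1) (by omega)) (hρ k hk)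
    rw [slope, slope]
    linarith

theorem intercept_le_succ (hρ : ∀ k, 1 ≤ k → 0 ≤ ρ k) (hβ : ∀ k, 0 ≤ β k) (hδ : ∀ k, 0 ≤ δ k)
    (R k : ℕ) (hk : 1 ≤ k) : intercept ρ β δ R k ≤ intercept ρ β δ (R + 1) k := by
  induction R generalizing k with
  | zero => exact intercept_nonneg hρ hβ hδ _ _ hk
  | succ R ih =>
    have := mul_le_mul_of_nonneg_left (slope_le_succ hρ R (k + 1) (by omega)) (hδ k)
    have h1 := ih (k + 1) (by omega)
    rw [intercept, intercept]
    linarith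

/-- Any r with ρ_k r_k + δ_k ≤ r_(k+1) stays above the error recursion; unrolling then charges 2 r +
β to each pair. -/
theorem slope_mul_add_intercept_le {r : ℕ → ℝ} (hρ : ∀ k, 1 ≤ k → 0 ≤ ρ k)
    (hr : ∀ k, 1 ≤ k → ρ k * r k + δ k ≤ r (k + 1)) (R k : ℕ) (hk : 1 ≤ k) {x : ℝ} (hx : x ≤ r k) :
    slope ρ R k * x + intercept ρ β δ R k ≤
      ∑ l ∈ Finset.range R, (2 * r (k + l) + β (k + l)) := by
  induction R generalizing k x with
  | zero => simp [slope, intercept]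
  | succ R ih =>
    have h1 : ρ k * x + δ k ≤ r (k + 1) :=
      (add_le_add_left (mul_le_mul_of_nonneg_left hx (hρ k hk)) _).trans (hr k hk)
    have h2 := ih (k + 1) (by omega) h1
    rw [Finset.sum_range_succ']
    have h3 : ∑ l ∈ Finset.range R, (2 * r (k + 1 + l) + β (k + 1 + l)) =
        ∑ l ∈ Finset.range R, (2 * r (k + (l + 1)) + β (k + (l + 1))) :=
      Finset.sum_congr rfl fun l _ => by rw [show k + 1 + l = k + (l + 1) by ring]
    rw [← h3]
    simp only [slope, intercept, add_zero]
    linarith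

theorem sum_inv_sqrt_le (R : ℕ) : ∑ l ∈ Finset.range R, 1 / √(1 + l : ℝ) ≤ 2 * √R := by
  induction R with
  | zero => simp
  | succ R ih =>
    rw [Finset.sum_range_succ]
    refine (add_le_add_left ih _).trans ?_
    have h0 : (0 : ℝ) ≤ R := Nat.cast_nonneg R
    have h1 : 0 < √(1 + R : ℝ) := Real.sqrt_pos.2 (by linarith)
    have h2 := Real.sq_sqrt (show (0 : ℝ) ≤ 1 + R by linarith)
    have h3 := Real.sq_sqrt h0
    have h4 := Real.sqrt_nonneg (R : ℝ)
    push_cast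
    rw [add_comm (R : ℝ) 1, ← le_sub_iff_add_le', div_le_iff₀ h1]
    nlinarith [sq_nonneg (√(1 + R : ℝ) - √R)]

/-- The contraction gains Q/κ^(3/2), of which the added error takes at most half since 2D ≤ Q. The
remaining factor 1 - 1/(2κ) still suffices to pass from κ^(-1/2) to (κ + 1)^(-1/2). -/
theorem rate_step {κ Q D : ℝ} (hκ : 1 ≤ κ) (hD : 2 * D ≤ Q) (hQ : 0 ≤ Q) :
    (1 - 1 / κ) * (Q / √κ) + D / (κ * √κ) ≤ Q / √(κ + 1) := by
  have h0 : 0 < κ := by linarith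
  have hs : 0 < √κ := Real.sqrt_pos.2 h0
  have hs' : 0 < √(κ + 1) := Real.sqrt_pos.2 (by linarith)
  have h1 : (1 - 1 / κ) * (Q / √κ) + D / (κ * √κ) ≤ Q * ((1 - 1 / (2 * κ)) / √κ) := by
    have : Q * ((1 - 1 / (2 * κ)) / √κ) - ((1 - 1 / κ) * (Q / √κ) + D / (κ * √κ)) =
        (Q - 2 * D) / (2 * κ * √κ) := by field_simp; ring
    have h2 : 0 ≤ (Q - 2 * D) / (2 * κ * √κ) := div_nonneg (by linarith) (by positivity)
    linarith
  refine h1.trans ?_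
  rw [div_eq_mul_one_div Q]
  refine mul_le_mul_of_nonneg_left ?_ hQ
  rw [div_le_div_iff₀ hs hs', one_mul]
  refine Real.le_sqrt_of_sq_le ?_
  rw [mul_pow, Real.sq_sqrt (by linarith)]
  have : κ - (1 - 1 / (2 * κ)) ^ 2 * (κ + 1) = (3 * κ - 1) / (4 * κ ^ 2) := by field_simp; ring
  have h2 : 0 ≤ (3 * κ - 1) / (4 * κ ^ 2) := div_nonneg (by linarith) (by positivity)
  linarith

end

/-! ### The gains of MSPSA -/

section

variable {K n : ℕ} {X : Set (EuclideanSpace ℝ (Fin n))} {α : MSPSA K n}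

theorem MSPSA.Valid.gain_pos (hα : α.Valid X) (i : Fin K) {k : ℕ} (hk : 1 ≤ k) :
    0 < α.gain i k := by
  have : (1 : ℝ) ≤ k := by exact_mod_cast hk
  exact div_pos (hα.γ'_pos i) (Real.rpow_pos_of_pos (by positivity) _)

theorem MSPSA.Valid.stepSize_nonneg (hα : α.Valid X) (i : Fin K) (k : ℕ) : 0 ≤ α.stepSize i k :=
  div_nonneg (hα.γ_pos i).le (by positivity)

theorem MSPSA.gain_sq (α : MSPSA K n) (i : Fin K) (k : ℕ) :
    α.gain i k ^ 2 = α.γ' i ^ 2 / √(α.N' i + k) := by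
  have h : ((α.N' i + k : ℝ) ^ (1 / 4 : ℝ)) ^ 2 = √(α.N' i + k) := by
    rw [← Real.rpow_natCast, ← Real.rpow_mul (by positivity), Real.sqrt_eq_rpow]
    norm_num
  rw [MSPSA.gain, div_pow, h]

theorem MSPSA.gain_sq_le (α : MSPSA K n) (i : Fin K) {k : ℕ} (hk : 1 ≤ k) :
    α.gain i k ^ 2 ≤ α.γ' i ^ 2 * (1 / √k) := by
  have : (1 : ℝ) ≤ k := by exact_mod_cast hk
  rw [α.gain_sq, div_eq_mul_one_div]
  gcongr
  linarith [Nat.cast_nonneg (α := ℝ) (α.N' i)]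

theorem MSPSA.gain_sq_le' (α : MSPSA K n) (i : Fin K) {k : ℕ} (hk : 1 ≤ k) :
    α.gain i k ^ 2 ≤ α.γ' i ^ 2 := by
  have : (1 : ℝ) ≤ k := by exact_mod_cast hk
  refine (α.gain_sq_le i hk).trans ?_
  refine mul_le_of_le_one_right (sq_nonneg _) ?_
  rw [div_le_one (by positivity)]
  exact Real.one_le_sqrt.2 this

/-- a_k²/c_k² is of order k^(-3/2). The offsets of the two gains are reconciled by N' + k ≤ (N' +
1)(N + k). -/
theorem MSPSA.Valid.stepSize_div_gain_sq_le (hα : α.Valid X) (i : Fin K) {k : ℕ} (hk : 1 ≤ k) :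
    (α.stepSize i k / α.gain i k) ^ 2 ≤ (α.γ i / α.γ' i) ^ 2 * √(α.N' i + 1) *
      (1 / ((α.N i + k) * √(α.N i + k))) := by
  have hk1 : (1 : ℝ) ≤ k := by exact_mod_cast hk
  have hN : (0 : ℝ) ≤ α.N i := Nat.cast_nonneg _
  have hN' : (0 : ℝ) ≤ α.N' i := Nat.cast_nonneg _
  have hg := hα.γ'_pos i
  have h1 : √(α.N' i + k) ≤ √(α.N' i + 1) * √(α.N i + k) := by
    rw [← Real.sqrt_mul (by positivity)]
    exact Real.sqrt_le_sqrt (by nlinarith)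
  have hs : 0 < √(α.N i + k : ℝ) := Real.sqrt_pos.2 (by linarith)
  have hs2 := Real.sq_sqrt (show (0 : ℝ) ≤ α.N i + k by linarith)
  have hs' : 0 < √(α.N' i + k : ℝ) := Real.sqrt_pos.2 (by linarith)
  rw [div_pow, α.gain_sq, MSPSA.stepSize]
  have e1 : (α.γ i / (α.N i + k)) ^ 2 / (α.γ' i ^ 2 / √(α.N' i + k)) =
      (α.γ i / α.γ' i) ^ 2 * (√(α.N' i + k) / (α.N i + k) ^ 2) := by
    have : (α.N i + k : ℝ) ≠ 0 := by positivity
    field_simp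
  have e2 : (1 : ℝ) / ((α.N i + k) * √(α.N i + k)) = √(α.N i + k) / (α.N i + k) ^ 2 := by
    have : (α.N i + k : ℝ) ≠ 0 := by positivity
    rw [div_eq_div_iff (by positivity) (by positivity)]
    nlinarith
  calc _ = (α.γ i / α.γ' i) ^ 2 * (√(α.N' i + k) / (α.N i + k) ^ 2) := e1
    _ ≤ (α.γ i / α.γ' i) ^ 2 * (√(α.N' i + 1) * √(α.N i + k) / (α.N i + k) ^ 2) := by gcongr
    _ = _ := by rw [e2]; ring

end

/-! ### One iteration of MSPSA -/

section

variable {K m n : ℕ} {Θ : Set (Params K m n)} {X : Set (EuclideanSpace ℝ (Fin n))}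
  {ystar : EuclideanSpace ℝ (Fin m)} {σ : ℝ} {α : MSPSA K n} {e : System K m n}

theorem lintegral_lintegral_affine {Z : Type*} [MeasurableSpace Z] {ρ : Measure Z}
    [IsProbabilityMeasure ρ] {g : Z → Z → ℝ}
    (hg : Measurable fun p : Z × Z => ENNReal.ofReal (g p.1 p.2)) (hg0 : ∀ z z', 0 ≤ g z z')
    {S I : ℝ} (hS : 0 ≤ S) (hI : 0 ≤ I) (c : ℝ≥0∞) :
    ∫⁻ z, (c + ∫⁻ z', ENNReal.ofReal (S * g z z' + I) ∂ρ) ∂ρ =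
      c + (ENNReal.ofReal S * ∫⁻ z, ∫⁻ z', ENNReal.ofReal (g z z') ∂ρ ∂ρ + ENNReal.ofReal I) := by
  have h1 : ∀ z, ∫⁻ z', ENNReal.ofReal (S * g z z' + I) ∂ρ =
      ENNReal.ofReal S * ∫⁻ z', ENNReal.ofReal (g z z') ∂ρ + ENNReal.ofReal I := fun z => by
    have hz : Measurable fun z' => ENNReal.ofReal (g z z') := hg.comp measurable_prodMk_left
    have : ∀ z', ENNReal.ofReal (S * g z z' + I) =
        ENNReal.ofReal S * ENNReal.ofReal (g z z') + ENNReal.ofReal I := fun z' => by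
      rw [ENNReal.ofReal_add (mul_nonneg hS (hg0 z z')) hI, ENNReal.ofReal_mul hS]
    simp_rw [this]
    rw [lintegral_add_right _ measurable_const, lintegral_const_mul _ hz]
    simp
  simp_rw [h1]
  rw [lintegral_add_left measurable_const, lintegral_add_right _ measurable_const,
    lintegral_const_mul _ hg.lintegral_prod_right']
  simp

theorem norm_add_sq_add_norm_sub_sq_le {h d : EuclideanSpace ℝ (Fin n)} {c B : ℝ}
    (hd : ‖d‖ ^ 2 ≤ B) : ‖h + c • d‖ ^ 2 + ‖h - c • d‖ ^ 2 ≤ 2 * ‖h‖ ^ 2 + 2 * c ^ 2 * B := by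
  have h1 := parallelogram_law_with_norm ℝ h (c • d)
  have h2 : ‖c • d‖ ^ 2 = c ^ 2 * ‖d‖ ^ 2 := by
    rw [norm_smul, mul_pow, Real.norm_eq_abs, sq_abs]
  nlinarith [mul_le_mul_of_nonneg_left hd (sq_nonneg c)]

/-- A pair for a fixed perturbation d, with an affine function of the next squared error as
continuation. The two input errors combine by the parallelogram law, and the cross term of the
update is linear in the exact cost difference `System.Centered.stageCost_sub`, so c cancels from it.
-/
theorem System.Admissible.lintegral_pair_le (he : e.Admissible Θ X ystar σ) (i : Fin K)
    {x d q : EuclideanSpace ℝ (Fin n)} {a c A B S I : ℝ} (hc : 0 < c) (hS : 0 ≤ S)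
    (hI : 0 ≤ I) (hd : ‖d‖ ^ 2 ≤ B)
    (hA : ∀ j, ‖meanOutput e.θ j (x + c • d) - ystar‖ ≤ A)
    (hA' : ∀ j, ‖meanOutput e.θ j (x - c • d) - ystar‖ ≤ A) :
    0 ≤ ‖x - e.optInput ystar i‖ ^ 2 - 8 * a * (inner ℝ d (Matrix.toEuclideanLin (e.gram i)
        (x - e.optInput ystar i)) * inner ℝ (x - e.optInput ystar i) q) +
        2 * (8 * A ^ 4 + 8 * m ^ 2 * σ ^ 4) * (a / c) ^ 2 * ‖q‖ ^ 2 ∧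
    ENNReal.ofReal (‖x + c • d - e.optInput ystar i‖ ^ 2) +
      ∫⁻ z, (ENNReal.ofReal (‖x - c • d - e.optInput ystar i‖ ^ 2) +
        ∫⁻ z', ENNReal.ofReal (S * ‖x - (a * ((seenCost e.θ ystar (x + c • d) z -
          seenCost e.θ ystar (x - c • d) z') / c)) • q - e.optInput ystar i‖ ^ 2 + I)
          ∂e.nextLaw i) ∂e.nextLaw i ≤
    ENNReal.ofReal (2 * ‖x - e.optInput ystar i‖ ^ 2 + 2 * c ^ 2 * B +
      S * (‖x - e.optInput ystar i‖ ^ 2 - 8 * a * (inner ℝ d (Matrix.toEuclideanLin (e.gram i)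
        (x - e.optInput ystar i)) * inner ℝ (x - e.optInput ystar i) q) +
        2 * (8 * A ^ 4 + 8 * m ^ 2 * σ ^ 4) * (a / c) ^ 2 * ‖q‖ ^ 2) + I) := by
  set h := x - e.optInput ystar i with hh
  set D := seenCost e.θ ystar (x + c • d) with hD
  set D' := seenCost e.θ ystar (x - c • d) with hD'
  have hcent := he.centered
  have h1 := lintegral_difference_step (he.memLp_seenCost i (x + c • d))
    (he.memLp_seenCost i (x - c • d)) (fun z => seenCost_nonneg _ _ z)
    (fun z => seenCost_nonneg _ _ z) h ((a / c) • q)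
  rw [he.integral_seenCost, he.integral_seenCost, hcent.stageCost_sub, ← hD, ← hD'] at h1
  have hsq := he.integral_seenCost_sq_le i hA
  have hsq' := he.integral_seenCost_sq_le i hA'
  rw [← hD] at hsq
  rw [← hD'] at hsq'
  set φ := ‖h‖ ^ 2 - 8 * a * (inner ℝ d (Matrix.toEuclideanLin (e.gram i) h) * inner ℝ h q) +
        2 * (8 * A ^ 4 + 8 * m ^ 2 * σ ^ 4) * (a / c) ^ 2 * ‖q‖ ^ 2 with hφ
  have hle : ‖h‖ ^ 2 - 2 * (4 * c * inner ℝ d (Matrix.toEuclideanLin (e.gram i) h)) *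
      inner ℝ h ((a / c) • q) + (∫ z, D z ^ 2 ∂e.nextLaw i + ∫ z, D' z ^ 2 ∂e.nextLaw i) *
      ‖(a / c) • q‖ ^ 2 ≤ φ := by
    have e1 : ‖(a / c) • q‖ ^ 2 = (a / c) ^ 2 * ‖q‖ ^ 2 := by
      rw [norm_smul, mul_pow, Real.norm_eq_abs, sq_abs]
    have e2 : 2 * (4 * c * inner ℝ d (Matrix.toEuclideanLin (e.gram i) h)) *
        inner ℝ h ((a / c) • q) =
        8 * a * (inner ℝ d (Matrix.toEuclideanLin (e.gram i) h) * inner ℝ h q) := by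
      rw [inner_smul_right]
      field_simp
      ring
    have e3 : (∫ z, D z ^ 2 ∂e.nextLaw i + ∫ z, D' z ^ 2 ∂e.nextLaw i) * ((a / c) ^ 2 * ‖q‖ ^ 2) ≤
        2 * (8 * A ^ 4 + 8 * m ^ 2 * σ ^ 4) * ((a / c) ^ 2 * ‖q‖ ^ 2) :=
      mul_le_mul_of_nonneg_right (by linarith) (by positivity)
    rw [e1, e2, hφ]
    linarith
  have hφ0 : 0 ≤ φ := h1.1.trans hle
  refine ⟨hφ0, ?_⟩
  have hvec : ∀ z z', x - (a * ((D z - D' z') / c)) • q - e.optInput ystar i =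
      h - (D z - D' z') • ((a / c) • q) := fun z z' => by
    rw [smul_smul, show (D z - D' z') * (a / c) = a * ((D z - D' z') / c) by ring, hh]
    abel
  have hm : Measurable fun p : (Fin K × EuclideanSpace ℝ (Fin m)) ×
      (Fin K × EuclideanSpace ℝ (Fin m)) =>
      ENNReal.ofReal (‖h - (D p.1 - D' p.2) • ((a / c) • q)‖ ^ 2) := by
    have m1 : Measurable D := measurable_seenCost_right _ _
    have m2 : Measurable D' := measurable_seenCost_right _ _
    fun_prop
  have hin : ∫⁻ z, (ENNReal.ofReal (‖x - c • d - e.optInput ystar i‖ ^ 2) +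
        ∫⁻ z', ENNReal.ofReal (S * ‖x - (a * ((D z - D' z') / c)) • q - e.optInput ystar i‖ ^ 2 + I)
          ∂e.nextLaw i) ∂e.nextLaw i =
      ENNReal.ofReal (‖x - c • d - e.optInput ystar i‖ ^ 2) + (ENNReal.ofReal S *
        ∫⁻ z, ∫⁻ z', ENNReal.ofReal (‖h - (D z - D' z') • ((a / c) • q)‖ ^ 2) ∂e.nextLaw i
          ∂e.nextLaw i + ENNReal.ofReal I) := by
    simp_rw [hvec]
    exact lintegral_lintegral_affine (g := fun z z' => ‖h - (D z - D' z') • ((a / c) • q)‖ ^ 2) hm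
      (fun _ _ => sq_nonneg _) hS hI _
  rw [hin]
  have e1 : x + c • d - e.optInput ystar i = h + c • d := by rw [hh]; abel
  have e2 : x - c • d - e.optInput ystar i = h - c • d := by rw [hh]; abel
  rw [e1, e2, ← add_assoc, ← ENNReal.ofReal_add (sq_nonneg _) (sq_nonneg _)]
  have h3 : ENNReal.ofReal S * ∫⁻ z, ∫⁻ z', ENNReal.ofReal
      (‖h - (D z - D' z') • ((a / c) • q)‖ ^ 2) ∂e.nextLaw i ∂e.nextLaw i ≤
      ENNReal.ofReal (S * φ) := by
    rw [ENNReal.ofReal_mul hS]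
    gcongr
    exact h1.2.trans (ENNReal.ofReal_le_ofReal hle)
  have hpar := norm_add_sq_add_norm_sub_sq_le (h := h) (c := c) hd
  calc _ ≤ ENNReal.ofReal (2 * ‖h‖ ^ 2 + 2 * c ^ 2 * B) + (ENNReal.ofReal (S * φ) +
        ENNReal.ofReal I) := by gcongr
    _ = _ := by
      have hB : 0 ≤ B := (sq_nonneg _).trans hd
      rw [← ENNReal.ofReal_add (by positivity) hI, ← ENNReal.ofReal_add (by positivity)
        (by positivity), ← add_assoc]

/-- Averaging over the perturbation turns the cross term into -8a⟨h, G h⟩, with G the Gram matrix,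
and this yields the contraction. -/
theorem MSPSA.Valid.lintegral_iteration_le (hα : α.Valid X) (hn : 0 < n)
    (he : e.Admissible Θ X ystar σ) (i : Fin K)
    (hγ : 1 / (8 * minEigenvalue (e.gram i)) ≤ α.γ i) {b ξ A : ℝ} (hξ0 : 0 ≤ ξ)
    (hb : ∀ᵐ y ∂(α.pert : Measure ℝ), |y| ≤ b)
    (hξ : ∫⁻ y, (ENNReal.ofReal (y ^ 2))⁻¹ ∂(α.pert : Measure ℝ) ≤ ENNReal.ofReal ξ)
    {k : ℕ} (hk : 1 ≤ k) {x : EuclideanSpace ℝ (Fin n)}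
    (hA : ∀ d : EuclideanSpace ℝ (Fin n), ‖d‖ ^ 2 ≤ n * b ^ 2 → ∀ j,
      ‖meanOutput e.θ j (x + α.gain i k • d) - ystar‖ ≤ A ∧
      ‖meanOutput e.θ j (x - α.gain i k • d) - ystar‖ ≤ A)
    {S I : ℝ} (hS : 0 ≤ S) (hI : 0 ≤ I) :
    ∫⁻ v, (ENNReal.ofReal (‖x + α.gain i k • pertVec v i k - e.optInput ystar i‖ ^ 2) +
      ∫⁻ z, (ENNReal.ofReal (‖x - α.gain i k • pertVec v i k - e.optInput ystar i‖ ^ 2) +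
        ∫⁻ z', ENNReal.ofReal (S * ‖x - (α.stepSize i k *
          ((seenCost e.θ ystar (x + α.gain i k • pertVec v i k) z -
          seenCost e.θ ystar (x - α.gain i k • pertVec v i k) z') / α.gain i k)) •
            invVec (pertVec v i k) - e.optInput ystar i‖ ^ 2 + I)
          ∂e.nextLaw i) ∂e.nextLaw i) ∂α.seedMeasure ≤
    ENNReal.ofReal (2 * ‖x - e.optInput ystar i‖ ^ 2 + 2 * α.gain i k ^ 2 * (n * b ^ 2) +
      S * ((1 - 1 / (α.N i + k)) * ‖x - e.optInput ystar i‖ ^ 2 +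
        2 * (8 * A ^ 4 + 8 * m ^ 2 * σ ^ 4) * (α.stepSize i k / α.gain i k) ^ 2 * (n * ξ)) + I) := by
  set h := x - e.optInput ystar i with hh
  set a := α.stepSize i k with ha
  set c := α.gain i k with hc
  set C₄ := 2 * (8 * A ^ 4 + 8 * m ^ 2 * σ ^ 4) * (a / c) ^ 2 with hC₄
  have hc0 : 0 < c := hα.gain_pos i hk
  have ha0 : 0 ≤ a := hα.stepSize_nonneg i k
  have hC0 : 0 ≤ C₄ := by
    have := Even.pow_nonneg (by decide : Even 4) A
    have := Even.pow_nonneg (by decide : Even 4) σ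
    positivity
  obtain ⟨hi1, hv1⟩ := hα.integral_inner_mul_inner i k (Matrix.toEuclideanLin (e.gram i) h) h
  obtain ⟨hi2, hv2⟩ := MSPSA.integral_norm_invVec_sq hξ0 hξ i k
  let φ : PertSeed K n → ℝ := fun v => ‖h‖ ^ 2 - 8 * a * (inner ℝ (pertVec v i k)
    (Matrix.toEuclideanLin (e.gram i) h) * inner ℝ h (invVec (pertVec v i k))) +
      C₄ * ‖invVec (pertVec v i k)‖ ^ 2
  have hφi : Integrable φ α.seedMeasure :=
    ((integrable_const _).sub (hi1.const_mul _)).add (hi2.const_mul _)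
  have hφv : ∫ v, φ v ∂α.seedMeasure ≤ (1 - 1 / (α.N i + k)) * ‖h‖ ^ 2 + C₄ * (n * ξ) := by
    have e1 : ∫ v, φ v ∂α.seedMeasure = ‖h‖ ^ 2 - 8 * a *
        inner ℝ h (Matrix.toEuclideanLin (e.gram i) h) +
        C₄ * ∫ v, ‖invVec (pertVec v i k)‖ ^ 2 ∂α.seedMeasure := by
      have j1 : Integrable (fun v => 8 * a * (inner ℝ (pertVec v i k)
        (Matrix.toEuclideanLin (e.gram i) h) * inner ℝ h (invVec (pertVec v i k))))
        α.seedMeasure := hi1.const_mul _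
      have j2 : Integrable (fun v => C₄ * ‖invVec (pertVec v i k)‖ ^ 2) α.seedMeasure :=
        hi2.const_mul _
      have j3 : Integrable (fun v => ‖h‖ ^ 2 - 8 * a * (inner ℝ (pertVec v i k)
        (Matrix.toEuclideanLin (e.gram i) h) * inner ℝ h (invVec (pertVec v i k))))
        α.seedMeasure := (integrable_const _).sub j1
      simp only [φ]
      rw [integral_add j3 j2, integral_sub (integrable_const _) j1, integral_const_mul,
        integral_const_mul, hv1]
      simp
    have hmin := e.minEigenvalue_gram_pos hn he.full_rank i
    have h2 := minEigenvalue_mul_le (e.gram_isHermitian i) h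
    have hk1 : (1 : ℝ) ≤ k := by exact_mod_cast hk
    have hN : (0 : ℝ) < α.N i + k := by positivity
    -- The lower bound on γ is used here and is exactly what makes the contraction factor 1 - 1/(N +
    -- k).
    have h3 : 1 / (α.N i + k) ≤ 8 * a * minEigenvalue (e.gram i) := by
      rw [div_le_iff₀ (by positivity)] at hγ
      rw [ha, MSPSA.stepSize, show 8 * (α.γ i / (α.N i + k)) * minEigenvalue (e.gram i) =
        α.γ i * (8 * minEigenvalue (e.gram i)) / (α.N i + k) by ring]
      gcongr
    have h4 : 1 / (α.N i + k) * ‖h‖ ^ 2 ≤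
        8 * a * inner ℝ h (Matrix.toEuclideanLin (e.gram i) h) := by
      calc _ ≤ 8 * a * minEigenvalue (e.gram i) * ‖h‖ ^ 2 := by gcongr
        _ = 8 * a * (minEigenvalue (e.gram i) * ‖h‖ ^ 2) := by ring
        _ ≤ _ := by gcongr
    have h5 := mul_le_mul_of_nonneg_left hv2 hC0
    rw [e1]
    linarith
  have hae := ae_norm_pertVec_le hb i k
  have hpt := fun v (hv : ‖pertVec v i k‖ ^ 2 ≤ n * b ^ 2) => he.lintegral_pair_le i (x := x)
    (a := a) (q := invVec (pertVec v i k)) hc0 hS hI hv (fun j => (hA _ hv j).1) fun j => (hA _ hv j).2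
  -- The perturbation is bounded only almost surely, so the pair bound and the nonnegativity that
  -- lets `ENNReal.ofReal` leave the integral hold almost everywhere.
  calc _ ≤ ∫⁻ v, ENNReal.ofReal (2 * ‖h‖ ^ 2 + 2 * c ^ 2 * (n * b ^ 2) + S * φ v + I)
        ∂α.seedMeasure := by
        refine lintegral_mono_ae ?_
        filter_upwards [hae] with v hv
        exact (hpt v hv).2
    _ = ENNReal.ofReal (∫ v, 2 * ‖h‖ ^ 2 + 2 * c ^ 2 * (n * b ^ 2) + S * φ v + I
        ∂α.seedMeasure) := by
        rw [ofReal_integral_eq_lintegral_ofReal]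
        · exact ((integrable_const _).add (hφi.const_mul S)).add (integrable_const I)
        · filter_upwards [hae] with v hv
          have := mul_nonneg hS (hpt v hv).1
          simp only [Pi.zero_apply, φ]
          positivity
    _ = ENNReal.ofReal (2 * ‖h‖ ^ 2 + 2 * c ^ 2 * (n * b ^ 2) + S * ∫ v, φ v ∂α.seedMeasure +
        I) := by
        have j1 : Integrable (fun v => S * φ v) α.seedMeasure := hφi.const_mul S
        have j2 : Integrable (fun v => 2 * ‖h‖ ^ 2 + 2 * c ^ 2 * (n * b ^ 2) + S * φ v)
          α.seedMeasure := (integrable_const _).add j1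
        rw [integral_add j2 (integrable_const I), integral_add (integrable_const _) j1,
          integral_const_mul]
        simp
    _ ≤ _ := by gcongr

end

/-! ### A potential for the estimates of one state -/

section

variable {K m n : ℕ}

/-- A bound on the expected squared errors after visits of state `i` in the next `R` stages, when
`W R k x` bounds those that begin with the `k`-th pair of stages and the estimate `x`. -/
def MSPSA.potential (α : MSPSA K n) (ystar : EuclideanSpace ℝ (Fin m)) (e : System K m n)
    (i : Fin K) (W : ℕ → ℕ → EuclideanSpace ℝ (Fin n) → ℝ≥0∞) (R : ℕ) (M : Memory n)
    (u : PertSeed K n) : ℝ≥0∞ :=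
  if M.flag then
    ENNReal.ofReal (‖M.est - α.gain i M.count • pertVec u i M.count - e.optInput ystar i‖ ^ 2) +
      ∫⁻ z, W R (M.count + 1) (M.est - (α.stepSize i M.count * ((M.dplus -
        seenCost e.θ ystar (M.est - α.gain i M.count • pertVec u i M.count) z) /
          α.gain i M.count)) • invVec (pertVec u i M.count)) ∂e.nextLaw i
  else W R (M.count + 1) M.est

/-- `W R k x` bounds the squared errors of a pair of stages with estimate `x` plus the value of
`W (R - 1) (k + 1)` at the next estimate, in expectation. -/
structure MSPSA.IsCostBound (α : MSPSA K n) (X : Set (EuclideanSpace ℝ (Fin n)))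
    (ystar : EuclideanSpace ℝ (Fin m)) (e : System K m n) (i : Fin K)
    (W : ℕ → ℕ → EuclideanSpace ℝ (Fin n) → ℝ≥0∞) : Prop where
  meas : ∀ R k, Measurable (W R k)
  mono : ∀ R k, 1 ≤ k → ∀ x, W R k x ≤ W (R + 1) k x
  proj_le : ∀ R k, 1 ≤ k → ∀ x, W R k (proj X x) ≤ W R k x
  pair_le : ∀ R k, 1 ≤ k → ∀ x ∈ X, ∫⁻ v, (ENNReal.ofReal
      (‖x + α.gain i k • pertVec v i k - e.optInput ystar i‖ ^ 2) + ∫⁻ z, (ENNReal.ofReal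
        (‖x - α.gain i k • pertVec v i k - e.optInput ystar i‖ ^ 2) +
          ∫⁻ z', W R (k + 1) (x - (α.stepSize i k *
          ((seenCost e.θ ystar (x + α.gain i k • pertVec v i k) z -
          seenCost e.θ ystar (x - α.gain i k • pertVec v i k) z') / α.gain i k)) •
            invVec (pertVec v i k)) ∂e.nextLaw i) ∂e.nextLaw i) ∂α.seedMeasure ≤ W (R + 1) k x

/-- The squared error of the input, if the preceding state is `i`. -/
def MSPSA.stageError (α : MSPSA K n) (X : Set (EuclideanSpace ℝ (Fin n)))
    (ystar : EuclideanSpace ℝ (Fin m)) (e : System K m n) (i : Fin K) (s : ℕ → Fin K)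
    (w : ℕ × Fin K → EuclideanSpace ℝ (Fin m)) (u : PertSeed K n) (t : ℕ) : ℝ≥0∞ :=
  if s t = i then ENNReal.ofReal
    (‖α.output u i (α.run X ystar e.θ s w u t i) - e.optInput ystar i‖ ^ 2) else 0

/-- The law of state path, noise and seed under MSPSA. -/
abbrev MSPSA.sampleLaw (α : MSPSA K n) (e : System K m n) (ν : PMF (Fin K)) :
    Measure ((ℕ → Fin K) × (ℕ × Fin K → EuclideanSpace ℝ (Fin m)) × PertSeed K n) :=
  (e.chainLaw ν).prod ((Measure.infinitePi fun q : ℕ × Fin K =>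
    (e.f q.2 : Measure (EuclideanSpace ℝ (Fin m)))).prod α.seedMeasure)

theorem MSPSA.law_policy (α : MSPSA K n) (X : Set (EuclideanSpace ℝ (Fin n)))
    (ystar : EuclideanSpace ℝ (Fin m)) (e : System K m n) (ν : PMF (Fin K)) :
    e.law ν (α.policy X ystar) = α.sampleLaw e ν := rfl

variable {X : Set (EuclideanSpace ℝ (Fin n))} {ystar : EuclideanSpace ℝ (Fin m)}
  {α : MSPSA K n} {e : System K m n} {i : Fin K} {W : ℕ → ℕ → EuclideanSpace ℝ (Fin n) → ℝ≥0∞}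

theorem MSPSA.measurable_potential (hW : ∀ R k, Measurable (W R k)) (R : ℕ) {Ω : Type*}
    [MeasurableSpace Ω] {u : Ω → PertSeed K n} {M : Ω → Memory n} (hu : Measurable u)
    (hM : Measurable M) : Measurable fun ω => α.potential ystar e i W R (M ω) (u ω) := by
  obtain ⟨h1, h2, h3, h4⟩ := measurable_memory_iff.1 hM
  have hg : Measurable fun ω => α.gain i (M ω).count :=
    (measurable_of_countable fun k => α.gain i k).comp h2
  have ha : Measurable fun ω => α.stepSize i (M ω).count :=
    (measurable_of_countable fun k => α.stepSize i k).comp h2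
  have hp : Measurable fun ω => pertVec (u ω) i (M ω).count :=
    measurable_pertVec hu measurable_const h2
  have hx : Measurable fun ω => (M ω).est - α.gain i (M ω).count • pertVec (u ω) i (M ω).count :=
    h1.sub (hg.smul hp)
  refine Measurable.ite (h3 (measurableSet_singleton true)) ?_ ?_
  · refine ((hx.sub_const _).norm.pow_const 2).ennreal_ofReal.add ?_
    refine Measurable.lintegral_prod_right' (f := fun p : Ω × (Fin K × EuclideanSpace ℝ (Fin m)) =>
      W R ((M p.1).count + 1) ((M p.1).est - (α.stepSize i (M p.1).count * (((M p.1).dplus -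
        seenCost e.θ ystar ((M p.1).est - α.gain i (M p.1).count •
          pertVec (u p.1) i (M p.1).count) p.2) / α.gain i (M p.1).count)) •
            invVec (pertVec (u p.1) i (M p.1).count))) ?_
    have hd := measurable_seenCost (θ := e.θ) (ystar := ystar) (hx.comp measurable_fst)
      (measurable_snd (α := Ω) (β := Fin K × EuclideanSpace ℝ (Fin m)))
    refine measurable_apply_index (f := fun (p : Ω × (Fin K × EuclideanSpace ℝ (Fin m))) k =>
      W R (k + 1) ((M p.1).est - (α.stepSize i (M p.1).count * (((M p.1).dplus -
        seenCost e.θ ystar ((M p.1).est - α.gain i (M p.1).count •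
          pertVec (u p.1) i (M p.1).count) p.2) / α.gain i (M p.1).count)) •
            invVec (pertVec (u p.1) i (M p.1).count))) (fun k => (hW R (k + 1)).comp ?_)
        (h2.comp measurable_fst)
    exact (h1.comp measurable_fst).sub (((ha.comp measurable_fst).mul
      (((h4.comp measurable_fst).sub hd).div (hg.comp measurable_fst))).smul
        (measurable_invVec.comp (hp.comp measurable_fst)))
  · exact measurable_apply_index (f := fun ω k => W R (k + 1) (M ω).est)
      (fun k => (hW R (k + 1)).comp h1) h2

theorem MSPSA.measurable_stageError (hproj : Measurable (proj X)) (t : ℕ) :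
    Measurable fun ω : (ℕ → Fin K) × (ℕ × Fin K → EuclideanSpace ℝ (Fin m)) × PertSeed K n =>
      α.stageError X ystar e i ω.1 ω.2.1 ω.2.2 t := by
  have hs : Measurable fun ω : (ℕ → Fin K) × (ℕ × Fin K → EuclideanSpace ℝ (Fin m)) ×
      PertSeed K n => ω.1 t := (measurable_pi_apply t).comp measurable_fst
  refine Measurable.ite (measurableSet_eq_fun hs measurable_const) ?_ measurable_const
  exact (((α.measurable_output measurable_snd.snd measurable_const
    ((measurable_pi_apply i).comp (MSPSA.measurable_run hproj t))).sub_const _).norm.pow_const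
      2).ennreal_ofReal

theorem MSPSA.potential_le_succ (hmono : ∀ R k, 1 ≤ k → ∀ x, W R k x ≤ W (R + 1) k x) (R : ℕ)
    (M : Memory n) (u : PertSeed K n) :
    α.potential ystar e i W R M u ≤ α.potential ystar e i W (R + 1) M u := by
  unfold MSPSA.potential
  split_ifs
  · gcongr
    exact hmono _ _ (by omega) _
  · exact hmono _ _ (by omega) _

/-- The flagged potential already contains the error and the continuation of the second measurement;
projecting the estimate and leaving budget unused only help. This case needs no averaging over the
seed. -/
theorem MSPSA.second_stage_le (hmono : ∀ R k, 1 ≤ k → ∀ x, W R k x ≤ W (R + 1) k x)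
    (hproj : ∀ R k, 1 ≤ k → ∀ x, W R k (proj X x) ≤ W R k x) (R : ℕ) {M : Memory n}
    (hM : M.flag = true) (u : PertSeed K n) :
    ENNReal.ofReal (‖α.output u i M - e.optInput ystar i‖ ^ 2) +
      ∫⁻ z, α.potential ystar e i W R
        (α.update X u i M (seenCost e.θ ystar (α.output u i M) z)) u ∂e.nextLaw i ≤
      α.potential ystar e i W (R + 1) M u := by
  simp only [MSPSA.potential, MSPSA.output, MSPSA.update, hM, if_true, pertInv_eq,
    Bool.false_eq_true, if_false]
  gcongr
  exact (hproj _ _ (by omega) _).trans (hmono _ _ (by omega) _)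

/-- The first measurement unfolds to the left side of `pair_le` with k = count + 1; the second is
integrated in advance, with the same law because it too will follow state i. -/
theorem MSPSA.first_stage_eq (R : ℕ) {M : Memory n} (hM : M.flag = false) (u : PertSeed K n) :
    ENNReal.ofReal (‖α.output u i M - e.optInput ystar i‖ ^ 2) +
      ∫⁻ z, α.potential ystar e i W R
        (α.update X u i M (seenCost e.θ ystar (α.output u i M) z)) u ∂e.nextLaw i =
    ENNReal.ofReal (‖M.est + α.gain i (M.count + 1) • pertVec u i (M.count + 1) -
      e.optInput ystar i‖ ^ 2) + ∫⁻ z, (ENNReal.ofReal (‖M.est - α.gain i (M.count + 1) •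
        pertVec u i (M.count + 1) - e.optInput ystar i‖ ^ 2) +
      ∫⁻ z', W R (M.count + 1 + 1) (M.est - (α.stepSize i (M.count + 1) * ((seenCost e.θ ystar
        (M.est + α.gain i (M.count + 1) • pertVec u i (M.count + 1)) z -
        seenCost e.θ ystar (M.est - α.gain i (M.count + 1) • pertVec u i (M.count + 1)) z') /
          α.gain i (M.count + 1))) • invVec (pertVec u i (M.count + 1))) ∂e.nextLaw i)
            ∂e.nextLaw i := by
  simp only [MSPSA.potential, MSPSA.output, MSPSA.update, hM, if_true, Bool.false_eq_true, if_false]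

/-- When a new pair begins, the inequality holds only on average over its perturbation. Past path
and noise may be frozen, because the past of the run has not used that perturbation. -/
theorem MSPSA.lintegral_seed_le (hX : IsCompact X) (hinit : ∀ i, α.init i ∈ X)
    (hXm : Measurable (proj X)) (hb : α.IsCostBound X ystar e i W) (R t : ℕ) (s : ℕ → Fin K) (w : ℕ × Fin K → EuclideanSpace ℝ (Fin m)) :
    ∫⁻ u, (α.stageError X ystar e i s w u t + ∫⁻ z, α.potential ystar e i W R
      (α.step X ystar e.θ u (α.run X ystar e.θ s w u t) (s t) z i) u ∂e.nextLaw (s t))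
        ∂α.seedMeasure ≤
    ∫⁻ u, α.potential ystar e i W (R + 1) (α.run X ystar e.θ s w u t i) u ∂α.seedMeasure := by
  obtain ⟨hW, hmono, hproj, hcore⟩ := hb
  by_cases hi : s t = i
  swap
  · refine lintegral_mono fun u => ?_
    simp only [MSPSA.stageError, if_neg hi, zero_add, MSPSA.step,
      Function.update_of_ne (Ne.symm hi), lintegral_const, measure_univ, mul_one]
    exact MSPSA.potential_le_succ hmono R _ u
  have hH : ∀ u, α.stageError X ystar e i s w u t + ∫⁻ z, α.potential ystar e i W R
      (α.step X ystar e.θ u (α.run X ystar e.θ s w u t) (s t) z i) u ∂e.nextLaw (s t) =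
      ENNReal.ofReal (‖α.output u i (α.run X ystar e.θ s w u t i) - e.optInput ystar i‖ ^ 2) +
      ∫⁻ z, α.potential ystar e i W R (α.update X u i (α.run X ystar e.θ s w u t i)
        (seenCost e.θ ystar (α.output u i (α.run X ystar e.θ s w u t i)) z)) u
          ∂e.nextLaw i := fun u => by
    simp only [MSPSA.stageError, MSPSA.step, hi, if_true, Function.update_self]
  simp_rw [hH]
  have hcount := fun u => MSPSA.run_count (α := α) (X := X) (ystar := ystar) (θ := e.θ) s w w u
    (fun _ => 0) t i
  set M₀ := α.run X ystar e.θ s w (fun _ => 0) t i with hM₀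
  -- Counters and flags do not depend on the seed, so this case distinction, and the index k below,
  -- are the same for all seeds.
  by_cases hf : M₀.flag = true
  · exact lintegral_mono fun u => MSPSA.second_stage_le hmono hproj R ((hcount u).2.trans hf) u
  have hf' : ∀ u, (α.run X ystar e.θ s w u t i).flag = false := fun u => by
    rw [(hcount u).2]; simpa using hf
  have hrhs : ∀ u, α.potential ystar e i W (R + 1) (α.run X ystar e.θ s w u t i) u =
      W (R + 1) (M₀.count + 1) (α.run X ystar e.θ s w u t i).est := fun u => by
    simp only [MSPSA.potential, hf', Bool.false_eq_true, if_false, (hcount u).1]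
  simp_rw [hrhs, MSPSA.first_stage_eq R (hf' _), (hcount _).1]
  classical
  set k := M₀.count + 1 with hk
  -- The coordinates of the perturbation for the pair about to begin. The run so far used indices up
  -- to k - 1 for state i, hence is unaffected when they are resampled.
  let S : Set (Fin K × ℕ × Fin n) := {p | p.1 = i ∧ p.2.1 = k}
  have hrun : ∀ u v : PertSeed K n, α.run X ystar e.θ s w (S.piecewise v u) t =
      α.run X ystar e.θ s w u t := fun u v => by
    refine (MSPSA.run_congr_seed s w t fun i' k' l hk' => ?_).symm
    refine (Set.piecewise_eq_of_notMem _ _ _ fun hS => ?_).symm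
    obtain ⟨rfl, hk2⟩ := hS
    simp only at hk2
    rw [(hcount u).1] at hk'
    omega
  have hvec : ∀ u v : PertSeed K n, pertVec (S.piecewise v u) i k = pertVec v i k := fun u v => by
    simp only [pertVec]
    congr 1
    funext l
    exact Set.piecewise_eq_of_mem _ _ _ ⟨rfl, rfl⟩
  have hmeas : Measurable fun u : PertSeed K n => ENNReal.ofReal
      (‖α.output u i (α.run X ystar e.θ s w u t i) - e.optInput ystar i‖ ^ 2) +
      ∫⁻ z, α.potential ystar e i W R (α.update X u i (α.run X ystar e.θ s w u t i)
        (seenCost e.θ ystar (α.output u i (α.run X ystar e.θ s w u t i)) z)) u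
          ∂e.nextLaw i := by
    have hr : Measurable fun u : PertSeed K n => α.run X ystar e.θ s w u t i :=
      (measurable_pi_apply i).comp ((MSPSA.measurable_run hXm t).comp
        (measurable_const.prodMk (measurable_const.prodMk measurable_id)))
    have ho : Measurable fun u : PertSeed K n => α.output u i (α.run X ystar e.θ s w u t i) :=
      α.measurable_output measurable_id measurable_const hr
    refine ((ho.sub_const _).norm.pow_const 2).ennreal_ofReal.add ?_
    refine Measurable.lintegral_prod_right' (f := fun p : PertSeed K n ×
      (Fin K × EuclideanSpace ℝ (Fin m)) => α.potential ystar e i W R (α.update X p.1 i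
        (α.run X ystar e.θ s w p.1 t i)
        (seenCost e.θ ystar (α.output p.1 i (α.run X ystar e.θ s w p.1 t i)) p.2)) p.1) ?_
    exact MSPSA.measurable_potential hW R measurable_fst (α.measurable_update hXm measurable_fst
      measurable_const (hr.comp measurable_fst) (measurable_seenCost (ho.comp measurable_fst)
        measurable_snd))
  simp_rw [MSPSA.first_stage_eq R (hf' _), (hcount _).1, ← hk] at hmeas
  rw [MSPSA.seedMeasure, lintegral_infinitePi_resample _ S hmeas]
  refine lintegral_mono fun u => ?_
  simp_rw [hrun, hvec]
  exact hcore R k (by omega) _ (MSPSA.run_invariant hX hinit s w u t i).1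

theorem lintegral_prod_prod_mono {A B C : Type*} [MeasurableSpace A] [MeasurableSpace B]
    [MeasurableSpace C] {μA : Measure A} {μB : Measure B} {μC : Measure C} [SFinite μA] [SFinite μB]
    [SFinite μC] {F G : A × B × C → ℝ≥0∞} (hF : Measurable F) (hG : Measurable G)
    (h : ∀ a b, ∫⁻ c, F (a, b, c) ∂μC ≤ ∫⁻ c, G (a, b, c) ∂μC) :
    ∫⁻ p, F p ∂μA.prod (μB.prod μC) ≤ ∫⁻ p, G p ∂μA.prod (μB.prod μC) := by
  rw [lintegral_prod _ hF.aemeasurable, lintegral_prod _ hG.aemeasurable]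
  refine lintegral_mono fun a => ?_
  have hFa : Measurable fun q => F (a, q) := hF.comp measurable_prodMk_left
  have hGa : Measurable fun q => G (a, q) := hG.comp measurable_prodMk_left
  rw [lintegral_prod _ hFa.aemeasurable, lintegral_prod _ hGa.aemeasurable]
  exact lintegral_mono fun b => h a b

/-- A supermartingale inequality with R as budget. A stage starts at most one pair of state i, so
lowering R by one per stage suffices for every path, and the random number of visits never enters.
-/
theorem MSPSA.lintegral_stage_le (hX : IsCompact X) (hinit : ∀ i, α.init i ∈ X)
    (hXm : Measurable (proj X)) (hb : α.IsCostBound X ystar e i W) (ν : PMF (Fin K)) (R t : ℕ) :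
    ∫⁻ ω, α.stageError X ystar e i ω.1 ω.2.1 ω.2.2 t ∂α.sampleLaw e ν +
      ∫⁻ ω, α.potential ystar e i W R (α.run X ystar e.θ ω.1 ω.2.1 ω.2.2 (t + 1) i) ω.2.2
        ∂α.sampleLaw e ν ≤
    ∫⁻ ω, α.potential ystar e i W (R + 1) (α.run X ystar e.θ ω.1 ω.2.1 ω.2.2 t i) ω.2.2
      ∂α.sampleLaw e ν := by
  have hstep : Measurable fun q : ((ℕ → Fin K) × (ℕ × Fin K → EuclideanSpace ℝ (Fin m)) ×
      PertSeed K n) × (Fin K × EuclideanSpace ℝ (Fin m)) => α.potential ystar e i W R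
        (α.step X ystar e.θ q.1.2.2 (α.run X ystar e.θ q.1.1 q.1.2.1 q.1.2.2 t) (q.1.1 t) q.2 i)
          q.1.2.2 := by
    refine MSPSA.measurable_potential hb.meas R measurable_fst.snd.snd
      ((measurable_pi_apply i).comp (MSPSA.measurable_step hXm measurable_fst.snd.snd
        ((MSPSA.measurable_run hXm t).comp measurable_fst)
          ((measurable_pi_apply t).comp measurable_fst.fst) measurable_snd))
  have hnext := System.lintegral_law_next e ν (α.policy X ystar) t
    (F := fun s w u z => α.potential ystar e i W R
      (α.step X ystar e.θ u (α.run X ystar e.θ s w u t) (s t) z i) u) hstep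
    (fun s s' h => by
      funext w u z
      rw [MSPSA.run_congr (w := w) (w' := w) u t h fun _ _ _ => rfl, h t le_rfl])
    (fun s w w' h => by
      funext u z
      rw [MSPSA.run_congr (s := s) (s' := s) u t (fun _ _ => rfl) h])
  rw [MSPSA.law_policy] at hnext
  change ∫⁻ ω, α.potential ystar e i W R (α.run X ystar e.θ ω.1 ω.2.1 ω.2.2 (t + 1) i) ω.2.2
    ∂α.sampleLaw e ν = ∫⁻ ω, ∫⁻ z, α.potential ystar e i W R (α.step X ystar e.θ ω.2.2
      (α.run X ystar e.θ ω.1 ω.2.1 ω.2.2 t) (ω.1 t) z i) ω.2.2 ∂e.nextLaw (ω.1 t)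
        ∂α.sampleLaw e ν at hnext
  have hkern : Measurable fun ω : (ℕ → Fin K) × (ℕ × Fin K → EuclideanSpace ℝ (Fin m)) ×
      PertSeed K n => ∫⁻ z, α.potential ystar e i W R (α.step X ystar e.θ ω.2.2
      (α.run X ystar e.θ ω.1 ω.2.1 ω.2.2 t) (ω.1 t) z i) ω.2.2 ∂e.nextLaw (ω.1 t) :=
    measurable_apply_index (f := fun (ω : (ℕ → Fin K) × (ℕ × Fin K → EuclideanSpace ℝ (Fin m)) ×
      PertSeed K n) j => ∫⁻ z, α.potential ystar e i W R (α.step X ystar e.θ ω.2.2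
      (α.run X ystar e.θ ω.1 ω.2.1 ω.2.2 t) (ω.1 t) z i) ω.2.2 ∂e.nextLaw j)
      (fun j => hstep.lintegral_prod_right') ((measurable_pi_apply t).comp measurable_fst)
  have herr := MSPSA.measurable_stageError (m := m) (α := α) (ystar := ystar) (e := e) (i := i)
    hXm t
  have hpot : Measurable fun ω : (ℕ → Fin K) × (ℕ × Fin K → EuclideanSpace ℝ (Fin m)) ×
      PertSeed K n => α.potential ystar e i W (R + 1)
        (α.run X ystar e.θ ω.1 ω.2.1 ω.2.2 t i) ω.2.2 :=
    MSPSA.measurable_potential hb.meas (R + 1) measurable_snd.snd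
      ((measurable_pi_apply i).comp (MSPSA.measurable_run hXm t))
  rw [hnext, ← lintegral_add_left herr]
  exact lintegral_prod_prod_mono (herr.add hkern) hpot fun s w =>
    MSPSA.lintegral_seed_le hX hinit hXm hb R t s w

theorem MSPSA.sum_lintegral_stageError_le (hX : IsCompact X) (hinit : ∀ i, α.init i ∈ X)
    (hXm : Measurable (proj X)) (hb : α.IsCostBound X ystar e i W) (ν : PMF (Fin K)) (T : ℕ) :
    ∑ t ∈ Finset.range T, ∫⁻ ω, α.stageError X ystar e i ω.1 ω.2.1 ω.2.2 t ∂α.sampleLaw e ν ≤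
      W T 1 (α.init i) := by
  have h : ∀ R t, ∑ r ∈ Finset.range R,
      ∫⁻ ω, α.stageError X ystar e i ω.1 ω.2.1 ω.2.2 (t + r) ∂α.sampleLaw e ν ≤
      ∫⁻ ω, α.potential ystar e i W R (α.run X ystar e.θ ω.1 ω.2.1 ω.2.2 t i) ω.2.2
        ∂α.sampleLaw e ν := by
    intro R
    induction R with
    | zero => intro t; simp
    | succ R ih =>
      intro t
      refine le_trans ?_ (MSPSA.lintegral_stage_le hX hinit hXm hb ν R t)
      rw [Finset.sum_range_succ', add_comm, add_zero]
      refine add_le_add_right ((le_of_eq ?_).trans (ih (t + 1))) _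
      exact Finset.sum_congr rfl fun r _ => by rw [show t + (r + 1) = t + 1 + r by ring]
  have h0 := h T 0
  simp only [zero_add, MSPSA.run, MSPSA.potential, Bool.false_eq_true, if_false, lintegral_const,
    measure_univ, mul_one] at h0
  exact h0

/-- At each stage exactly one state precedes, so the error splits into contributions of separate
states, each with its own potential. -/
theorem MSPSA.cumMSE_eq (hXm : Measurable (proj X)) (ν : PMF (Fin K)) (T : ℕ) :
    cumMSE ystar ν e (α.policy X ystar) T = ∑ i, ∑ t ∈ Finset.range T,
      ∫⁻ ω, α.stageError X ystar e i ω.1 ω.2.1 ω.2.2 t ∂α.sampleLaw e ν := by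
  rw [cumMSE, Finset.sum_comm]
  simp_rw [← lintegral_finsetSum Finset.univ fun i _ =>
    MSPSA.measurable_stageError (m := m) (α := α) (ystar := ystar) (e := e) (i := i) hXm _]
  rw [← lintegral_finsetSum _ fun t _ => Finset.measurable_fun_sum _ fun i _ =>
    MSPSA.measurable_stageError (m := m) (α := α) (ystar := ystar) (e := e) (i := i) hXm t]
  refine lintegral_congr fun ω => ?_
  rw [ENNReal.ofReal_sum_of_nonneg fun t _ => sq_nonneg _]
  refine Finset.sum_congr rfl fun t _ => ?_
  rw [MSPSA.input_policy]
  simp only [MSPSA.stageError, Finset.sum_ite_eq, Finset.mem_univ, if_true]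

end

/-! ### Order-optimality of MSPSA -/

section

variable {K m n : ℕ} {Θ : Set (Params K m n)} {X : Set (EuclideanSpace ℝ (Fin n))}
  {ystar : EuclideanSpace ℝ (Fin m)} {σ : ℝ}

theorem exists_params_bound (hΘ : IsCompact Θ) : ∃ c : ℝ, 0 ≤ c ∧ ∀ θ ∈ Θ, ∀ j,
    (∀ x, ‖Matrix.toEuclideanLin (θ j).1 x‖ ≤ c * ‖x‖) ∧ ‖(θ j).2‖ ≤ c := by
  let L : Matrix (Fin m) (Fin n) ℝ →ₗ[ℝ]
      (EuclideanSpace ℝ (Fin n) →L[ℝ] EuclideanSpace ℝ (Fin m)) :=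
    LinearMap.toContinuousLinearMap.toLinearMap ∘ₗ Matrix.toEuclideanLin.toLinearMap
  have hL : Continuous L := L.continuous_of_finiteDimensional
  have hc : Continuous fun θ : Params K m n => ∑ j, (‖L (θ j).1‖ + ‖(θ j).2‖) :=
    continuous_finsetSum _ fun j _ =>
      ((hL.comp (continuous_fst.comp (continuous_apply j))).norm.add
        (continuous_snd.comp (continuous_apply j)).norm)
  obtain ⟨c, hcb⟩ := hΘ.exists_bound_of_continuousOn hc.continuousOn
  refine ⟨max c 0, le_max_right _ _, fun θ hθ j => ?_⟩
  have h1 : ‖L (θ j).1‖ + ‖(θ j).2‖ ≤ max c 0 :=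
    (Finset.single_le_sum (f := fun j => ‖L (θ j).1‖ + ‖(θ j).2‖) (fun j _ => by positivity)
      (Finset.mem_univ j)).trans ((le_abs_self _).trans ((hcb θ hθ).trans (le_max_left _ _)))
  refine ⟨fun x => ((L (θ j).1).le_opNorm x).trans ?_, by linarith [norm_nonneg (L (θ j).1)]⟩
  gcongr
  linarith [norm_nonneg (θ j).2]

/-- The excess cost is the Gram quadratic form of the input error, and compactness of Θ bounds it
uniformly. -/
theorem regret_le_mul_cumMSE {c : ℝ} {e : System K m n}
    (he : e.Admissible Θ X ystar σ)
    (hc : ∀ j x, ‖Matrix.toEuclideanLin (e.θ j).1 x‖ ≤ c * ‖x‖) (ν : PMF (Fin K))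
    (μ : Policy K m n) (T : ℕ) :
    regret ystar ν e μ T ≤ ENNReal.ofReal (c ^ 2) * cumMSE ystar ν e μ T := by
  rw [regret, cumMSE, ← lintegral_const_mul' _ _ ENNReal.ofReal_ne_top]
  refine lintegral_mono fun ω => ?_
  rw [← ENNReal.ofReal_mul (sq_nonneg _)]
  refine ENNReal.ofReal_le_ofReal ?_
  rw [← Finset.sum_sub_distrib, Finset.mul_sum]
  refine Finset.sum_le_sum fun t _ => ?_
  rw [he.centered.stageCost_eq, add_sub_cancel_left]
  set h := μ.input e.θ ω t - e.optInput ystar (ω.1 t)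
  calc _ ≤ ∑ j, e.p (ω.1 t) j * (c * ‖h‖) ^ 2 := by
        refine Finset.sum_le_sum fun j _ => mul_le_mul_of_nonneg_left ?_ (e.p_nonneg _ _)
        exact pow_le_pow_left₀ (norm_nonneg _) (hc j h) 2
    _ = _ := by rw [← Finset.sum_mul, e.sum_p, one_mul, mul_pow]

/-- W is affine in the squared error, with the coefficients `slope` and `intercept`. All constants
come from Θ, X, σ, y* and the parameters of MSPSA before a system is chosen, which makes the bound
uniform. -/
theorem MSPSA.Valid.exists_costBound {α : MSPSA K n} (hα : α.Valid X) (hn : 0 < n)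
    (hΘ : IsCompact Θ) (hX : IsCompact X) (hXc : Convex ℝ X) (i : Fin K) :
    ∃ C : ℝ, 0 ≤ C ∧ ∀ e : System K m n, e.Admissible Θ X ystar σ →
      1 / (8 * minEigenvalue (e.gram i)) ≤ α.γ i →
      ∃ W, α.IsCostBound X ystar e i W ∧ ∀ T : ℕ, W T 1 (α.init i) ≤ ENNReal.ofReal (C * √T) := by
  obtain ⟨Λ, hΛ0, hΛ⟩ := exists_params_bound hΘ
  obtain ⟨r, hr⟩ := hX.isBounded.exists_norm_le
  obtain ⟨b, hb⟩ := hα.pert_bdd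
  obtain ⟨ξ', hξ'⟩ := hα.pert_inv
  set ξ := max ξ' 0
  have hξ0 : 0 ≤ ξ := le_max_right _ _
  have hξ := hξ'.trans (ENNReal.ofReal_le_ofReal (le_max_left ξ' 0))
  -- Bounds the mean residual at every input applied: estimates have norm at most r, and
  -- perturbations have squared norm at most γ'² n b².
  set A := Λ * (r + √(α.γ' i ^ 2 * (n * b ^ 2))) + Λ + ‖ystar‖ with hA
  set C₄ := 2 * (8 * A ^ 4 + 8 * m ^ 2 * σ ^ 4) with hC₄
  have hC0 : 0 ≤ C₄ := by
    have := Even.pow_nonneg (by decide : Even 4) A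
    have := Even.pow_nonneg (by decide : Even 4) σ
    positivity
  let ρ : ℕ → ℝ := fun k => 1 - 1 / (α.N i + k)
  let β : ℕ → ℝ := fun k => 2 * α.gain i k ^ 2 * (n * b ^ 2)
  let δ : ℕ → ℝ := fun k => C₄ * (α.stepSize i k / α.gain i k) ^ 2 * (n * ξ)
  have hN : (0 : ℝ) ≤ α.N i := Nat.cast_nonneg _
  have hρ : ∀ k, 1 ≤ k → 0 ≤ ρ k := fun k hk => by
    have hk1 : (1 : ℝ) ≤ k := by exact_mod_cast hk
    simp only [ρ, sub_nonneg]
    rw [div_le_one (by positivity)]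
    linarith
  have hβ : ∀ k, 0 ≤ β k := fun k => by positivity
  have hδ : ∀ k, 0 ≤ δ k := fun k => by positivity
  set D := C₄ * ((α.γ i / α.γ' i) ^ 2 * √(α.N' i + 1)) * (n * ξ) with hD
  have hD0 : 0 ≤ D := by positivity
  -- The first summand is what `rate_step` requires; the second covers the initial squared error, at
  -- most (2r)².
  set Q := 2 * D + (2 * r) ^ 2 * √(α.N i + 1) with hQ
  have hQ0 : 0 ≤ Q := by positivity
  set B := 2 * α.γ' i ^ 2 * (n * b ^ 2) with hB
  have hB0 : 0 ≤ B := by positivity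
  refine ⟨(2 * Q + B) * 2, by positivity, fun e he hγ => ?_⟩
  refine ⟨fun R k x => ENNReal.ofReal
    (slope ρ R k * ‖x - e.optInput ystar i‖ ^ 2 + intercept ρ β δ R k), ⟨?_, ?_, ?_, ?_⟩, ?_⟩
  · intro R k
    fun_prop
  · intro R k hk x
    refine ENNReal.ofReal_le_ofReal (add_le_add ?_ (intercept_le_succ hρ hβ hδ R k hk))
    exact mul_le_mul_of_nonneg_right (slope_le_succ hρ R k hk) (sq_nonneg _)
  · intro R k hk x
    refine ENNReal.ofReal_le_ofReal (add_le_add_left (mul_le_mul_of_nonneg_left ?_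
      (slope_nonneg hρ R k hk)) _)
    exact pow_le_pow_left₀ (norm_nonneg _) (norm_proj_sub_le hX hXc x (he.optInput_mem i)) 2
  · intro R k hk x hx
    refine (hα.lintegral_iteration_le hn he i hγ hξ0 hb hξ hk (A := A) ?_
      (slope_nonneg hρ R (k + 1) (by omega))
      (intercept_nonneg hρ hβ hδ R (k + 1) (by omega))).trans (le_of_eq ?_)
    · intro d hd j
      have h1 : ‖α.gain i k • d‖ ≤ √(α.γ' i ^ 2 * (n * b ^ 2)) := by
        refine Real.le_sqrt_of_sq_le ?_
        rw [norm_smul, mul_pow, Real.norm_eq_abs, sq_abs]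
        exact mul_le_mul (α.gain_sq_le' i hk) hd (sq_nonneg _) (sq_nonneg _)
      have h2 : ∀ y, ‖y‖ ≤ r + √(α.γ' i ^ 2 * (n * b ^ 2)) →
          ‖meanOutput e.θ j y - ystar‖ ≤ A := fun y hy => by
        obtain ⟨h3, h4⟩ := hΛ e.θ he.mem_params j
        refine (norm_sub_le _ _).trans ?_
        have h5 := norm_add_le (Matrix.toEuclideanLin (e.θ j).1 y) (e.θ j).2
        have h6 := mul_le_mul_of_nonneg_left hy hΛ0
        have h7 := h3 y
        simp only [meanOutput, hA]
        linarith
      exact ⟨h2 _ ((norm_add_le _ _).trans (add_le_add (hr x hx) h1)),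
        h2 _ ((norm_sub_le _ _).trans (add_le_add (hr x hx) h1))⟩
    · simp only [slope, intercept, ρ, β, δ, hC₄]
      congr 1
      ring
  · intro T
    refine ENNReal.ofReal_le_ofReal ?_
    have hinit : ‖α.init i - e.optInput ystar i‖ ^ 2 ≤ Q / √(α.N i + (1 : ℕ)) := by
      rw [Nat.cast_one, le_div_iff₀ (Real.sqrt_pos.2 (by linarith))]
      have h1 : ‖α.init i - e.optInput ystar i‖ ≤ 2 * r := by
        have := norm_sub_le (α.init i) (e.optInput ystar i)
        linarith [hr _ (hα.init_mem i), hr _ (he.optInput_mem i)]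
      have h2 := pow_le_pow_left₀ (norm_nonneg _) h1 2
      have h3 := mul_le_mul_of_nonneg_right h2 (Real.sqrt_nonneg (α.N i + 1 : ℝ))
      linarith
    -- The comparison sequence Q/√(N + k) has the order of both the error and the squared gain, so
    -- each pair costs O(k^(-1/2)).
    refine (slope_mul_add_intercept_le (r := fun k => Q / √(α.N i + k)) hρ (fun k hk => ?_) T 1
      le_rfl hinit).trans ?_
    · have hk1 : (1 : ℝ) ≤ k := by exact_mod_cast hk
      have h1 : δ k ≤ D / ((α.N i + k) * √(α.N i + k)) := by
        have := mul_le_mul_of_nonneg_right (mul_le_mul_of_nonneg_left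
          (hα.stepSize_div_gain_sq_le i hk) hC0) (show 0 ≤ n * ξ by positivity)
        refine this.trans (le_of_eq ?_)
        rw [hD]
        ring
      have h2 := rate_step (κ := α.N i + k) (D := D) (Q := Q) (by linarith)
        (by rw [hQ]; linarith [show 0 ≤ (2 * r) ^ 2 * √(α.N i + 1 : ℝ) by positivity]) hQ0
      push_cast
      rw [← add_assoc]
      exact (add_le_add_right h1 _).trans h2
    · calc _ ≤ ∑ l ∈ Finset.range T, (2 * Q + B) * (1 / √(1 + l : ℝ)) := by
            refine Finset.sum_le_sum fun l _ => ?_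
            have h1 : Q / √(α.N i + ((1 + l : ℕ) : ℝ)) ≤ Q * (1 / √(1 + l : ℝ)) := by
              rw [← mul_one_div]
              refine mul_le_mul_of_nonneg_left (one_div_le_one_div_of_le
                (Real.sqrt_pos.2 (by positivity)) (Real.sqrt_le_sqrt ?_)) hQ0
              push_cast
              linarith
            have h2 : β (1 + l) ≤ B * (1 / √(1 + l : ℝ)) := by
              have := α.gain_sq_le i (k := 1 + l) (by omega)
              push_cast at this
              calc β (1 + l) ≤ 2 * (α.γ' i ^ 2 * (1 / √(1 + l : ℝ))) * (n * b ^ 2) := by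
                    simp only [β]
                    gcongr
                _ = _ := by rw [hB]; ring
            linarith
        _ ≤ (2 * Q + B) * (2 * √T) := by
            rw [← Finset.mul_sum]
            exact mul_le_mul_of_nonneg_left (sum_inv_sqrt_le T) (by positivity)
        _ = _ := by ring

theorem MSPSA.Valid.exists_worstRegret_le {α : MSPSA K n} (hα : α.Valid X) (hn : 0 < n)
    (hΘ : IsCompact Θ) (hX : IsCompact X) (hXc : Convex ℝ X) (hXm : Measurable (proj X))
    (hγ : ∀ e : System K m n, e.Admissible Θ X ystar σ → ∀ i,
      1 / (8 * minEigenvalue (e.gram i)) ≤ α.γ i) :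
    ∃ C > (0 : ℝ), ∀ (ν : PMF (Fin K)) (T : ℕ),
      worstRegret Θ X ystar σ ν (α.policy X ystar) T ≤ ENNReal.ofReal (C * √T) := by
  obtain ⟨Λ, -, hΛ⟩ := exists_params_bound hΘ
  choose C hC0 hC using hα.exists_costBound (ystar := ystar) (σ := σ) hn hΘ hX hXc
  have hsum : 0 ≤ ∑ i, C i := Finset.sum_nonneg fun i _ => hC0 i
  -- The 1 only serves to make the constant strictly positive.
  refine ⟨Λ ^ 2 * ∑ i, C i + 1, by positivity, fun ν T => iSup₂_le fun e he => ?_⟩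
  have hmse : cumMSE ystar ν e (α.policy X ystar) T ≤ ENNReal.ofReal ((∑ i, C i) * √T) := by
    rw [MSPSA.cumMSE_eq hXm, Finset.sum_mul,
      ENNReal.ofReal_sum_of_nonneg fun i _ => mul_nonneg (hC0 i) (Real.sqrt_nonneg _)]
    refine Finset.sum_le_sum fun i _ => ?_
    obtain ⟨W, hW, hT⟩ := hC i e he (hγ e he i)
    exact (MSPSA.sum_lintegral_stageError_le hX hα.init_mem hXm hW ν T).trans (hT T)
  refine (regret_le_mul_cumMSE he (fun j => (hΛ e.θ he.mem_params j).1) ν _ T).trans ?_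
  calc _ ≤ ENNReal.ofReal (Λ ^ 2) * ENNReal.ofReal ((∑ i, C i) * √T) := by gcongr
    _ = ENNReal.ofReal (Λ ^ 2 * ((∑ i, C i) * √T)) := (ENNReal.ofReal_mul (sq_nonneg _)).symm
    _ ≤ _ := by
      refine ENNReal.ofReal_le_ofReal ?_
      have := Real.sqrt_nonneg (T : ℝ)
      linarith

end

end JumpAffine

end

/-! ### The two bounds combined -/

theorem mainTheorem4 {K m n : ℕ} (hK : 1 < K) (hn : 0 < n)
    (Θ : Set (JumpAffine.Params K m n)) (hΘ : IsCompact Θ)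
    (X : Set (EuclideanSpace ℝ (Fin n))) (hX : IsCompact X) (hXc : Convex ℝ X)
    (ystar : EuclideanSpace ℝ (Fin m)) (σ : ℝ) (hσ : 0 < σ)
    (hint : ∃ e : JumpAffine.System K m n, e.Admissible Θ X ystar σ ∧
      e.θ ∈ interior Θ ∧ ∀ i, e.optInput ystar i ∈ interior X) :
    (∃ C' > (0 : ℝ), ∃ C'' > (0 : ℝ), ∀ (ν : PMF (Fin K)) (μ : JumpAffine.Policy K m n),
      μ.IsMeasurable → ∀ T : ℕ,
        ENNReal.ofReal (C' * √T) ≤ JumpAffine.worstMSE Θ X ystar σ ν μ T ∧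
        ENNReal.ofReal (C'' * √T) ≤ JumpAffine.worstRegret Θ X ystar σ ν μ T) ∧
    (∀ α : JumpAffine.MSPSA K n, α.Valid X →
      (α.policy X ystar).IsMeasurable ∧
      ((∀ e : JumpAffine.System K m n, e.Admissible Θ X ystar σ → ∀ i,
          1 / (8 * JumpAffine.minEigenvalue (e.gram i)) ≤ α.γ i) →
        ∃ c > (0 : ℝ), ∃ C > (0 : ℝ), ∀ (ν : PMF (Fin K)) (T : ℕ),
          ENNReal.ofReal (c * √T) ≤
            JumpAffine.worstRegret Θ X ystar σ ν (α.policy X ystar) T ∧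
          JumpAffine.worstRegret Θ X ystar σ ν (α.policy X ystar) T ≤
            ENNReal.ofReal (C * √T))) := by
  have hlow := JumpAffine.exists_worst_lower_bounds hK hn hσ hint
  refine ⟨hlow, fun α hα => ?_⟩
  have hproj : Measurable (JumpAffine.proj X) :=
    JumpAffine.measurable_proj hX hXc ⟨_, hα.init_mem ⟨0, by omega⟩⟩
  have hmeas : (α.policy X ystar).IsMeasurable := α.isMeasurable_policy hproj ystar
  refine ⟨hmeas, fun hγ => ?_⟩
  obtain ⟨_, _, c, hc, hreg⟩ := hlow
  obtain ⟨C, hC, hup⟩ := hα.exists_worstRegret_le hn hΘ hX hXc hproj hγ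
  exact ⟨c, hc, C, hC, fun ν T => ⟨(hreg ν _ hmeas T).2, hup ν T⟩⟩
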